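/- Conventions. Model categories have all small limits and colimits and functorial factorizations. A Quillen pair is an adjunction $L\dashv R$ between model categories whose left adjoint $L$ preserves cofibrations and trivial cofibrations. A category is contractible if the geometric realization of its nerve is contractible. Let $\mathcal C$ be a small category. Equip $\mathrm{sSet}^{\mathcal C}$ with the Bousfield–Kan model structure: weak equivalences and fibrations are the maps that are objectwise weak equivalences, respectively Kan fibrations, of simplicial sets, and cofibrations are the maps with the left lifting property with respect to the trivial fibrations. Let $V\mathcal C=(\mathrm{sSet}^{\mathcal C})^{op}$ with the opposite model structure, and let $r\colon\mathcal C\to V\mathcal C$ be the Yoneda embedding, $rX=\mathcal C(X,-)$ regarded as a diagram of discrete simplicial sets. For $n\ge 0$ let $rX\otimes\Delta^n$ be the object of $V\mathcal C$ given by the diagram $Z\mapsto \mathcal C(X,Z)\times\Delta^n$; the objects $rX\otimes\Delta^\bullet$ form a simplicial object of $V\mathcal C$, with maps $rX\to rX\otimes\Delta^n$ in $V\mathcal C$ opposite to the projections. Let $\mathcal M$ be a model category and $\gamma\colon\mathcal C\to\mathcal M$ a functor. A co-factorization of $\gamma$ through $V\mathcal C$ is a Quillen pair $L\colon\mathcal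 M\rightleftarrows V\mathcal C\colon R$ together with a natural weak equivalence $\eta\colon\gamma\to R\circ r$; a map $(L,R,\eta)\to(L',R',\eta')$ is a natural transformation $\tau\colon R\to R'$ with $\tau_{rX}\circ\eta_X=\eta'_X$ for all $X\in\mathcal C$. A simplicial resolution of $\gamma$ is a functor $\Phi\colon\mathcal C\to s\mathcal M$ to simplicial objects of $\mathcal M$ such that every $\Phi(X)$ is Reedy fibrant, together with a natural map $c_*\gamma(X)\to\Phi(X)$ from the constant simplicial object that is a weak equivalence in every degree; a map of simplicial resolutions is a natural transformation $\Phi\to\Phi'$ compatible with the maps from $c_*\gamma$. Proposition. (a) There is a co-factorization of $\gamma$ through $V\mathcal C$, and the category of all such co-factorizations is contractible. (b) The category of co-factorizations of $\gamma$ through $V\mathcal C$ is naturally equivalent to the category of simplicial resolutions of $\gamma$: there is an equivalence of categories which, up to natural isomorphism, sends $(L,R,\eta)$ to the simplicial resolution $X\mapsto\big([n]\mapsto R(rX\otimes\Delta^n)\big)$ with the structure maps $\gamma(X)\xrightarrow{\eta_X}R(rX)\to R(rX\otimes\Delta^n)$. -/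

import Mathlib

open CategoryTheory Limits HomotopicalAlgebra MonoidalCategory CartesianMonoidalCategory
open Opposite Simplicial
open scoped SSet.modelCategoryQuillen

universe v u v' u' w

/-! ## The Kan-Quillen model structure on simplicial sets

The cofibrations (monomorphisms) and the fibrations (Kan fibrations) are Mathlib's. -/

/-- The weak equivalences of the Kan-Quillen model structure on simplicial sets. A model
structure is determined by its cofibrations and its fibrations: the trivial cofibrations are
the maps with the left lifting property with respect to all fibrations (here: the anodyne
extensions), the trivial fibrations are the maps with the right lifting property with respect to
all cofibrations (here: to all monomorphisms), and the weak equivalences are the composites of a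
trivial cofibration followed by a trivial fibration. -/
instance SSet.categoryWithWeakEquivalencesKanQuillen :
    CategoryWithWeakEquivalences SSet.{w} where
  weakEquivalences _ _ f :=
    Nonempty (SSet.anodyneExtensions.MapFactorizationData
      (MorphismProperty.monomorphisms SSet.{w}).rlp f)

/-! ## The Bousfield-Kan model structure on diagrams of simplicial sets -/

namespace BousfieldKan

variable (C : Type u) [Category.{v} C]

/-- Objectwise weak equivalences. -/
instance : CategoryWithWeakEquivalences (C ⥤ SSet.{w}) where
  weakEquivalences _ _ f := ∀ X : C, WeakEquivalence (f.app X)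

/-- Objectwise fibrations. -/
instance : CategoryWithFibrations (C ⥤ SSet.{w}) where
  fibrations _ _ f := ∀ X : C, Fibration (f.app X)

/-- The maps with the left lifting property with respect to the trivial fibrations. -/
instance : CategoryWithCofibrations (C ⥤ SSet.{w}) where
  cofibrations := (trivialFibrations (C ⥤ SSet.{w})).llp

end BousfieldKan

/-- The category `VC = [sSet^C]ᵒᵖ`. Its cofibrations, fibrations and weak equivalences are those
of the opposite of the Bousfield-Kan structure, through Mathlib's instances on opposites. -/
abbrev VCat (C : Type v) [SmallCategory C] : Type (v + 1) := (C ⥤ SSet.{v})ᵒᵖ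

namespace VCat

variable (C : Type v) [SmallCategory C]

/-- `X ↦ C(X, -)`, as a diagram of discrete simplicial sets. -/
def discreteCoyoneda : Cᵒᵖ ⥤ C ⥤ SSet.{v} :=
  coyoneda ⋙ (Functor.whiskeringRight C (Type v) SSet.{v}).obj (SimplicialObject.const (Type v))

/-- The Yoneda embedding `r : C ⥤ VC`. -/
def r : C ⥤ VCat C := (discreteCoyoneda C).rightOp

/-- The constant diagrams on the standard simplices. -/
def constSimplex : SimplexCategory ⥤ C ⥤ SSet.{v} := SSet.stdSimplex ⋙ Functor.const C

/-- The functor which sends `X` to the simplicial object `[n] ↦ rX ⊗ Δ[n]` of `VC`; here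
`(rX ⊗ Δ[n])(Z) = C(X, Z) × Δ[n]`, which is covariant in `[n]` in the category of diagrams,
hence contravariant in `VC`. -/
def tensorSimplex : C ⥤ SimplicialObject (VCat C) where
  obj X :=
    { obj := fun n => op ((discreteCoyoneda C).obj (op X) ⊗ (constSimplex C).obj n.unop)
      map := fun φ => ((discreteCoyoneda C).obj (op X) ◁ (constSimplex C).map φ.unop).op }
  map f :=
    { app := fun n => ((discreteCoyoneda C).map f.op ▷ (constSimplex C).obj n.unop).op
      naturality := fun _ _ _ => Quiver.Hom.unop_inj (whisker_exchange _ _).symm }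

/-- The maps `rX ⟶ rX ⊗ Δ[n]` of `VC` that are opposite to the projections. -/
def toTensorSimplex :
    r C ⋙ SimplicialObject.const (VCat C) ⟶ tensorSimplex C where
  app X :=
    { app := fun n =>
        (fst ((discreteCoyoneda C).obj (op X)) ((constSimplex C).obj n.unop)).op
      naturality := fun _ _ φ => Quiver.Hom.unop_inj
        ((Category.comp_id _).trans
          (whiskerLeft_fst ((discreteCoyoneda C).obj (op X))
            ((constSimplex C).map φ.unop)).symm) }
  naturality _ _ f := by
    ext n : 2
    exact Quiver.Hom.unop_inj
      (whiskerRight_fst ((discreteCoyoneda C).map f.op) ((constSimplex C).obj n.unop)).symm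

end VCat

/-! ## Quillen pairs and co-factorizations -/

section

variable {M : Type u} [Category.{v} M] [CategoryWithCofibrations M]
  [CategoryWithWeakEquivalences M]
  {N : Type u'} [Category.{v'} N] [CategoryWithCofibrations N] [CategoryWithWeakEquivalences N]

/-- An adjunction `L ⊣ R` is a Quillen pair if `L` preserves cofibrations and trivial
cofibrations. -/
structure IsQuillenPair {L : M ⥤ N} {R : N ⥤ M} (_adj : L ⊣ R) : Prop where
  map_cofibrations {X Y : M} (f : X ⟶ Y) (hf : cofibrations M f) : cofibrations N (L.map f)
  map_trivialCofibrations {X Y : M} (f : X ⟶ Y) (hf : trivialCofibrations M f) :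
    trivialCofibrations N (L.map f)

variable {C : Type w} [Category.{w} C]

/-- A co-factorization of `γ : C ⥤ M` through `r : C ⥤ N`. -/
structure CoFact (r : C ⥤ N) (γ : C ⥤ M) where
  /-- the left adjoint -/
  L : M ⥤ N
  /-- the right adjoint -/
  R : N ⥤ M
  /-- the adjunction -/
  adj : L ⊣ R
  isQuillenPair : IsQuillenPair adj
  /-- the natural weak equivalence -/
  η : γ ⟶ r ⋙ R
  weakEquivalence_η (X : C) : WeakEquivalence (η.app X)

namespace CoFact

variable {r : C ⥤ N} {γ : C ⥤ M}

/-- A map of co-factorizations is a natural transformation between the right adjoints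
which is compatible with the natural weak equivalences. -/
@[ext]
structure Hom (F G : CoFact r γ) where
  /-- the natural transformation -/
  τ : F.R ⟶ G.R
  fac : F.η ≫ Functor.whiskerLeft r τ = G.η

instance : Category (CoFact r γ) where
  Hom := Hom
  id F := { τ := 𝟙 _, fac := by simp }
  comp f g :=
    { τ := f.τ ≫ g.τ
      fac := by rw [Functor.whiskerLeft_comp, ← Category.assoc, f.fac, g.fac] }

end CoFact

end

/-! ## Simplicial resolutions -/

section

variable {M : Type u} [Category.{v} M]

/-- The index category of the matching object in degree `n` (before passing to the opposite
category): the injective maps `⦋k⦌ ⟶ ⦋n⦌` other than isomorphisms. -/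
abbrev MatchingIndex (n : ℕ) :=
  ObjectProperty.FullSubcategory (fun f : Over ⦋n⦌ => Mono f.hom ∧ ¬ IsIso f.hom)

/-- The diagram `(⦋k⦌ ⟶ ⦋n⦌) ↦ Φ _⦋k⦌` whose limit is the matching object. -/
def matchingDiagram (Φ : SimplicialObject M) (n : ℕ) : (MatchingIndex n)ᵒᵖ ⥤ M :=
  (ObjectProperty.ι _ ⋙ Over.forget ⦋n⦌).op ⋙ Φ

/-- The cone on the matching diagram with point `Φ _⦋n⦌`. -/
def matchingCone (Φ : SimplicialObject M) (n : ℕ) : Cone (matchingDiagram Φ n) where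
  pt := Φ.obj (op ⦋n⦌)
  π :=
    { app := fun f => Φ.map f.unop.obj.hom.op
      naturality := fun f g h => by
        have e : g.unop.obj.hom = h.unop.hom.left ≫ f.unop.obj.hom :=
          (Over.w h.unop.hom).symm
        dsimp [matchingDiagram]
        rw [Category.id_comp, e, op_comp, Φ.map_comp] }

/-- A simplicial object is Reedy fibrant if all its matching maps are fibrations. -/
def IsReedyFibrant [CategoryWithFibrations M] [HasLimits M] (Φ : SimplicialObject M) : Prop :=
  ∀ n : ℕ, Fibration (limit.lift (matchingDiagram Φ n) (matchingCone Φ n))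

variable {C : Type w} [Category.{w} C]

/-- The category of simplicial resolutions of `γ : C ⥤ M`: the full subcategory of the
category of functors `Φ : C ⥤ SimplicialObject M` under `X ↦ c_*(γ X)` such that every
`Φ X` is Reedy fibrant and every map `γ X ⟶ (Φ X) _⦋n⦌` is a weak equivalence. -/
abbrev SRes [CategoryWithFibrations M] [CategoryWithWeakEquivalences M] [HasLimits M]
    (γ : C ⥤ M) :=
  ObjectProperty.FullSubcategory (fun Φ : Under (γ ⋙ SimplicialObject.const M) =>
    (∀ X : C, IsReedyFibrant (Φ.right.obj X)) ∧
      ∀ (X : C) (n : SimplexCategoryᵒᵖ), WeakEquivalence ((Φ.hom.app X).app n))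

end

namespace CoFact

variable {C : Type v} [SmallCategory C] {M : Type u} [Category.{v} M]
  [CategoryWithCofibrations M] [CategoryWithWeakEquivalences M]

/-- The functor which sends a co-factorization `(L, R, η)` of `γ` through `VC` to the functor
`X ↦ ([n] ↦ R(rX ⊗ Δ[n]))`, with the maps `γ X ⟶ R(rX) ⟶ R(rX ⊗ Δ[n])`. -/
def toUnder (γ : C ⥤ M) :
    CoFact (VCat.r C) γ ⥤ Under (γ ⋙ SimplicialObject.const M) where
  obj F := Under.mk (Y := VCat.tensorSimplex C ⋙ (SimplicialObject.whiskering _ _).obj F.R)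
    { app := fun X =>
        { app := fun n => F.η.app X ≫ F.R.map (((VCat.toTensorSimplex C).app X).app n)
          naturality := fun m n φ => by
            have h := ((VCat.toTensorSimplex C).app X).naturality φ
            have h' : F.η.app X ≫ F.R.map (((VCat.toTensorSimplex C).app X).app n) =
                (F.η.app X ≫ F.R.map (((VCat.toTensorSimplex C).app X).app m)) ≫
                  F.R.map (((VCat.tensorSimplex C).obj X).map φ) := by
              rw [Category.assoc, ← F.R.map_comp]
              exact congr_arg (fun t => F.η.app X ≫ F.R.map t)
                ((Category.id_comp _).symm.trans h)
            exact (Category.id_comp _).trans h' }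
      naturality := fun X Y g => by
        ext n
        have h : (VCat.r C).map g ≫ ((VCat.toTensorSimplex C).app Y).app n =
            ((VCat.toTensorSimplex C).app X).app n ≫ ((VCat.tensorSimplex C).map g).app n :=
          congr_arg (fun t => t.app n) ((VCat.toTensorSimplex C).naturality g)
        have h' : γ.map g ≫ F.η.app Y ≫ F.R.map (((VCat.toTensorSimplex C).app Y).app n) =
            (F.η.app X ≫ F.R.map (((VCat.toTensorSimplex C).app X).app n)) ≫
              F.R.map (((VCat.tensorSimplex C).map g).app n) := by
          rw [F.η.naturality_assoc g, Category.assoc, ← F.R.map_comp, ← h, F.R.map_comp]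
          rfl
        exact h' }
  map {F G} f := Under.homMk
    (Functor.whiskerLeft (VCat.tensorSimplex C)
      ((SimplicialObject.whiskering _ _).map f.τ)) (by
        ext X n
        have h : F.η.app X ≫ f.τ.app ((VCat.r C).obj X) = G.η.app X :=
          NatTrans.congr_app f.fac X
        have h' : (F.η.app X ≫ F.R.map (((VCat.toTensorSimplex C).app X).app n)) ≫
            f.τ.app (((VCat.tensorSimplex C).obj X).obj n) =
              G.η.app X ≫ G.R.map (((VCat.toTensorSimplex C).app X).app n) := by
          rw [← h, Category.assoc, Category.assoc, f.τ.naturality]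
        exact h')
  map_id _ := by
    ext
    rfl
  map_comp _ _ := by
    ext
    rfl

end CoFact

/-- A category is contractible if its classifying space, the geometric realization of its
nerve, is contractible. -/
def IsContractibleCategory (D : Type u) [Category.{v} D] : Prop :=
  ContractibleSpace (SSet.toTop.obj (nerve D))

/-! An adjunction `L ⊣ R` between `M` and `VC` is the same thing as a functor `Φ : C ⥤
SimplicialObject M`. By the Yoneda lemma for diagrams of simplicial sets, `(L m)(X)_n` is the set of
maps from `rX ⊗ Δ[n]` to `L m` in diagrams, hence by adjunction the set of maps `m ⟶ R(rX ⊗ Δ[n])`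
(`rhoIso`). So `L m` is `X ↦ Map(m, Φ X)` with `Φ X = R(rX ⊗ Δ[•])`, and `R S` is the limit of `Φ`
weighted by `S`. Natural transformations between right adjoints are the same as maps between the
corresponding `Φ` (`natTrans_ext`, `exists_natTrans`), and every `Φ` occurs (`resAdj`, `restrJIso`).

The Quillen condition translates as follows. `L` preserves trivial cofibrations iff `Map(f, Φ X)` is
a trivial Kan fibration for every trivial cofibration `f`; by transposing lifting problems along
`∂Δ[n] ⟶ Δ[n]` (`hasLiftingProperty_matchingMap_iff`) this says that each `Φ X` is Reedy fibrant.
`L` preserves cofibrations iff `Map(f, Φ X)` is a Kan fibration for every cofibration `f`. For Reedy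
fibrant `Φ X` this means that all structure maps are weak equivalences: horn inclusions and vertex
inclusions generate each other under composition, cobase change and cancellation
(`horn_ι_mem_of_vertex`, `vertex_mem_of_horn`), and vertices correspond to the maps from degree `n`
to degree `0`. This gives the equivalence (b).

For (a), a functorial Reedy fibrant replacement gives a zigzag from the identity of the category of
resolutions, through replacement, to the constant functor at the replacement of `c_*γ`. Natural
transformations become homotopies on realizations (`toTop_map_homotopic`), so the category is
contractible.

The replacement `injRes` is the limit of a tower of functors `S_j`, starting at the terminal one.
With `U` the restriction to objects and `G` its right adjoint, factor `U X ⟶ U (S_j X)` levelwise as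
a trivial cofibration `U X ⟶ E_j` and a fibration, and let `S_(j+1)` be the pullback of `S_j ⟶ G U
S_j` and `G E_j ⟶ G U S_j`. Every transition map then lifts against all levelwise trivial
cofibrations, so the limit does so over the terminal object, which implies Reedy fibrancy. The
levels of the `S_j` are interleaved with the `E_j`, which are all weakly equivalent to `X`;
`InterleavedTower.weakEquivalence_lift` concludes that `X ⟶ lim S_j` is a levelwise weak
equivalence. -/

namespace SSet

/-! ### Points of geometric realizations and maps out of them. -/

/-- Maps out of a geometric realization agree if they agree on all simplices. -/
lemma toTop_hom_ext {X : SSet.{w}} {Y : TopCat.{w}} {f g : |X| ⟶ Y}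
    (h : ∀ (n : ℕ) (x : X _⦋n⦌),
      toTop.map (yonedaEquiv.symm x) ≫ f = toTop.map (yonedaEquiv.symm x) ≫ g) : f = g := by
  apply (sSetTopAdj.homEquiv _ _).injective
  ext ⟨⟨n⟩⟩ x
  have := congr_arg (sSetTopAdj.homEquiv _ _) (h n x)
  rw [Adjunction.homEquiv_naturality_left, Adjunction.homEquiv_naturality_left] at this
  rw [yonedaEquiv_symm_comp, yonedaEquiv_symm_comp] at this
  exact yonedaEquiv.symm.injective this

/-- The point of the realization of `X` with coordinates `t` in the simplex `x`. -/
noncomputable def realPoint {X : SSet.{w}} {n : ℕ} (x : X _⦋n⦌) (t : _root_.stdSimplex ℝ (Fin (n + 1))) :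
    |X| :=
  toTop.map (yonedaEquiv.symm x) (SimplexCategory.toTopHomeo.{w} ⦋n⦌ |>.symm t)

lemma continuous_realPoint {X : SSet.{w}} {n : ℕ} (x : X _⦋n⦌) : Continuous (realPoint x) :=
  (toTop.map (yonedaEquiv.symm x)).hom.continuous.comp
    (SimplexCategory.toTopHomeo.{w} ⦋n⦌).symm.continuous

lemma map_realPoint {X Y : SSet.{w}} (f : X ⟶ Y) {n : ℕ} (x : X _⦋n⦌)
    (t : _root_.stdSimplex ℝ (Fin (n + 1))) :
    toTop.map f (realPoint x t) = realPoint (f.app _ x) t := by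
  dsimp [realPoint]
  rw [← yonedaEquiv_symm_comp, Functor.map_comp]
  rfl

lemma realPoint_map {X : SSet.{w}} {n m : ℕ} (φ : ⦋n⦌ ⟶ ⦋m⦌) (x : X _⦋m⦌)
    (t : _root_.stdSimplex ℝ (Fin (n + 1))) :
    realPoint (X.map φ.op x) t = realPoint x (stdSimplex.map φ t) := by
  dsimp [realPoint]
  have := SimplexCategory.toTopHomeo_symm_naturality_apply.{w} φ t
  dsimp at this
  erw [this]
  have h : yonedaEquiv.symm (X.map φ.op x) =
      SSet.stdSimplex.map φ ≫ yonedaEquiv.symm x := by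
    rw [← yonedaEquiv_symm_naturality_left]
  rw [h, Functor.map_comp]
  rfl

/-- Every function to an indiscrete space is continuous. The predicate of lying on some simplex and
the constant predicate `True` are thus two maps to an indiscrete space of propositions which agree
on all simplices, hence everywhere. -/
lemma exists_realPoint {X : SSet.{w}} (z : |X|) :
    ∃ (n : ℕ) (x : X _⦋n⦌) (t : _root_.stdSimplex ℝ (Fin (n + 1))), realPoint x t = z := by
  let _ : TopologicalSpace (ULift.{w} Prop) := ⊤
  let Y : TopCat.{w} := TopCat.of (ULift.{w} Prop)
  let f : |X| ⟶ Y := TopCat.ofHom ⟨fun z => ⟨∃ (n : ℕ) (x : X _⦋n⦌)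
    (t : _root_.stdSimplex ℝ (Fin (n + 1))), realPoint x t = z⟩, continuous_top⟩
  let g : |X| ⟶ Y := TopCat.ofHom ⟨fun z => ⟨True⟩, continuous_top⟩
  have h : f = g := by
    apply toTop_hom_ext
    intro n x
    ext s
    refine iff_of_true ⟨n, x, SimplexCategory.toTopHomeo.{w} ⦋n⦌ s, ?_⟩ trivial
    simp only [realPoint, Homeomorph.symm_apply_apply]
    rfl
  have := ConcreteCategory.congr_hom h z
  exact of_eq_true (congr_arg ULift.down this)

/-- The map from a realization determined by compatible maps on the simplices. -/
noncomputable def realDesc {X : SSet.{w}} {Y : TopCat.{w}}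
    (F : ∀ (n : ℕ) (_ : X _⦋n⦌), C(_root_.stdSimplex ℝ (Fin (n + 1)), Y))
    (hF : ∀ (n m : ℕ) (φ : ⦋n⦌ ⟶ ⦋m⦌) (x : X _⦋m⦌) (t : _root_.stdSimplex ℝ (Fin (n + 1))),
      F n (X.map φ.op x) t = F m x (stdSimplex.map φ t)) : |X| ⟶ Y :=
  (sSetTopAdj.homEquiv X Y).symm
    { app := fun n => ↾fun x => (Y.toSSetObjEquiv n).symm (F n.unop.len x)
      naturality := by
        rintro ⟨⟨m⟩⟩ ⟨⟨n⟩⟩ φ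
        ext x
        apply (Y.toSSetObjEquiv _).injective
        ext t
        exact hF n m φ.unop x t }

lemma realDesc_realPoint {X : SSet.{w}} {Y : TopCat.{w}}
    (F : ∀ (n : ℕ) (_ : X _⦋n⦌), C(_root_.stdSimplex ℝ (Fin (n + 1)), Y))
    (hF : ∀ (n m : ℕ) (φ : ⦋n⦌ ⟶ ⦋m⦌) (x : X _⦋m⦌) (t : _root_.stdSimplex ℝ (Fin (n + 1))),
      F n (X.map φ.op x) t = F m x (stdSimplex.map φ t))
    (n : ℕ) (x : X _⦋n⦌) (t : _root_.stdSimplex ℝ (Fin (n + 1))) :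
    realDesc F hF (realPoint x t) = F n x t := by
  have h : sSetTopAdj.homEquiv X Y (realDesc F hF) = _ := Equiv.apply_symm_apply _ _
  have h2 := ConcreteCategory.congr_hom (NatTrans.congr_app h (op ⦋n⦌)) x
  rw [Adjunction.homEquiv_unit] at h2
  have h3 := congr_arg (fun y => Y.toSSetObjEquiv _ y t) h2
  have h4 := sSetTopAdj_unit_app_app_down X (op ⦋n⦌) x
  have h5 := ConcreteCategory.congr_hom h4 ⟨t⟩
  refine Eq.trans ?_ h3
  change _ = realDesc F hF ((ConcreteCategory.hom (X := SimplexCategory.toTop.{w}.obj ⦋n⦌)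
    ((sSetTopAdj.unit.app X).app (op ⦋n⦌) x).down) ⟨t⟩)
  exact congr_arg _ h5.symm

end SSet


/-! ### The prism decomposition in barycentric coordinates. -/

namespace stdSimplex

lemma sum_filter_map {X Y : Type*} [Fintype X] [Fintype Y] (f : X → Y)
    (s : stdSimplex ℝ X) (P : Y → Prop) [DecidablePred P] :
    ∑ y with P y, stdSimplex.map f s y = ∑ x with P (f x), s x := by
  classical
  have h (y : Y) : stdSimplex.map f s y = ∑ x with f x = y, s x := by
    rw [map_coe, FunOnFinite.linearMap_apply_apply]
  simp_rw [h]
  rw [← Finset.sum_fiberwise_of_maps_to (s := Finset.univ.filter (fun x => P (f x)))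
    (t := Finset.univ.filter P) (g := f) (by simp)]
  refine Finset.sum_congr rfl (fun y hy => Finset.sum_congr ?_ (fun _ _ => rfl))
  ext x
  simp only [Finset.mem_filter, Finset.mem_univ, true_and] at hy ⊢
  constructor
  · rintro rfl
    exact ⟨hy, rfl⟩
  · exact fun h => h.2

variable {n : ℕ}

/-- The sum of the first `k` barycentric coordinates. -/
noncomputable def cum (t : stdSimplex ℝ (Fin (n + 1))) (k : ℕ) : ℝ :=
  ∑ i with i.val < k, t i

lemma cum_zero (t : stdSimplex ℝ (Fin (n + 1))) : cum t 0 = 0 := by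
  simp [cum]

lemma cum_last (t : stdSimplex ℝ (Fin (n + 1))) : cum t (n + 1) = 1 := by
  rw [cum, Finset.filter_true_of_mem (fun i _ => i.2), sum_eq_one]

lemma cum_mono (t : stdSimplex ℝ (Fin (n + 1))) : Monotone (cum t) := by
  intro a b hab
  refine Finset.sum_le_sum_of_subset_of_nonneg (fun i hi => ?_) (fun i _ _ => zero_le t i)
  simp only [Finset.mem_filter, Finset.mem_univ, true_and] at hi ⊢
  lia

lemma continuous_cum (k : ℕ) : Continuous (fun t : stdSimplex ℝ (Fin (n + 1)) => cum t k) :=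
  continuous_finsetSum _ (fun i _ => (continuous_apply i).comp continuous_subtype_val)

lemma cum_nonneg (t : stdSimplex ℝ (Fin (n + 1))) (k : ℕ) : 0 ≤ cum t k :=
  Finset.sum_nonneg (fun i _ => zero_le t i)

lemma cum_le_one (t : stdSimplex ℝ (Fin (n + 1))) (k : ℕ) : cum t k ≤ 1 := by
  rw [← sum_eq_one t]
  exact Finset.sum_le_sum_of_subset_of_nonneg (by simp) (fun i _ _ => zero_le t i)

/-- The weights on `Fin (n + 1) × Fin 2` that describe the point `(t, s)` of the product
of a simplex and the interval: the interval `[0, 1]` is cut into pieces of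
lengths `t i`, and each piece is cut at `s`. -/
noncomputable def prodWeightFun (t : stdSimplex ℝ (Fin (n + 1))) (s : ℝ)
    (p : Fin (n + 1) × Fin 2) : ℝ :=
  if p.2 = 0 then min (cum t (p.1.val + 1)) s - min (cum t p.1.val) s
  else max (cum t (p.1.val + 1)) s - max (cum t p.1.val) s

lemma sum_fin_lt_sub (f : ℕ → ℝ) {q : ℕ} (hq : q ≤ n + 1) :
    ∑ i : Fin (n + 1) with i.val < q, (f (i.val + 1) - f i.val) = f q - f 0 := by
  rw [← Finset.sum_range_sub f q]
  refine Finset.sum_bij (fun i _ => i.val) (by simp) (fun _ _ _ _ h => Fin.ext h)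
    (fun b hb => ?_) (by simp)
  simp only [Finset.mem_range] at hb
  exact ⟨⟨b, by lia⟩, by simpa using hb, rfl⟩

lemma sum_prod_filter (g : Fin (n + 1) × Fin 2 → ℝ) (q : ℕ) (ε : Fin 2) :
    ∑ p with p.1.val < q ∧ p.2 = ε, g p = ∑ i : Fin (n + 1) with i.val < q, g (i, ε) := by
  symm
  refine Finset.sum_bij (fun i _ => (i, ε)) (by simp) (by simp) ?_ (by simp)
  rintro ⟨i, ε'⟩ h
  simp only [Finset.mem_filter, Finset.mem_univ, true_and] at h
  obtain ⟨h1, rfl⟩ := h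
  exact ⟨i, by simpa using h1, rfl⟩

lemma sum_prodWeightFun_zero (t : stdSimplex ℝ (Fin (n + 1))) {s : ℝ} (hs : 0 ≤ s) {q : ℕ}
    (hq : q ≤ n + 1) :
    ∑ p with p.1.val < q ∧ p.2 = 0, prodWeightFun t s p = min (cum t q) s := by
  rw [sum_prod_filter]
  simp only [prodWeightFun, if_true]
  rw [sum_fin_lt_sub (fun k => min (cum t k) s) hq, cum_zero, min_eq_left hs, sub_zero]

lemma sum_prodWeightFun_one (t : stdSimplex ℝ (Fin (n + 1))) {s : ℝ} (hs : 0 ≤ s) {q : ℕ}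
    (hq : q ≤ n + 1) :
    ∑ p with p.1.val < q ∧ p.2 = 1, prodWeightFun t s p = max (cum t q) s - s := by
  rw [sum_prod_filter]
  simp only [prodWeightFun, one_ne_zero, if_false]
  rw [sum_fin_lt_sub (fun k => max (cum t k) s) hq, cum_zero, max_eq_right hs]

/-- The weights `prodWeightFun` as a point of a simplex. -/
noncomputable def prodWeight (t : stdSimplex ℝ (Fin (n + 1))) (s : unitInterval) :
    stdSimplex ℝ (Fin (n + 1) × Fin 2) :=
  ⟨prodWeightFun t s, fun p => by
    have h := cum_mono t (Nat.le_succ p.1.val)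
    dsimp only [prodWeightFun]
    split_ifs
    · exact sub_nonneg.2 (min_le_min_right _ h)
    · exact sub_nonneg.2 (max_le_max_right _ h), by
    have h0 := sum_prodWeightFun_zero t s.2.1 le_rfl
    have h1 := sum_prodWeightFun_one t s.2.1 le_rfl
    rw [sum_prod_filter, Finset.filter_true_of_mem (fun i _ => i.2)] at h0 h1
    rw [Fintype.sum_prod_type]
    simp only [Fin.sum_univ_two]
    rw [Finset.sum_add_distrib, h0, h1, cum_last, min_eq_right s.2.2, max_eq_left s.2.2]
    ring⟩

lemma prodWeight_apply (t : stdSimplex ℝ (Fin (n + 1))) (s : unitInterval)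
    (p : Fin (n + 1) × Fin 2) : prodWeight t s p = prodWeightFun t s p := rfl

lemma continuous_prodWeight :
    Continuous (fun x : stdSimplex ℝ (Fin (n + 1)) × unitInterval => prodWeight x.1 x.2) := by
  refine Continuous.subtype_mk (continuous_pi fun p => ?_) _
  have h (k : ℕ) : Continuous (fun x : stdSimplex ℝ (Fin (n + 1)) × unitInterval => cum x.1 k) :=
    (continuous_cum k).comp continuous_fst
  have hs : Continuous (fun x : stdSimplex ℝ (Fin (n + 1)) × unitInterval => (x.2 : ℝ)) :=
    continuous_subtype_val.comp continuous_snd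
  dsimp only [prodWeightFun]
  split_ifs
  · exact ((h _).min hs).sub ((h _).min hs)
  · exact ((h _).max hs).sub ((h _).max hs)

/-- A point of the simplex on `Fin (n + 1) × Fin 2` is determined by its partial sums. -/
lemma ext_of_partial_sums {a b : stdSimplex ℝ (Fin (n + 1) × Fin 2)}
    (h : ∀ (q : ℕ) (ε : Fin 2), q ≤ n + 1 →
      ∑ p with p.1.val < q ∧ p.2 = ε, a p = ∑ p with p.1.val < q ∧ p.2 = ε, b p) : a = b := by
  ext ⟨i, ε⟩
  have aux (c : stdSimplex ℝ (Fin (n + 1) × Fin 2)) :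
      ∑ p with p.1.val < i.val + 1 ∧ p.2 = ε, c p =
        c (i, ε) + ∑ p with p.1.val < i.val ∧ p.2 = ε, c p := by
    rw [← Finset.sum_insert (by simp)]
    refine Finset.sum_congr ?_ (fun _ _ => rfl)
    ext ⟨j, ε'⟩
    simp only [Finset.mem_filter, Finset.mem_univ, true_and, Finset.mem_insert, Prod.mk.injEq,
      Fin.ext_iff]
    lia
  have h1 := h (i.val + 1) ε (by lia)
  rw [aux, aux, h i.val ε (by lia)] at h1
  exact add_right_cancel h1

/-- The preimage of an initial segment under a monotone map is an initial segment. Hence partial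
sums of a pushed-forward point are again partial sums of the original point. -/
lemma exists_threshold {m : ℕ} (φ : Fin (n + 1) → Fin (m + 1)) (hφ : Monotone φ) (q : ℕ) :
    ∃ q' ≤ n + 1, ∀ i : Fin (n + 1), (φ i).val < q ↔ i.val < q' := by
  classical
  by_cases h : ∃ k, ∃ hk : k < n + 1, q ≤ (φ ⟨k, hk⟩).val
  · obtain ⟨hk, hk'⟩ := Nat.find_spec h
    refine ⟨Nat.find h, by lia, fun i => ⟨fun hi => ?_, fun hi => ?_⟩⟩
    · by_contra! h'
      have : (φ ⟨Nat.find h, hk⟩) ≤ φ i := hφ h'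
      have : (φ ⟨Nat.find h, hk⟩).val ≤ (φ i).val := this
      lia
    · have := Nat.find_min h hi
      push Not at this
      exact this i.2
  · push Not at h
    exact ⟨n + 1, le_rfl, fun i => iff_of_true (h _ _) i.2⟩

/-- In both layers the partial sums of `prodWeight` depend only on `s` and the cumulative
coordinate, and pushing forward along `φ` only moves the threshold. -/
lemma map_prodWeight {m : ℕ} (φ : Fin (n + 1) → Fin (m + 1)) (hφ : Monotone φ)
    (t : stdSimplex ℝ (Fin (n + 1))) (s : unitInterval) :
    stdSimplex.map (Prod.map φ id) (prodWeight t s) = prodWeight (stdSimplex.map φ t) s := by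
  apply ext_of_partial_sums
  intro q ε hq
  obtain ⟨q', hq', h⟩ := exists_threshold φ hφ q
  have hc : cum (stdSimplex.map φ t) q = cum t q' := by
    rw [cum, sum_filter_map φ t (fun i => i.val < q), cum]
    simp only [h]
  rw [sum_filter_map (Prod.map φ id) _ (fun p => p.1.val < q ∧ p.2 = ε)]
  simp only [Prod.map_fst, Prod.map_snd, id_eq, h, prodWeight_apply]
  obtain rfl | rfl : ε = 0 ∨ ε = 1 := by lia
  · rw [sum_prodWeightFun_zero _ s.2.1 hq', sum_prodWeightFun_zero _ s.2.1 hq, hc]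
  · rw [sum_prodWeightFun_one _ s.2.1 hq', sum_prodWeightFun_one _ s.2.1 hq, hc]

/-- The mass below the cut `s` goes to layer `0` and the mass above it to layer `1`; at `s = 0`
everything is in layer `1`. This is the source of the reversed orientation of the interval later on.
-/
lemma prodWeight_zero (t : stdSimplex ℝ (Fin (n + 1))) :
    prodWeight t 0 = stdSimplex.map (fun i => (i, 1)) t := by
  apply ext_of_partial_sums
  intro q ε hq
  rw [sum_filter_map (fun i : Fin (n + 1) => (i, (1 : Fin 2))) _ (fun p => p.1.val < q ∧ p.2 = ε)]
  simp only [prodWeight_apply, Set.Icc.coe_zero]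
  obtain rfl | rfl : ε = 0 ∨ ε = 1 := by lia
  · rw [sum_prodWeightFun_zero _ unitInterval.zero_mem.1 hq]
    simp [cum_nonneg]
  · rw [sum_prodWeightFun_one _ unitInterval.zero_mem.1 hq]
    simpa [cum] using cum_nonneg t q

lemma prodWeight_one (t : stdSimplex ℝ (Fin (n + 1))) :
    prodWeight t 1 = stdSimplex.map (fun i => (i, 0)) t := by
  apply ext_of_partial_sums
  intro q ε hq
  rw [sum_filter_map (fun i : Fin (n + 1) => (i, (0 : Fin 2))) _ (fun p => p.1.val < q ∧ p.2 = ε)]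
  simp only [prodWeight_apply, Set.Icc.coe_one]
  obtain rfl | rfl : ε = 0 ∨ ε = 1 := by lia
  · rw [sum_prodWeightFun_zero _ unitInterval.one_mem.1 hq]
    simpa [cum] using cum_le_one t q
  · rw [sum_prodWeightFun_one _ unitInterval.one_mem.1 hq]
    simp [cum_le_one]

/-- Positive weight at `(i, 0)` forces the `i`th piece to start before `s`; positive weight at `(j,
1)` forces the `j`th piece to end after `s`. This makes the support a chain in the product order. -/
lemma prodWeight_support (t : stdSimplex ℝ (Fin (n + 1))) (s : unitInterval)
    {i j : Fin (n + 1)} (hi : prodWeight t s (i, 0) ≠ 0) (hj : prodWeight t s (j, 1) ≠ 0) :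
    i ≤ j := by
  simp only [prodWeight_apply, prodWeightFun, if_true, one_ne_zero, if_false] at hi hj
  have h1 : cum t i.val < s := by
    by_contra! h
    exact hi (by rw [min_eq_right h, min_eq_right (h.trans (cum_mono t (Nat.le_succ _))),
      sub_self])
  have h2 : s < cum t (j.val + 1) := by
    by_contra! h
    exact hj (by rw [max_eq_right h, max_eq_right ((cum_mono t (Nat.le_succ _)).trans h),
      sub_self])
  by_contra! h
  exact absurd (cum_mono t (show j.val + 1 ≤ i.val from h)) (not_le.2 (h1.trans h2))

end stdSimplex


/-! ### The realization of a prism and of a simplicial homotopy. -/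

namespace SSet

/-- Barycentric coordinates on the realization of `Δ[n] ⊗ Δ[1]`. -/
noncomputable def prodCoordHom (n : ℕ) :
    |(Δ[n] ⊗ Δ[1] : SSet.{w})| ⟶
      TopCat.of (ULift.{w} (_root_.stdSimplex ℝ (Fin (n + 1) × Fin 2))) :=
  realDesc (fun _ x => ⟨fun t => ⟨stdSimplex.map (prodStdSimplex.objEquiv x) t⟩,
      continuous_uliftUp.comp (stdSimplex.continuous_map _)⟩) (by
    intro k m φ x t
    apply ULift.ext
    change stdSimplex.map _ t = stdSimplex.map _ (stdSimplex.map _ t)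
    rw [stdSimplex.map_comp_apply]
    rfl)

/-- Barycentric coordinates on the realization of `Δ[n] ⊗ Δ[1]`. -/
noncomputable def prodCoord (n : ℕ) (z : |(Δ[n] ⊗ Δ[1] : SSet.{w})|) :
    _root_.stdSimplex ℝ (Fin (n + 1) × Fin 2) := (prodCoordHom n z).down

lemma continuous_prodCoord (n : ℕ) : Continuous (prodCoord.{w} n) :=
  continuous_uliftDown.comp (prodCoordHom n).hom.continuous

lemma prodCoord_realPoint {n k : ℕ} (x : (Δ[n] ⊗ Δ[1] : SSet.{w}) _⦋k⦌)
    (t : _root_.stdSimplex ℝ (Fin (k + 1))) :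
    prodCoord n (realPoint x t) = stdSimplex.map (prodStdSimplex.objEquiv x) t :=
  congr_arg ULift.down (realDesc_realPoint _ _ k x t)

/-- Every point of a realization lies in the interior of a nondegenerate simplex. -/
lemma exists_realPoint_nonDegenerate {X : SSet.{w}} (z : |X|) :
    ∃ (n : ℕ) (x : X _⦋n⦌) (t : _root_.stdSimplex ℝ (Fin (n + 1))),
      x ∈ X.nonDegenerate n ∧ (∀ i, 0 < t i) ∧ realPoint x t = z := by
  classical
  -- Choose a representation of minimal dimension: a degenerate simplex, or a vanishing coordinate
  -- (which puts the point on a face), would allow a smaller one.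
  have h := exists_realPoint z
  obtain ⟨x, t, hz⟩ := Nat.find_spec h
  have hmin : ∀ m < Nat.find h, ¬ ∃ (x : X _⦋m⦌) (t : _root_.stdSimplex ℝ (Fin (m + 1))),
    realPoint x t = z := fun m hm => Nat.find_min h hm
  generalize Nat.find h = n at x t hz hmin
  refine ⟨n, x, t, ?_, fun i => ?_, hz⟩
  · by_contra hx
    rw [mem_nonDegenerate_iff_notMem_degenerate, not_not] at hx
    obtain ⟨m, hm, φ, y, rfl⟩ := hx
    refine hmin m hm ⟨y, stdSimplex.map φ t, ?_⟩
    rw [← hz, ← realPoint_map]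
  · refine lt_of_le_of_ne (stdSimplex.zero_le t i) (fun hi => ?_)
    obtain _ | n := n
    · have h1 := stdSimplex.sum_eq_one t
      rw [Fin.sum_univ_one, Subsingleton.elim (α := Fin 1) 0 i, ← hi] at h1
      exact zero_ne_one h1
    · have hsum : ∑ j, t (i.succAbove j) = 1 := by
        have h1 := stdSimplex.sum_eq_one t
        rwa [Fin.sum_univ_succAbove _ i, ← hi, zero_add] at h1
      let t' : _root_.stdSimplex ℝ (Fin (n + 1)) :=
        ⟨fun j => t (i.succAbove j), fun j => stdSimplex.zero_le t _, hsum⟩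
      have ht : stdSimplex.map (SimplexCategory.δ i) t' = t := by
        ext j
        rw [stdSimplex.map_coe, FunOnFinite.linearMap_apply_apply]
        obtain rfl | ⟨j, rfl⟩ := Fin.eq_self_or_eq_succAbove i j
        · rw [← hi]
          refine Finset.sum_eq_zero (fun k hk => ?_)
          simp only [Finset.mem_filter, Finset.mem_univ, true_and] at hk
          exact absurd hk (Fin.succAbove_ne _ k)
        · have : Finset.univ.filter (fun k => (SimplexCategory.δ i) k = i.succAbove j) = {j} := by
            ext k
            simp only [Finset.mem_filter, Finset.mem_univ, true_and, Finset.mem_singleton]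
            exact Fin.succAbove_right_inj
          exact (Finset.sum_congr this (fun _ _ => rfl)).trans (Finset.sum_singleton _ _)
      refine hmin n (by lia) ⟨X.map (SimplexCategory.δ i).op x, t', ?_⟩
      rw [realPoint_map, ht, hz]

lemma map_injective_apply {X Y : Type*} [Fintype X] [Fintype Y] {f : X → Y}
    (hf : Function.Injective f) (t : _root_.stdSimplex ℝ X) (x : X) :
    stdSimplex.map f t (f x) = t x := by
  classical
  rw [stdSimplex.map_coe, FunOnFinite.linearMap_apply_apply]
  have : Finset.univ.filter (fun k => f k = f x) = {x} := by
    ext k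
    simp [hf.eq_iff]
  exact (Finset.sum_congr this (fun _ _ => rfl)).trans (Finset.sum_singleton _ _)

lemma map_apply_of_notMem {X Y : Type*} [Fintype X] [Fintype Y] {f : X → Y}
    (t : _root_.stdSimplex ℝ X) {y : Y} (hy : y ∉ Set.range f) :
    stdSimplex.map f t y = 0 := by
  classical
  rw [stdSimplex.map_coe, FunOnFinite.linearMap_apply_apply]
  refine Finset.sum_eq_zero (fun k hk => ?_)
  simp only [Finset.mem_filter, Finset.mem_univ, true_and] at hk
  exact absurd ⟨k, hk⟩ hy

lemma support_map {X Y : Type*} [Fintype X] [Fintype Y] {f : X → Y}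
    (hf : Function.Injective f) {t : _root_.stdSimplex ℝ X} (ht : ∀ i, 0 < t i) :
    {y | stdSimplex.map f t y ≠ 0} = Set.range f := by
  ext y
  constructor
  · intro hy
    by_contra h
    exact hy (map_apply_of_notMem t h)
  · rintro ⟨x, rfl⟩
    exact (map_injective_apply hf t x).trans_ne (ht x).ne'

/-- Nondegenerate simplices of the prism are strictly increasing chains. For a point interior to
such a simplex, the support of its coordinates is the set of vertices of the chain, which determines
the chain and then the coordinates in it. -/
lemma prodCoord_injective (n : ℕ) : Function.Injective (prodCoord.{w} n) := by
  intro z z' h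
  obtain ⟨k, x, t, hx, ht, rfl⟩ := exists_realPoint_nonDegenerate z
  obtain ⟨k', x', t', hx', ht', rfl⟩ := exists_realPoint_nonDegenerate z'
  rw [prodCoord_realPoint, prodCoord_realPoint] at h
  rw [prodStdSimplex.nonDegenerate_iff_strictMono_objEquiv] at hx hx'
  have hr : Set.range (prodStdSimplex.objEquiv x) = Set.range (prodStdSimplex.objEquiv x') := by
    rw [← support_map hx.injective ht, ← support_map hx'.injective ht', h]
  obtain rfl : k = k' := by
    have h1 := Set.card_range_of_injective hx.injective
    have h2 := Set.card_range_of_injective hx'.injective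
    have h3 : Nat.card (Set.range (prodStdSimplex.objEquiv x)) =
      Nat.card (Set.range (prodStdSimplex.objEquiv x')) := by rw [hr]
    rw [Nat.card_range_of_injective hx.injective, Nat.card_range_of_injective hx'.injective] at h3
    simpa using h3
  obtain rfl : x = x' := by
    apply prodStdSimplex.objEquiv.injective
    exact DFunLike.coe_injective ((hx.range_inj hx').1 hr)
  congr 1
  ext i
  rw [← map_injective_apply hx.injective t i, h, map_injective_apply hx.injective]

instance (n : ℕ) : CompactSpace |(Δ[n] ⊗ Δ[1] : SSet.{w})| := by
  have : (Set.univ : Set |(Δ[n] ⊗ Δ[1] : SSet.{w})|) =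
      ⋃ (k : Fin (n + 2)) (x : (Δ[n] ⊗ Δ[1] : SSet.{w}) _⦋k.val⦌), Set.range (realPoint x) := by
    symm
    rw [Set.eq_univ_iff_forall]
    intro z
    obtain ⟨k, x, t, hx, ht, rfl⟩ := exists_realPoint_nonDegenerate z
    have hk : k < n + 2 := by
      by_contra! hk
      have := (Δ[n] ⊗ Δ[1] : SSet.{w}).nonDegenerate_eq_empty_of_hasDimensionLT (n + 1 + 1) k hk
      rw [this] at hx
      exact hx
    simp only [Set.mem_iUnion]
    exact ⟨⟨k, hk⟩, x, t, rfl⟩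
  refine ⟨?_⟩
  rw [this]
  exact isCompact_iUnion (fun k => isCompact_iUnion (fun x =>
    isCompact_range (continuous_realPoint x)))

/-- A continuous injection from a compact space to a Hausdorff space is a closed embedding.
Continuity of maps into the realized prism can therefore be checked in coordinates. -/
lemma isEmbedding_prodCoord (n : ℕ) : Topology.IsEmbedding (prodCoord.{w} n) :=
  ((continuous_prodCoord n).isClosedEmbedding (prodCoord_injective n)).isEmbedding

/-- The support of the weights, enumerated in lexicographic order, is the simplex that carries the
point; it is a chain for the product order by `prodWeight_support`. -/
lemma prodWeight_mem_range {n : ℕ} (t : _root_.stdSimplex ℝ (Fin (n + 1))) (s : unitInterval) :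
    ∃ z : |(Δ[n] ⊗ Δ[1] : SSet.{w})|, prodCoord n z = stdSimplex.prodWeight t s := by
  classical
  let W := stdSimplex.prodWeight t s
  let S : Finset (Fin (n + 1) ×ₗ Fin 2) := Finset.univ.filter (fun p => W (ofLex p) ≠ 0)
  have hS : S.Nonempty := by
    by_contra h
    rw [Finset.not_nonempty_iff_eq_empty, Finset.filter_eq_empty_iff] at h
    have h1 := stdSimplex.sum_eq_one W
    rw [Finset.sum_eq_zero (fun p _ => by simpa using h (x := toLex p) (Finset.mem_univ _))] at h1
    exact zero_ne_one h1
  obtain ⟨k, hk⟩ : ∃ k, S.card = k + 1 := ⟨S.card - 1, by have := hS.card_pos; lia⟩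
  let f := S.orderEmbOfFin hk
  have hf (i : Fin (k + 1)) : W (ofLex (f i)) ≠ 0 :=
    (Finset.mem_filter.1 (S.orderEmbOfFin_mem hk i)).2
  have hmono : Monotone (fun i => ofLex (f i)) := by
    intro i j hij
    have h1 : f i ≤ f j := f.monotone hij
    rw [Prod.Lex.le_iff] at h1
    rcases h1 with h1 | ⟨h1, h2⟩
    -- With strictly increasing first coordinates, a drop from layer `1` to layer `0` is exactly
    -- what `prodWeight_support` rules out.
    · refine ⟨h1.le, ?_⟩
      by_contra h3
      have hi : (ofLex (f i)).2 = 1 := by lia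
      have hj : (ofLex (f j)).2 = 0 := by lia
      have := stdSimplex.prodWeight_support t s (i := (ofLex (f j)).1) (j := (ofLex (f i)).1)
        (by rw [← hj]; exact hf j) (by rw [← hi]; exact hf i)
      exact absurd h1 (not_lt.2 this)
    · exact ⟨h1.le, h2⟩
  have hinj : Function.Injective (fun i => ofLex (f i)) := fun i j h => f.injective h
  have hsurj (p : Fin (n + 1) × Fin 2) (hp : W p ≠ 0) : p ∈ Set.range (fun i => ofLex (f i)) := by
    have : toLex p ∈ Set.range f := by
      rw [S.range_orderEmbOfFin hk]
      simpa [S] using hp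
    obtain ⟨i, hi⟩ := this
    exact ⟨i, congr_arg ofLex hi⟩
  let t' : _root_.stdSimplex ℝ (Fin (k + 1)) := ⟨fun i => W (ofLex (f i)),
    fun i => stdSimplex.zero_le W _, by
      rw [← stdSimplex.sum_eq_one W]
      rw [← Finset.sum_image (f := W) (g := fun i => ofLex (f i)) (fun i _ j _ h => hinj h)]
      refine Finset.sum_subset (Finset.subset_univ _) (fun p _ hp => ?_)
      by_contra h
      obtain ⟨i, rfl⟩ := hsurj p h
      exact hp (Finset.mem_image_of_mem _ (Finset.mem_univ i))⟩
  refine ⟨realPoint (prodStdSimplex.objEquiv.symm ⟨_, hmono⟩) t', ?_⟩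
  rw [prodCoord_realPoint, Equiv.apply_symm_apply]
  ext p
  by_cases hp : p ∈ Set.range (fun i => ofLex (f i))
  · obtain ⟨i, rfl⟩ := hp
    exact map_injective_apply hinj t' i
  · rw [map_apply_of_notMem t' (f := (⟨_, hmono⟩ : Fin (k + 1) →o _)) hp]
    by_contra h
    exact hp (hsurj p (Ne.symm h))

/-- The inverse of the canonical map `|Δ[n] ⊗ Δ[1]| ⟶ |Δ[n]| × [0, 1]` (where
the interval has the opposite orientation). -/
noncomputable def prodRealPoint {n : ℕ} (t : _root_.stdSimplex ℝ (Fin (n + 1)))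
    (s : unitInterval) : |(Δ[n] ⊗ Δ[1] : SSet.{w})| :=
  (prodWeight_mem_range t s).choose

lemma prodCoord_prodRealPoint {n : ℕ} (t : _root_.stdSimplex ℝ (Fin (n + 1)))
    (s : unitInterval) :
    prodCoord.{w} n (prodRealPoint t s) = stdSimplex.prodWeight t s :=
  (prodWeight_mem_range t s).choose_spec

lemma continuous_prodRealPoint (n : ℕ) :
    Continuous (fun x : _root_.stdSimplex ℝ (Fin (n + 1)) × unitInterval =>
      prodRealPoint.{w} x.1 x.2) := by
  rw [(isEmbedding_prodCoord n).continuous_iff]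
  convert stdSimplex.continuous_prodWeight using 2
  exact prodCoord_prodRealPoint _ _

lemma prodCoord_whiskerRight {n m : ℕ} (φ : ⦋n⦌ ⟶ ⦋m⦌) (z : |(Δ[n] ⊗ Δ[1] : SSet.{w})|) :
    prodCoord m (toTop.map (SSet.stdSimplex.map φ ▷ Δ[1]) z) =
      stdSimplex.map (Prod.map φ id) (prodCoord n z) := by
  obtain ⟨k, x, t, rfl⟩ := exists_realPoint z
  rw [map_realPoint, prodCoord_realPoint, prodCoord_realPoint, stdSimplex.map_comp_apply]
  rfl

lemma prodRealPoint_map {n m : ℕ} (φ : ⦋n⦌ ⟶ ⦋m⦌) (t : _root_.stdSimplex ℝ (Fin (n + 1)))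
    (s : unitInterval) :
    toTop.map (SSet.stdSimplex.map φ ▷ Δ[1]) (prodRealPoint.{w} t s) =
      prodRealPoint (stdSimplex.map φ t) s := by
  apply prodCoord_injective
  rw [prodCoord_whiskerRight, prodCoord_prodRealPoint, prodCoord_prodRealPoint]
  exact stdSimplex.map_prodWeight _ φ.toOrderHom.monotone t s

lemma prodRealPoint_zero {n : ℕ} (t : _root_.stdSimplex ℝ (Fin (n + 1))) :
    prodRealPoint.{w} t 0 =
      toTop.map ι₁ (realPoint (SSet.stdSimplex.objEquiv.symm (𝟙 ⦋n⦌)) t) := by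
  apply prodCoord_injective
  rw [prodCoord_prodRealPoint, map_realPoint, prodCoord_realPoint, stdSimplex.prodWeight_zero]
  rfl

lemma prodRealPoint_one {n : ℕ} (t : _root_.stdSimplex ℝ (Fin (n + 1))) :
    prodRealPoint.{w} t 1 =
      toTop.map ι₀ (realPoint (SSet.stdSimplex.objEquiv.symm (𝟙 ⦋n⦌)) t) := by
  apply prodCoord_injective
  rw [prodCoord_prodRealPoint, map_realPoint, prodCoord_realPoint, stdSimplex.prodWeight_one]
  rfl

/-- The realization of a simplicial homotopy, as a map to a path space. -/
noncomputable def realHomotopy {K L : SSet.{w}} (H : K ⊗ Δ[1] ⟶ L) :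
    |K| ⟶ TopCat.of C(unitInterval, |L|) :=
  realDesc (fun n x => ContinuousMap.curry ⟨fun p => toTop.map (yonedaEquiv.symm x ▷ Δ[1] ≫ H)
      (prodRealPoint p.1 p.2),
      (toTop.map (yonedaEquiv.symm x ▷ Δ[1] ≫ H)).hom.continuous.comp
        (continuous_prodRealPoint n)⟩) (by
    intro n m φ x t
    ext s
    change toTop.map (yonedaEquiv.symm _ ▷ Δ[1] ≫ H) (prodRealPoint t s) =
      toTop.map (yonedaEquiv.symm x ▷ Δ[1] ≫ H) (prodRealPoint (stdSimplex.map φ t) s)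
    rw [← prodRealPoint_map, ← yonedaEquiv_symm_naturality_left, MonoidalCategory.comp_whiskerRight,
      Category.assoc, Functor.map_comp]
    rfl)

lemma realHomotopy_realPoint {K L : SSet.{w}} (H : K ⊗ Δ[1] ⟶ L) {n : ℕ} (x : K _⦋n⦌)
    (t : _root_.stdSimplex ℝ (Fin (n + 1))) (s : unitInterval) :
    (realHomotopy H (realPoint x t) : C(unitInterval, |L|)) s =
      toTop.map (yonedaEquiv.symm x ▷ Δ[1] ≫ H) (prodRealPoint t s) := by
  rw [realHomotopy, realDesc_realPoint]
  rfl

lemma realHomotopy_zero {K L : SSet.{w}} (H : K ⊗ Δ[1] ⟶ L) (z : |K|) :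
    (realHomotopy H z : C(unitInterval, |L|)) 0 = toTop.map (ι₁ ≫ H) z := by
  obtain ⟨n, x, t, rfl⟩ := exists_realPoint z
  rw [realHomotopy_realPoint, prodRealPoint_zero, map_realPoint, map_realPoint, map_realPoint]
  congr 1
  have h := ConcreteCategory.congr_hom (NatTrans.congr_app
    (ι₁_comp_assoc (yonedaEquiv.symm x) H) (op ⦋n⦌)) (stdSimplex.objEquiv.symm (𝟙 ⦋n⦌))
  refine Eq.trans ?_ (h.trans ?_)
  · rfl
  · exact congr_arg (ConcreteCategory.hom ((ι₁ ≫ H).app (op ⦋n⦌))) (yonedaEquiv_symm_app_id x)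

lemma realHomotopy_one {K L : SSet.{w}} (H : K ⊗ Δ[1] ⟶ L) (z : |K|) :
    (realHomotopy H z : C(unitInterval, |L|)) 1 = toTop.map (ι₀ ≫ H) z := by
  obtain ⟨n, x, t, rfl⟩ := exists_realPoint z
  rw [realHomotopy_realPoint, prodRealPoint_one, map_realPoint, map_realPoint, map_realPoint]
  congr 1
  have h := ConcreteCategory.congr_hom (NatTrans.congr_app
    (ι₀_comp_assoc (yonedaEquiv.symm x) H) (op ⦋n⦌)) (stdSimplex.objEquiv.symm (𝟙 ⦋n⦌))
  refine Eq.trans ?_ (h.trans ?_)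
  · rfl
  · exact congr_arg (ConcreteCategory.hom ((ι₀ ≫ H).app (op ⦋n⦌))) (yonedaEquiv_symm_app_id x)

/-- The realizations of homotopic maps of simplicial sets are homotopic. -/
lemma toTop_map_homotopic {K L : SSet.{w}} (H : K ⊗ Δ[1] ⟶ L) :
    ContinuousMap.Homotopic (toTop.map (ι₀ ≫ H)).hom (toTop.map (ι₁ ≫ H)).hom := by
  let G : C(|K|, C(unitInterval, |L|)) := (realHomotopy H).hom
  -- Parameter `0` gives the end `ι₁`, hence the symmetry. Currying into the path space lets the
  -- homotopy be defined simplex by simplex, without knowing that `|K| × [0, 1]` is a colimit.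
  refine ContinuousMap.Homotopic.symm ⟨⟨⟨fun p => G p.2 p.1, ?_⟩, ?_, ?_⟩⟩
  · exact (ContinuousMap.continuous_uncurry_of_continuous G).comp continuous_swap
  · exact realHomotopy_zero H
  · exact realHomotopy_one H

end SSet

/-! ### Natural transformations and contractible categories. -/

namespace CategoryTheory

/-- The homotopy on nerves that is induced by a natural transformation. -/
def nerveHomotopy {D E : Type u} [Category.{v} D] [Category.{v} E] {F G : D ⥤ E} (α : F ⟶ G) :
    nerve D ⊗ Δ[1] ⟶ nerve E where
  app _ := ↾fun x =>
    Functor.prod' (SSet.stdSimplex.objEquiv x.2).toOrderHom.monotone.functor x.1 ⋙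
      Functor.uncurry.obj (ComposableArrows.mk₁ α)
  naturality _ _ _ := rfl

lemma ι₀_nerveHomotopy {D E : Type u} [Category.{v} D] [Category.{v} E] {F G : D ⥤ E}
    (α : F ⟶ G) : SSet.ι₀ ≫ nerveHomotopy α = nerveMap F := by
  ext n x
  refine Functor.ext (fun i => rfl) (fun i j f => ?_)
  exact (Category.id_comp (F.map (x.map f))).trans
    ((Category.id_comp _).trans (Category.comp_id _)).symm

lemma ι₁_nerveHomotopy {D E : Type u} [Category.{v} D] [Category.{v} E] {F G : D ⥤ E}
    (α : F ⟶ G) : SSet.ι₁ ≫ nerveHomotopy α = nerveMap G := by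
  ext n x
  refine Functor.ext (fun i => rfl) (fun i j f => ?_)
  exact (Category.id_comp (G.map (x.map f))).trans
    ((Category.id_comp _).trans (Category.comp_id _)).symm

lemma toTop_nerveMap_homotopic {D E : Type u} [Category.{v} D] [Category.{v} E] {F G : D ⥤ E}
    (α : F ⟶ G) : ContinuousMap.Homotopic (SSet.toTop.map (nerveMap F)).hom
      (SSet.toTop.map (nerveMap G)).hom := by
  rw [← ι₀_nerveHomotopy α, ← ι₁_nerveHomotopy α]
  exact SSet.toTop_map_homotopic _

end CategoryTheory

/-- A category is contractible if its identity functor is connected to a constant functor by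
a zigzag of two natural transformations. -/
lemma IsContractibleCategory.of_zigzag {D : Type u} [Category.{v} D] (T : D ⥤ D) (c : D)
    (α : 𝟭 D ⟶ T) (β : (Functor.const D).obj c ⟶ T) : IsContractibleCategory D := by
  let p : nerve D _⦋0⦌ := ComposableArrows.mk₀ c
  have h1 := toTop_nerveMap_homotopic α
  have h2 := toTop_nerveMap_homotopic β
  have h3 : nerveMap (𝟭 D) = 𝟙 (nerve D) := rfl
  -- The nerve of a constant functor factors through `Δ[0]`, whose realization is a point.
  have h4 : nerveMap ((Functor.const D).obj c) =
      SSet.stdSimplex.isTerminalObj₀.from (nerve D) ≫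
        SSet.yonedaEquiv.symm p := by
    ext n x
    refine CategoryTheory.Functor.ext (fun i => rfl) (fun i j f => ?_)
    exact ((Category.id_comp _).trans (Category.comp_id _)).symm
  have h := h1.trans h2.symm
  rw [h3, h4, SSet.toTop.map_id, SSet.toTop.map_comp] at h
  refine (contractible_iff_id_nullhomotopic _).2
    ⟨SSet.toTop.map (SSet.yonedaEquiv.symm p) default, h.trans ?_⟩
  convert ContinuousMap.Homotopic.refl _
  ext z
  exact congr_arg (SSet.toTop.map (SSet.yonedaEquiv.symm p))
    (Subsingleton.elim _ _)


/-! ### Limits of towers of fibrations. -/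

section

variable {M : Type u} [Category.{v} M]

/-- `P` is the limit of the tower `⋯ ⟶ A 2 ⟶ A 1 ⟶ A 0`. -/
structure IsSeqLim (A : ℕ → M) (a : ∀ n, A (n + 1) ⟶ A n) (P : M) (π : ∀ n, P ⟶ A n) : Prop where
  w (n : ℕ) : π (n + 1) ≫ a n = π n
  lift {W : M} (f : ∀ n, W ⟶ A n) (hf : ∀ n, f (n + 1) ≫ a n = f n) :
    ∃ g : W ⟶ P, ∀ n, g ≫ π n = f n
  ext {W : M} {g h : W ⟶ P} (H : ∀ n, g ≫ π n = h ≫ π n) : g = h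

lemma IsSeqLim.of_isLimit {F : ℕᵒᵖ ⥤ M} {c : Cone F} (hc : IsLimit c) :
    IsSeqLim (fun n => F.obj (op n)) (fun n => F.map (homOfLE (Nat.le_add_right n 1)).op) c.pt
      (fun n => c.π.app (op n)) where
  w n := c.w _
  lift {W} f hf := by
    let s : Cone F :=
      { pt := W
        π := NatTrans.ofOpSequence (F := (Functor.const _).obj W) f
          (fun n => ((Category.id_comp _).trans (hf n).symm)) }
    exact ⟨hc.lift s, fun n => hc.fac s (op n)⟩
  ext H := hc.hom_ext (fun ⟨n⟩ => H n)

lemma exists_isSeqLim [HasLimitsOfShape ℕᵒᵖ M] (A : ℕ → M) (a : ∀ n, A (n + 1) ⟶ A n) :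
    ∃ (P : M) (π : ∀ n, P ⟶ A n), IsSeqLim A a P π := by
  have h := IsSeqLim.of_isLimit (limit.isLimit (Functor.ofOpSequence a))
  simp only [Functor.ofOpSequence_map_homOfLE_succ] at h
  exact ⟨_, _, h⟩

/-- A map of towers with suitable relative lifting properties has the lifting property on limits. -/
lemma IsSeqLim.exists_lift {A : ℕ → M} {a : ∀ n, A (n + 1) ⟶ A n} {P : M} {π : ∀ n, P ⟶ A n}
    (hA : IsSeqLim A a P π) {B : ℕ → M} {b : ∀ n, B (n + 1) ⟶ B n} {P' : M} {π' : ∀ n, P' ⟶ B n}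
    (hB : IsSeqLim B b P' π') (r : ∀ n, A n ⟶ B n)
    {S T : M} (i : S ⟶ T) (h0 : HasLiftingProperty i (r 0))
    (hs : ∀ (n : ℕ) (s : S ⟶ A (n + 1)) (l : T ⟶ A n) (t : T ⟶ B (n + 1)),
      s ≫ a n = i ≫ l → s ≫ r (n + 1) = i ≫ t → l ≫ r n = t ≫ b n →
      ∃ l' : T ⟶ A (n + 1), i ≫ l' = s ∧ l' ≫ a n = l ∧ l' ≫ r (n + 1) = t)
    (f : P ⟶ P') (hf : ∀ n, f ≫ π' n = π n ≫ r n) : HasLiftingProperty i f where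
  sq_hasLift {s t} sq := by
    -- Partial lifts at level `n`. The relative lifting property extends each one to the next level,
    -- and a compatible sequence of choices gives a map to the limit.
    let St (n : ℕ) := { l : T ⟶ A n // i ≫ l = s ≫ π n ∧ l ≫ r n = t ≫ π' n }
    have hn (n : ℕ) (x : St n) : ∃ y : St (n + 1), y.1 ≫ a n = x.1 := by
      obtain ⟨l', h1, h2, h3⟩ := hs n (s ≫ π (n + 1)) x.1 (t ≫ π' (n + 1))
        (by rw [Category.assoc, hA.w, x.2.1])
        (by rw [Category.assoc, ← hf, ← Category.assoc, sq.w, Category.assoc])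
        (by rw [x.2.2, Category.assoc, hB.w])
      exact ⟨⟨l', h1, h3⟩, h2⟩
    have sq0 : CommSq (s ≫ π 0) i (r 0) (t ≫ π' 0) :=
      ⟨by rw [Category.assoc, ← hf, ← Category.assoc, sq.w, Category.assoc]⟩
    let x (n : ℕ) : St n := Nat.rec ⟨sq0.lift, sq0.fac_left, sq0.fac_right⟩
      (fun n y => (hn n y).choose) n
    have hx (n : ℕ) : (x (n + 1)).1 ≫ a n = (x n).1 := (hn n (x n)).choose_spec
    obtain ⟨g, hg⟩ := hA.lift (fun n => (x n).1) hx
    refine ⟨⟨⟨g, hA.ext (fun n => ?_), hB.ext (fun n => ?_)⟩⟩⟩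
    · rw [Category.assoc, hg, (x n).2.1]
    · rw [Category.assoc, hf, ← Category.assoc, hg, (x n).2.2]

variable [ModelCategory M]

/-- The limit of a tower of trivial fibrations is a trivial fibration over the bottom. -/
lemma IsSeqLim.trivialFibrations {A : ℕ → M} {a : ∀ n, A (n + 1) ⟶ A n} {P : M}
    {π : ∀ n, P ⟶ A n} (hA : IsSeqLim A a P π) (ha : ∀ n, trivialFibrations M (a n)) :
    trivialFibrations M (π 0) := by
  rw [← cofibrations_rlp]
  intro S T i hi
  -- Compare with the constant tower at `A 0`, whose limit is `A 0`: its relative lifting problems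
  -- are just those against the maps `a n`.
  let r (n : ℕ) : A n ⟶ A 0 := Nat.rec (𝟙 _) (fun n r => a n ≫ r) n
  have hr (n : ℕ) : r (n + 1) = a n ≫ r n := rfl
  have hc : IsSeqLim (fun _ => A 0) (fun _ => 𝟙 _) (A 0) (fun _ => 𝟙 _) :=
    { w := by simp
      lift := fun f hf => ⟨f 0, fun n => by
        induction n with
        | zero => simp
        | succ n ih =>
            have := hf n
            rw [Category.comp_id] at this
            rw [ih, this]⟩
      ext := fun H => by simpa using H 0 }
  refine hA.exists_lift hc r i ?_ ?_ (π 0) (fun n => ?_)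
  · exact inferInstanceAs (HasLiftingProperty i (𝟙 _))
  · intro n s l t h1 h2 h3
    have : HasLiftingProperty i (a n) := by
      have := ha n
      rw [← cofibrations_rlp] at this
      exact this i hi
    have sq : CommSq s i (a n) l := ⟨h1⟩
    refine ⟨sq.lift, sq.fac_left, sq.fac_right, ?_⟩
    rw [hr, ← Category.assoc, sq.fac_right, h3, Category.comp_id]
  · rw [Category.comp_id]
    induction n with
    | zero => exact (Category.comp_id _).symm
    | succ n ih => rw [hr, ← Category.assoc, hA.w, ih]

/-! ### Weak equivalences to the limit of an interleaved tower. -/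

/-- The data of an interleaved pair of towers `Z`, `E`
under an object `X` that is weakly equivalent to all `E j`. -/
structure InterleavedTower (X : M) where
  /-- the first tower -/
  Z : ℕ → M
  /-- the second tower -/
  E : ℕ → M
  /-- the maps from the second tower to the first one -/
  b (j : ℕ) : E j ⟶ Z j
  /-- the maps from the first tower to the second one -/
  a (j : ℕ) : Z (j + 1) ⟶ E j
  /-- the weak equivalences from `X` -/
  e (j : ℕ) : X ⟶ E j
  fac (j : ℕ) : e (j + 1) ≫ b (j + 1) ≫ a j = e j
  fibration_b (j : ℕ) : Fibration (b j)
  fibration_p (j : ℕ) : Fibration (a j ≫ b j)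
  weakEquivalence_e (j : ℕ) : WeakEquivalence (e j)

namespace InterleavedTower

variable {X : M} (D : InterleavedTower X)

/-- The transition maps of the first tower. -/
abbrev p (j : ℕ) : D.Z (j + 1) ⟶ D.Z j := D.a j ≫ D.b j

/-- The map from `X` to the first tower. -/
abbrev z (j : ℕ) : X ⟶ D.Z j := D.e j ≫ D.b j

lemma z_a (j : ℕ) : D.z (j + 1) ≫ D.a j = D.e j := by
  rw [Category.assoc, D.fac]

/-- A trivial fibration over `Z j`, under `X`. -/
structure Stage (j : ℕ) where
  /-- the object -/
  Q : M
  /-- the trivial fibration -/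
  r : Q ⟶ D.Z j
  hr : trivialFibrations M r
  /-- the map from `X` -/
  x : X ⟶ Q
  fac : x ≫ r = D.z j

variable {D}

/-- The pullback of a stage to `E j`. -/
noncomputable abbrev Stage.F {j : ℕ} (s : D.Stage j) : M := pullback s.r (D.b j)

/-- The map from `X` to the pullback of a stage. -/
noncomputable abbrev Stage.f {j : ℕ} (s : D.Stage j) : X ⟶ s.F :=
  pullback.lift s.x (D.e j) s.fac

/-- The projection to `E j` is a base change of the trivial fibration `r`; use two-out-of-three with
`e j`. -/
lemma Stage.weakEquivalence_f {j : ℕ} (s : D.Stage j) : WeakEquivalence s.f := by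
  obtain ⟨_, _⟩ := (mem_trivialFibrations_iff _).1 s.hr
  have := D.weakEquivalence_e j
  exact weakEquivalence_of_postcomp_of_fac (f := s.f) (g := pullback.snd _ _) (fg := D.e j)
    (pullback.lift_snd _ _ _)

/-- The map `a j` need not be a fibration, so the pullback `G` of `Q` to `Z (j + 1)` need not be
fibered over `F`. Replacing the graph of `G ⟶ F` by a fibration corrects this without changing the
weak type of `G`. -/
lemma Stage.exists_next {j : ℕ} (s : D.Stage j) :
    ∃ (s' : D.Stage (j + 1)) (φ : s'.Q ⟶ s.F)
      (h : (φ ≫ pullback.fst _ _) ≫ s.r = s'.r ≫ D.p j),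
      Fibration φ ∧ s'.x ≫ φ = s.f ∧ trivialFibrations M (pullback.lift _ _ h) := by
  obtain ⟨_, _⟩ := (mem_trivialFibrations_iff _).1 s.hr
  have := D.fibration_b j
  have := D.fibration_p j
  let G := pullback s.r (D.p j)
  let g : G ⟶ s.F := pullback.lift (pullback.fst _ _) (pullback.snd _ _ ≫ D.a j) (by
    rw [Category.assoc, pullback.condition])
  let δ : G ⟶ pullback (pullback.fst s.r (D.p j)) (pullback.fst s.r (D.b j)) :=
    pullback.lift (𝟙 _) g (by rw [Category.id_comp]; exact (pullback.lift_fst _ _ _).symm)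
  let d := MorphismProperty.factorizationData (trivialCofibrations M) (fibrations M) δ
  let ρ : d.Z ⟶ G := d.p ≫ pullback.fst _ _
  -- `ρ` is a fibration because `F ⟶ Q` is a base change of `b j`, and a weak equivalence because it
  -- retracts the trivial cofibration `d.i`.
  have hid : d.i ≫ ρ = 𝟙 _ := (d.fac_assoc _).trans (pullback.lift_fst _ _ _)
  have : WeakEquivalence ρ := weakEquivalence_of_precomp_of_fac hid
  have hρ : trivialFibrations M ρ := mem_trivialFibrations ρ
  -- The second projection is a base change of `G ⟶ Q`, itself a base change of the fibration `p j`.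
  have hφ : Fibration (d.p ≫ pullback.snd _ _) := inferInstance
  have e1 : (d.p ≫ pullback.snd _ _) ≫ pullback.fst _ _ = ρ ≫ pullback.fst _ _ := by
    simp only [ρ, Category.assoc, pullback.condition]
  let x' : X ⟶ G := pullback.lift s.x (D.z (j + 1)) (by
    rw [s.fac, ← Category.assoc, D.z_a])
  refine ⟨⟨d.Z, ρ ≫ pullback.snd _ _, mem_trivialFibrations _, x' ≫ d.i, ?_⟩,
    d.p ≫ pullback.snd _ _, ?_, hφ, ?_, ?_⟩
  · rw [Category.assoc, reassoc_of% hid, pullback.lift_snd]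
  · rw [e1]
    change (ρ ≫ _) ≫ s.r = (ρ ≫ pullback.snd _ _) ≫ D.p j
    rw [Category.assoc ρ, Category.assoc ρ, pullback.condition]
  · dsimp only
    rw [Category.assoc, d.fac_assoc, pullback.lift_snd]
    apply pullback.hom_ext
    · rw [Category.assoc, pullback.lift_fst, pullback.lift_fst]
      exact (pullback.lift_fst _ _ _).symm
    · rw [Category.assoc, pullback.lift_snd, pullback.lift_snd, ← Category.assoc, pullback.lift_snd,
        D.z_a]
  · convert hρ
    apply pullback.hom_ext
    · rw [pullback.lift_fst, e1]
    · exact pullback.lift_snd _ _ _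

variable (D)

/-- The bottom stage. -/
def stageZero : D.Stage 0 where
  Q := D.Z 0
  r := 𝟙 _
  hr := mem_trivialFibrations _
  x := D.z 0
  fac := Category.comp_id _

/-- A sequence of stages. -/
noncomputable def stage (j : ℕ) : D.Stage j :=
  Nat.rec D.stageZero (fun _ s => s.exists_next.choose) j

/-- The pullbacks `F j` form a tower of trivial fibrations, so `X` is weakly equivalent to its limit
`T`. The objects `Q j` are interleaved with the `F j` and have the same limit, and `Q ⟶ Z` is a
relative trivial fibration of towers, so `T ⟶ P` is a trivial fibration. -/
lemma weakEquivalence_lift [HasLimitsOfShape ℕᵒᵖ M] {P : M} {π : ∀ n, P ⟶ D.Z n}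
    (hP : IsSeqLim D.Z D.p P π) (f : X ⟶ P) (hf : ∀ n, f ≫ π n = D.z n) :
    WeakEquivalence f := by
  have hnext (j : ℕ) := (D.stage j).exists_next.choose_spec
  let φ (j : ℕ) : (D.stage (j + 1)).Q ⟶ (D.stage j).F := (hnext j).choose
  have hφ (j : ℕ) : (φ j ≫ pullback.fst _ _) ≫ (D.stage j).r = (D.stage (j + 1)).r ≫ D.p j :=
    (hnext j).choose_spec.choose
  have hφ' (j : ℕ) : Fibration (φ j) := (hnext j).choose_spec.choose_spec.1
  have hφx (j : ℕ) : (D.stage (j + 1)).x ≫ φ j = (D.stage j).f :=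
    (hnext j).choose_spec.choose_spec.2.1
  have hφt (j : ℕ) : trivialFibrations M (pullback.lift _ _ (hφ j)) :=
    (hnext j).choose_spec.choose_spec.2.2
  let q (j : ℕ) : (D.stage (j + 1)).Q ⟶ (D.stage j).Q := φ j ≫ pullback.fst _ _
  let F (j : ℕ) : M := (D.stage j).F
  let c (j : ℕ) : F (j + 1) ⟶ F j := pullback.fst _ _ ≫ φ j
  have hfc (j : ℕ) : (D.stage (j + 1)).f ≫ c j = (D.stage j).f := by
    simp only [c, pullback.lift_fst_assoc, hφx]
  have hc (j : ℕ) : trivialFibrations M (c j) := by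
    have := D.fibration_b (j + 1)
    have := hφ' j
    have := (D.stage j).weakEquivalence_f
    have := (D.stage (j + 1)).weakEquivalence_f
    have : WeakEquivalence (c j) := weakEquivalence_of_precomp_of_fac (hfc j)
    exact mem_trivialFibrations _
  obtain ⟨T, κ, hT⟩ := exists_isSeqLim F c
  -- Both towers are every second term of the single tower `⋯ ⟶ F (j + 1) ⟶ Q (j + 1) ⟶ F j ⟶ Q j`.
  have hQ : IsSeqLim (fun j => (D.stage j).Q) q T (fun j => κ j ≫ pullback.fst _ _) :=
    { w := fun j => by rw [← hT.w j]; simp only [c, q, Category.assoc]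
      lift := fun {W} g hg => by
        obtain ⟨h, hh⟩ := hT.lift (fun j => g (j + 1) ≫ φ j) (fun j => by
          rw [Category.assoc, ← hg (j + 1)]
          simp only [c, q, Category.assoc])
        refine ⟨h, fun j => ?_⟩
        rw [← Category.assoc, hh, Category.assoc]
        exact hg j
      ext := fun {W} g h H => hT.ext (fun j => by
        rw [← hT.w j]
        simpa only [c, Category.assoc] using H (j + 1) =≫ φ j) }
  obtain ⟨ρ, hρ⟩ := hP.lift (fun j => (κ j ≫ pullback.fst _ _) ≫ (D.stage j).r) (fun j => by
    rw [Category.assoc, ← hφ, ← hQ.w j]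
    simp only [q, Category.assoc])
  have hρt : trivialFibrations M ρ := by
    rw [← cofibrations_rlp]
    intro S T i hi
    refine hQ.exists_lift hP (fun j => (D.stage j).r) i ?_ ?_ ρ hρ
    · exact inferInstanceAs (HasLiftingProperty i (𝟙 _))
    · intro n s l t h1 h2 h3
      have : HasLiftingProperty i (pullback.lift _ _ (hφ n)) := by
        have := hφt n
        rw [← cofibrations_rlp] at this
        exact this i hi
      have sq : CommSq s i (pullback.lift _ _ (hφ n)) (pullback.lift l t h3) :=
        ⟨by
          apply pullback.hom_ext
          · rw [Category.assoc, Category.assoc, pullback.lift_fst, pullback.lift_fst]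
            exact h1
          · rw [Category.assoc, Category.assoc, pullback.lift_snd, pullback.lift_snd]
            exact h2⟩
      refine ⟨sq.lift, sq.fac_left, ?_, ?_⟩
      · have := sq.fac_right =≫ pullback.fst _ _
        rwa [Category.assoc, pullback.lift_fst, pullback.lift_fst] at this
      · have := sq.fac_right =≫ pullback.snd _ _
        rwa [Category.assoc, pullback.lift_snd, pullback.lift_snd] at this
  obtain ⟨x, hx⟩ := hT.lift (fun j => (D.stage j).f) hfc
  have h0 := hT.trivialFibrations hc
  obtain ⟨_, _⟩ := (mem_trivialFibrations_iff _).1 h0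
  obtain ⟨_, _⟩ := (mem_trivialFibrations_iff _).1 hρt
  have := (D.stage 0).weakEquivalence_f
  have : WeakEquivalence x := weakEquivalence_of_postcomp_of_fac (hx 0)
  have hfx : x ≫ ρ = f := hP.ext (fun j => by
    rw [Category.assoc, hρ, hf, ← Category.assoc, ← Category.assoc, hx, pullback.lift_fst,
      Stage.fac])
  rw [← hfx]
  infer_instance

end InterleavedTower

end


/-! ## Coaugmented towers -/

section

variable {K : Type u} [Category.{v} K] {N : Type u'} [Category.{v'} N]

/-- A natural transformation, as a functor to the category of arrows. -/
@[simps]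
def arrowFunctor {F F' : K ⥤ N} (σ : F ⟶ F') : K ⥤ Arrow N where
  obj X := Arrow.mk (σ.app X)
  map f := Arrow.homMk (F.map f) (F'.map f)

variable {U : K ⥤ N} {G : N ⥤ K} (adj : U ⊣ G) {W₁ W₂ : MorphismProperty N}
  (data : MorphismProperty.FunctorialFactorizationData W₁ W₂)

namespace CoaugmentedTower

variable (U)

/-- The intermediate object in the factorization of `U X ⟶ U S(X)`. -/
def E (s : Under (𝟭 K)) : K ⥤ N :=
  arrowFunctor (Functor.whiskerRight s.hom U) ⋙ data.Z

/-- The first map of the factorization. -/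
def e (s : Under (𝟭 K)) : U ⟶ E U data s where
  app X := data.i.app ((arrowFunctor (Functor.whiskerRight s.hom U)).obj X)
  naturality _ _ f :=
    data.i.naturality ((arrowFunctor (Functor.whiskerRight s.hom U)).map f)

/-- The second map of the factorization. -/
def b (s : Under (𝟭 K)) : E U data s ⟶ s.right ⋙ U where
  app X := data.p.app ((arrowFunctor (Functor.whiskerRight s.hom U)).obj X)
  naturality _ _ f :=
    data.p.naturality ((arrowFunctor (Functor.whiskerRight s.hom U)).map f)

lemma e_b_app (s : Under (𝟭 K)) (X : K) :
    (e U data s).app X ≫ (b U data s).app X = U.map (s.hom.app X) :=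
  data.fac_app (f := (arrowFunctor (Functor.whiskerRight s.hom U)).obj X)

variable {U}

/-- The unit of the adjunction on `S`. -/
abbrev unitS (s : Under (𝟭 K)) : s.right ⟶ (s.right ⋙ U) ⋙ G := Functor.whiskerLeft s.right adj.unit

variable (U G) in
/-- The image under `G` of the second map of the factorization. -/
abbrev mapB (s : Under (𝟭 K)) : E U data s ⋙ G ⟶ (s.right ⋙ U) ⋙ G :=
  Functor.whiskerRight (b U data s) G

/-- The map to the image under `G` of the intermediate object. -/
def unitE (s : Under (𝟭 K)) : 𝟭 K ⟶ E U data s ⋙ G where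
  app X := adj.unit.app X ≫ G.map ((e U data s).app X)
  naturality X Y f := by
    have := (e U data s).naturality f
    dsimp at this ⊢
    rw [← adj.unit_naturality_assoc, ← G.map_comp, this, Category.assoc, G.map_comp]

lemma unitE_mapB (s : Under (𝟭 K)) : s.hom ≫ unitS adj s = unitE adj data s ≫ mapB U G data s := by
  ext X
  dsimp [unitE]
  rw [Category.assoc, ← G.map_comp, e_b_app, adj.unit_naturality]

variable [HasPullbacks K]

/-- The next coaugmented functor. -/
noncomputable def next (s : Under (𝟭 K)) : Under (𝟭 K) :=
  Under.mk (Y := pullback (unitS adj s) (mapB U G data s))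
    (pullback.lift s.hom (unitE adj data s) (unitE_mapB adj data s))

/-- The map from the next functor. -/
noncomputable def p (s : Under (𝟭 K)) : (next adj data s).right ⟶ s.right :=
  pullback.fst (unitS adj s) (mapB U G data s)

lemma hom_p (s : Under (𝟭 K)) : (next adj data s).hom ≫ p adj data s = s.hom :=
  pullback.lift_fst _ _ _

/-- The second projection from the next functor. -/
noncomputable def q (s : Under (𝟭 K)) : (next adj data s).right ⟶ E U data s ⋙ G :=
  pullback.snd (unitS adj s) (mapB U G data s)

lemma hom_q (s : Under (𝟭 K)) : (next adj data s).hom ≫ q adj data s = unitE adj data s :=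
  pullback.lift_snd _ _ _

/-- The map from the next functor to the intermediate object. -/
noncomputable def a (s : Under (𝟭 K)) : (next adj data s).right ⋙ U ⟶ E U data s :=
  Functor.whiskerRight (q adj data s) U ≫
    Functor.whiskerLeft (E U data s) adj.counit

lemma isPullback_app (s : Under (𝟭 K)) (X : K) :
    IsPullback ((p adj data s).app X) ((q adj data s).app X)
      (adj.unit.app (s.right.obj X)) (G.map ((b U data s).app X)) :=
  (IsPullback.of_hasPullback (unitS adj s) (mapB U G data s)).map ((evaluation K K).obj X)

/-- `a` is the adjoint transpose of `q`, so this is the transpose of the pullback square. Together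
with `hom_a_app` it interleaves the two towers. -/
lemma a_b_app (s : Under (𝟭 K)) (X : K) :
    (a adj data s).app X ≫ (b U data s).app X = U.map ((p adj data s).app X) := by
  have h := U.congr_map (isPullback_app adj data s X).w
  dsimp [a]
  rw [Category.assoc]
  have h2 := adj.counit_naturality ((b U data s).app X)
  dsimp at h2
  erw [← h2]
  rw [← U.map_comp_assoc, ← (isPullback_app adj data s X).w, U.map_comp, Category.assoc]
  erw [adj.left_triangle_components]
  exact Category.comp_id _

lemma hom_a_app (s : Under (𝟭 K)) (X : K) :
    U.map ((next adj data s).hom.app X) ≫ (a adj data s).app X = (e U data s).app X := by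
  have h1 := congr_app (hom_q adj data s) X
  dsimp at h1
  dsimp [a]
  rw [← U.map_comp_assoc, h1]
  dsimp [unitE]
  rw [U.map_comp, Category.assoc]
  erw [adj.counit_naturality]
  rw [← Category.assoc]
  erw [adj.left_triangle_components]
  exact Category.id_comp _

/-- `p` is a base change of `G b`, and lifting `f` against `G b` is lifting `U f` against `b`. -/
lemma hasLiftingProperty_p_app (s : Under (𝟭 K)) (X : K) {A B : K} (f : A ⟶ B)
    (h : HasLiftingProperty (U.map f) ((b U data s).app X)) :
    HasLiftingProperty f ((p adj data s).app X) := by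
  have : HasLiftingProperty f (G.map ((b U data s).app X)) :=
    (adj.hasLiftingProperty_iff _ _).1 h
  exact (isPullback_app adj data s X).flip.hasLiftingProperty f

variable [HasTerminal K]

/-- The tower of coaugmented functors. -/
noncomputable def stage (j : ℕ) : Under (𝟭 K) :=
  Nat.rec (Under.mk (Y := (Functor.const K).obj (⊤_ K)) { app := fun _ => terminal.from _ })
    (fun _ s => next adj data s) j

/-- The transition maps of the tower. -/
noncomputable def trans (j : ℕ) : (stage adj data (j + 1)).right ⟶ (stage adj data j).right :=
  p adj data (stage adj data j)

/-- The tower of functors. -/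
noncomputable def diagram : ℕᵒᵖ ⥤ K ⥤ K :=
  Functor.ofOpSequence (X := fun j => (stage adj data j).right) (trans adj data)

lemma diagram_map_succ (j : ℕ) :
    (diagram adj data).map (homOfLE (Nat.le_add_right j 1)).op = trans adj data j :=
  Functor.ofOpSequence_map_homOfLE_succ (X := fun j => (stage adj data j).right) _ _

variable [HasLimitsOfShape ℕᵒᵖ K]

/-- The limit of the tower of functors. -/
noncomputable def T : K ⥤ K := limit (diagram adj data)

/-- The projections from the limit of the tower. -/
noncomputable def π (j : ℕ) : T adj data ⟶ (stage adj data j).right :=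
  limit.π (diagram adj data) (op j)

/-- The coaugmentation of the limit of the tower. -/
noncomputable def ι : 𝟭 K ⟶ T adj data :=
  limit.lift (diagram adj data)
    { pt := 𝟭 K
      π := NatTrans.ofOpSequence (F := (Functor.const _).obj (𝟭 K))
        (fun j => (stage adj data j).hom) (fun j => by
          rw [diagram_map_succ]
          exact (Category.id_comp _).trans (hom_p adj data (stage adj data j)).symm) }

lemma ι_π (j : ℕ) : ι adj data ≫ π adj data j = (stage adj data j).hom :=
  limit.lift_π _ _

lemma isSeqLim_app {N' : Type*} [Category* N'] (V : K ⥤ N') [PreservesLimitsOfShape ℕᵒᵖ V] (X : K) :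
    IsSeqLim (fun j => V.obj ((stage adj data j).right.obj X))
      (fun j => V.map ((trans adj data j).app X))
      (V.obj ((T adj data).obj X)) (fun j => V.map ((π adj data j).app X)) := by
  have h := IsSeqLim.of_isLimit (isLimitOfPreserves ((evaluation K K).obj X ⋙ V)
    (limit.isLimit (diagram adj data)))
  simp only [Functor.comp_map, diagram_map_succ] at h
  exact h

/-- The maps to the terminal object from the limit of the tower have the right lifting property
with respect to all maps that are sent by `U` to maps with the left lifting property with respect
to `W₂`. -/
lemma hasLiftingProperty_T_obj (X : K) {A B : K} (f : A ⟶ B) (hf : W₂.llp (U.map f)) :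
    HasLiftingProperty f (terminal.from ((T adj data).obj X)) := by
  have hc : IsSeqLim (fun _ => ⊤_ K) (fun _ => 𝟙 _) (⊤_ K) (fun _ => 𝟙 _) :=
    { w := fun _ => by simp
      lift := fun f _ => ⟨terminal.from _, fun _ => Subsingleton.elim _ _⟩
      ext := fun _ => Subsingleton.elim _ _ }
  refine (isSeqLim_app adj data (𝟭 K) X).exists_lift hc (fun _ => terminal.from _) f ?_ ?_ _
    (fun _ => Subsingleton.elim _ _)
  -- The tower starts at the terminal functor, so the bottom lifting problem is trivial.
  · have : IsIso (terminal.from (((stage adj data 0).right).obj X)) := by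
      have : terminal.from (((stage adj data 0).right).obj X) = 𝟙 (⊤_ K) := Subsingleton.elim _ _
      rw [this]
      exact IsIso.id (⊤_ K)
    exact inferInstanceAs (HasLiftingProperty f (terminal.from (((stage adj data 0).right).obj X)))
  · intro n s l t h1 _ _
    have : HasLiftingProperty f ((trans adj data n).app X) := hasLiftingProperty_p_app adj data (stage adj data n) X f (hf _ (data.hp _))
    have sq : CommSq s f ((trans adj data n).app X) l := ⟨h1⟩
    exact ⟨sq.lift, sq.fac_left, sq.fac_right, Subsingleton.elim _ _⟩

end CoaugmentedTower

end


/-! ## Functorial resolutions in functor categories -/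

section

variable {I : Type} [SmallCategory I] {M : Type u} [Category.{v} M]

/-- Over a discrete category, lifts can be chosen objectwise, since naturality is automatic. -/
lemma llp_functorCategory_discrete {J : Type w} {W : MorphismProperty M} {A B : Discrete J ⥤ M}
    (f : A ⟶ B) (hf : ∀ j, W.llp (f.app j)) : (W.functorCategory (Discrete J)).llp f := by
  intro S T g hg
  refine ⟨fun {s t} sq => ?_⟩
  have sqj (j : Discrete J) : CommSq (s.app j) (f.app j) (g.app j) (t.app j) :=
    ⟨congr_app sq.w j⟩
  have hl (j : Discrete J) : (sqj j).HasLift := (hf j _ (hg j)).sq_hasLift _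
  refine ⟨⟨⟨Discrete.natTrans (fun j => (sqj j).lift), ?_, ?_⟩⟩⟩
  · ext j
    exact (sqj j).fac_left
  · ext j
    exact (sqj j).fac_right

variable [ModelCategory M]

/-- A map with the right lifting property with respect to levelwise trivial cofibrations is
a levelwise fibration. -/
lemma fibration_app_of_rlp [HasColimits M] {S T : I ⥤ M} (g : S ⟶ T)
    (hg : ((trivialCofibrations M).functorCategory I).rlp g) (k : I) : Fibration (g.app k) := by
  have : HasColimitsOfSize.{0, 0} M := hasColimitsOfSizeShrink.{0, 0, v, v} M
  have key : (trivialCofibrations M).rlp (g.app k) := by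
    intro A B i hi
    -- The left adjoint of evaluation at `k` sends `i` to coproducts of copies of `i` in each
    -- degree, and these are trivial cofibrations.
    refine ((evaluationAdjunctionRight M k).hasLiftingProperty_iff i g).1 (hg _ (fun t => ?_))
    have : MorphismProperty.IsStableUnderCoproducts.{0} (trivialCofibrations M) := by
      rw [← fibrations_llp]
      infer_instance
    have e : (Limits.Sigma.desc fun h => i ≫ Sigma.ι (fun _ : k ⟶ t => B) h) =
        Limits.Sigma.map (fun _ => i) := by
      ext
      simp
    change trivialCofibrations M (Limits.Sigma.desc fun h => i ≫ Sigma.ι (fun _ : k ⟶ t => B) h)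
    rw [e]
    exact MorphismProperty.colimMap _ (fun ⟨_⟩ => hi)
  rw [trivialCofibrations_rlp] at key
  exact (fibration_iff _).2 key

variable (I M) in
/-- The restriction of functors to the discrete category. -/
abbrev restrDiscrete : (I ⥤ M) ⥤ (Discrete I ⥤ M) :=
  (Functor.whiskeringLeft (Discrete I) I M).obj (Discrete.functor id)

lemma llp_restrDiscrete {A B : I ⥤ M} (f : A ⟶ B)
    (hf : (trivialCofibrations M).functorCategory I f) :
    ((fibrations M).functorCategory (Discrete I)).llp ((restrDiscrete I M).map f) :=
  llp_functorCategory_discrete _ (fun j => by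
    rw [fibrations_llp]
    exact hf _)

variable [HasLimits M]

variable (I M) in
/-- The adjunction between restriction and right Kan extension. -/
noncomputable abbrev restrDiscreteAdj : restrDiscrete I M ⊣ (Discrete.functor id).ran :=
  (Discrete.functor (id : I → I)).ranAdjunction M

open CoaugmentedTower

/-- The functorial factorization in the category of families of objects. -/
noncomputable abbrev factDiscrete (I : Type) (M : Type u) [Category.{v} M] [ModelCategory M]
    [MorphismProperty.HasFunctorialFactorization (trivialCofibrations M) (fibrations M)] :=
  (MorphismProperty.functorialFactorizationData (trivialCofibrations M)
    (fibrations M)).functorCategory (Discrete I)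

variable [MorphismProperty.HasFunctorialFactorization (trivialCofibrations M) (fibrations M)]

variable (I M) in
/-- A functorial replacement of functors by functors with the right lifting property
with respect to levelwise trivial cofibrations. -/
noncomputable def injRes : (I ⥤ M) ⥤ (I ⥤ M) :=
  T (restrDiscreteAdj I M) (factDiscrete I M)

variable (I M) in
/-- The coaugmentation of `injRes`. -/
noncomputable def injResι : 𝟭 (I ⥤ M) ⟶ injRes I M :=
  ι (restrDiscreteAdj I M) (factDiscrete I M)

lemma hasLiftingProperty_injRes (X : I ⥤ M) {A B : I ⥤ M} (f : A ⟶ B)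
    (hf : (trivialCofibrations M).functorCategory I f) :
    HasLiftingProperty f (terminal.from ((injRes I M).obj X)) :=
  hasLiftingProperty_T_obj _ _ X f (llp_restrDiscrete f hf)

/-- Limits and pullbacks of functors are computed pointwise, so evaluating the construction at `k`
gives an interleaved tower under `X.obj k`. -/
instance weakEquivalence_injResι_app [HasColimits M] (X : I ⥤ M) (k : I) :
    WeakEquivalence (((injResι I M).app X).app k) := by
  let adj := restrDiscreteAdj I M
  let data := factDiscrete I M
  let D : InterleavedTower (X.obj k) :=
    { Z := fun j => ((stage adj data j).right.obj X).obj k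
      E := fun j => ((E _ data (stage adj data j)).obj X).obj ⟨k⟩
      b := fun j => ((b _ data (stage adj data j)).app X).app ⟨k⟩
      a := fun j => ((a adj data (stage adj data j)).app X).app ⟨k⟩
      e := fun j => ((e (restrDiscrete I M) data (stage adj data j)).app X).app ⟨k⟩
      fac := fun j => by
        have h1 := congr_app (e_b_app (U := restrDiscrete I M) data (stage adj data (j + 1)) X) ⟨k⟩
        have h2 := congr_app (hom_a_app adj data (stage adj data j) X) ⟨k⟩
        exact (Category.assoc _ _ _).symm.trans
          ((congr_arg (· ≫ ((a adj data (stage adj data j)).app X).app ⟨k⟩) h1).trans h2)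
      fibration_b := fun j => (fibration_iff _).2 (data.hp _ _)
      -- The transition map lifts against levelwise trivial cofibrations, so it is a levelwise
      -- fibration, although `G` was applied only to a family of fibrations over the discrete
      -- category.
      fibration_p := fun j => by
        have h' : Fibration (((p adj data (stage adj data j)).app X).app k) :=
          fibration_app_of_rlp _ (fun _ _ f hf => hasLiftingProperty_p_app adj data _ X f
            (llp_restrDiscrete f hf _ (data.hp _))) k
        have h'' : Fibration (((a adj data (stage adj data j)).app X ≫
            (b _ data (stage adj data j)).app X).app ⟨k⟩) := by
          rw [a_b_app]
          exact h'
        exact h''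
      weakEquivalence_e := fun j => by
        have h := (data.hi ((arrowFunctor (Functor.whiskerRight (stage adj data j).hom
          (restrDiscrete I M))).obj X)) ⟨k⟩
        exact ((mem_trivialCofibrations_iff _).1 h).2 }
  have hP := isSeqLim_app adj data ((evaluation I M).obj k) X
  have hp (j : ℕ) : ((trans adj data j).app X).app k = D.p j :=
    (congr_app (a_b_app adj data (stage adj data j) X) ⟨k⟩).symm
  refine D.weakEquivalence_lift (P := ((injRes I M).obj X).obj k)
    (π := fun j => ((π adj data j).app X).app k) ?_ _ ?_
  · have hp' : D.p = fun j => ((trans adj data j).app X).app k := funext (fun j => (hp j).symm)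
    rw [hp']
    exact hP
  · intro n
    have h1 := congr_app (e_b_app (U := restrDiscrete I M) data (stage adj data n) X) ⟨k⟩
    have h2 := congr_app (congr_app (ι_π adj data n) X) k
    exact h2.trans h1.symm

end


/-! ## Maps from the boundary of a simplex -/

namespace SSet

/-- The simplex of the boundary attached to an injective map that is not an isomorphism. -/
def boundaryMk {n : ℕ} (θ : MatchingIndex n) : (∂Δ[n] : SSet.{v}).obj (op θ.obj.left) :=
  ⟨stdSimplex.objEquiv.symm θ.obj.hom, fun h => θ.property.2 (by
    have := θ.property.1
    have : Epi θ.obj.hom := SimplexCategory.epi_iff_surjective.2 h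
    exact isIso_of_mono_of_epi _)⟩

/-- The image of a simplex of the boundary. -/
noncomputable def boundaryImage {n : ℕ} {k : SimplexCategoryᵒᵖ}
    (x : (∂Δ[n] : SSet.{v}).obj k) : MatchingIndex n :=
  ⟨Over.mk (image.ι (stdSimplex.objEquiv x.1)), inferInstanceAs (Mono (image.ι _)), fun h => x.2 (by
    have h' : IsIso (image.ι (stdSimplex.objEquiv x.1)) := h
    have : Epi (stdSimplex.objEquiv x.1) := by
      rw [← image.fac (stdSimplex.objEquiv x.1)]
      exact epi_comp _ _
    exact SimplexCategory.epi_iff_surjective.1 this)⟩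

/-- The surjection onto the image of a simplex of the boundary. -/
noncomputable def boundaryEpi {n : ℕ} {k : SimplexCategoryᵒᵖ} (x : (∂Δ[n] : SSet.{v}).obj k) :
    k.unop ⟶ (boundaryImage x).obj.left :=
  factorThruImage (stdSimplex.objEquiv x.1)

instance {n : ℕ} {k : SimplexCategoryᵒᵖ} (x : (∂Δ[n] : SSet.{v}).obj k) :
    StrongEpi (boundaryEpi x) :=
  inferInstanceAs (StrongEpi (factorThruImage (stdSimplex.objEquiv x.1)))

lemma boundaryEpi_hom {n : ℕ} {k : SimplexCategoryᵒᵖ} (x : (∂Δ[n] : SSet.{v}).obj k) :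
    boundaryEpi x ≫ (boundaryImage x).obj.hom = stdSimplex.objEquiv x.1 :=
  image.fac _

lemma map_boundaryEpi {n : ℕ} {k : SimplexCategoryᵒᵖ} (x : (∂Δ[n] : SSet.{v}).obj k) :
    (∂Δ[n] : SSet.{v}).map (boundaryEpi x).op (boundaryMk (boundaryImage x)) = x := by
  apply Subtype.ext
  apply stdSimplex.objEquiv.injective
  exact boundaryEpi_hom x

/-- A map from the boundary of a simplex is determined by its values on proper faces. -/
lemma boundary_hom_ext {n : ℕ} {K : SSet.{v}} {s t : (∂Δ[n] : SSet.{v}) ⟶ K}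
    (h : ∀ θ : MatchingIndex n, s.app _ (boundaryMk θ) = t.app _ (boundaryMk θ)) : s = t := by
  ext k x
  rw [← map_boundaryEpi x]
  have hs := ConcreteCategory.congr_hom (s.naturality (boundaryEpi x).op)
    (boundaryMk (boundaryImage x))
  have ht := ConcreteCategory.congr_hom (t.naturality (boundaryEpi x).op)
    (boundaryMk (boundaryImage x))
  exact (hs.trans (congr_arg (K.map (boundaryEpi x).op) (h _))).trans ht.symm

/-- A compatible family of simplices indexed by the proper faces of `Δ[n]`
defines a map from the boundary. -/
lemma exists_boundary_hom {n : ℕ} {K : SSet.{v}}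
    (x : ∀ θ : MatchingIndex n, K.obj (op θ.obj.left))
    (hx : ∀ {θ θ' : MatchingIndex n} (h : θ ⟶ θ'), K.map h.hom.left.op (x θ') = x θ) :
    ∃ s : (∂Δ[n] : SSet.{v}) ⟶ K, ∀ θ, s.app _ (boundaryMk θ) = x θ := by
  -- The value on a simplex does not depend on how it is factored through a proper face: a strong
  -- epimorphism lifts against the image inclusion, which gives a map in the matching index
  -- category.
  have key {k l : SimplexCategoryᵒᵖ} (y : (∂Δ[n] : SSet.{v}).obj k)
      (θ : MatchingIndex n) (ψ : l.unop ⟶ θ.obj.left) (φ : l.unop ⟶ k.unop)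
      (h : φ ≫ stdSimplex.objEquiv y.1 = ψ ≫ θ.obj.hom) [StrongEpi ψ] :
      K.map (φ ≫ boundaryEpi y).op (x (boundaryImage y)) = K.map ψ.op (x θ) := by
    have := (boundaryImage y).property.1
    have sq : CommSq (φ ≫ boundaryEpi y) ψ (boundaryImage y).obj.hom θ.obj.hom :=
      ⟨by rw [Category.assoc, boundaryEpi_hom, h]⟩
    let δ : θ ⟶ boundaryImage y := ObjectProperty.homMk (Over.homMk sq.lift sq.fac_right)
    have hδ : ψ ≫ δ.hom.left = φ ≫ boundaryEpi y := sq.fac_left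
    rw [← hx δ, ← hδ, op_comp, K.map_comp]
    rfl
  refine ⟨{ app := fun k => ↾fun y => K.map (boundaryEpi y).op (x (boundaryImage y))
            naturality := fun k l φ => ?_ }, fun θ => ?_⟩
  · ext y
    have := key y (boundaryImage ((∂Δ[n] : SSet.{v}).map φ y))
      (boundaryEpi ((∂Δ[n] : SSet.{v}).map φ y)) φ.unop (by rw [boundaryEpi_hom]; rfl)
    refine this.symm.trans ?_
    rw [op_comp, K.map_comp]
    rfl
  · have := key (boundaryMk.{v} θ) θ (𝟙 _) (𝟙 _) (by rw [Category.id_comp, Category.id_comp]; rfl)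
    rw [Category.id_comp, op_id, K.map_id] at this
    exact this

end SSet

/-! ## Mapping simplicial sets -/

section

variable {M : Type u} [Category.{v} M]

/-- The simplicial set `[n] ↦ Hom(m, Φ n)`. -/
@[simps]
def mapSSet (Φ : SimplicialObject M) (m : M) : SSet.{v} where
  obj n := m ⟶ Φ.obj n
  map φ := ↾fun g => g ≫ Φ.map φ
  map_id n := by ext g; simp
  map_comp f g := by ext; simp

/-- The functoriality of `mapSSet` in the first variable. -/
@[simps]
def mapSSetMap (Φ : SimplicialObject M) {m m' : M} (f : m ⟶ m') :
    mapSSet Φ m' ⟶ mapSSet Φ m where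
  app n := ↾fun g => f ≫ g
  naturality _ _ φ := by ext g; exact (Category.assoc f g _).symm

variable [HasLimits M]

/-- The matching map of a simplicial object. -/
noncomputable def matchingMap (Φ : SimplicialObject M) (n : ℕ) :
    Φ.obj (op ⦋n⦌) ⟶ limit (matchingDiagram Φ n) :=
  limit.lift (matchingDiagram Φ n) (matchingCone Φ n)

lemma comp_matchingMap_π (Φ : SimplicialObject M) (n : ℕ) {m : M} (g : m ⟶ Φ.obj (op ⦋n⦌))
    (θ : MatchingIndex n) :
    (g ≫ matchingMap Φ n) ≫ limit.π (matchingDiagram Φ n) (op θ) = g ≫ Φ.map θ.obj.hom.op := by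
  rw [Category.assoc]
  exact congr_arg (fun z => g ≫ z) (limit.lift_π (matchingCone Φ n) (op θ))

omit [HasLimits M] in
lemma app_eq_comp_map {Φ : SimplicialObject M} {m : M} {k n : SimplexCategory}
    (t : SSet.stdSimplex.{v}.obj n ⟶ mapSSet Φ m) (θ : k ⟶ n) :
    t.app (op k) (SSet.stdSimplex.objEquiv.symm θ) =
      (show m ⟶ Φ.obj (op n) from SSet.yonedaEquiv t) ≫ Φ.map θ.op := by
  obtain ⟨y, rfl⟩ := SSet.yonedaEquiv.symm.surjective t
  rw [Equiv.apply_symm_apply]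
  rfl

/-- Maps from `m` to the matching object are maps from `∂Δ[n]` to `Map(m, Φ)`, and maps from `m` to
`Φ _⦋n⦌` are maps from `Δ[n]`; the two lifting problems are transposes of each other. -/
lemma hasLiftingProperty_matchingMap_iff (Φ : SimplicialObject M) (n : ℕ) {m m' : M}
    (f : m ⟶ m') :
    HasLiftingProperty f (matchingMap Φ n) ↔
      HasLiftingProperty (∂Δ[n] : (Δ[n] : SSet.{v}).Subcomplex).ι (mapSSetMap Φ f) := by
  constructor
  · intro hf
    refine ⟨fun {s t} sq => ?_⟩
    let y : m ⟶ Φ.obj (op ⦋n⦌) := SSet.yonedaEquiv t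
    let c : Cone (matchingDiagram Φ n) :=
      { pt := m'
        π :=
          { app := fun θ => s.app _ (SSet.boundaryMk θ.unop)
            naturality := fun θ θ' h => by
              have := ConcreteCategory.congr_hom (s.naturality h.unop.hom.left.op)
                (SSet.boundaryMk θ.unop)
              refine (Category.id_comp _).trans (Eq.trans ?_ this)
              refine congr_arg (fun z => s.app _ z) (Subtype.ext ?_)
              exact congr_arg SSet.stdSimplex.objEquiv.symm (Over.w h.unop.hom).symm } }
    have hc (θ : MatchingIndex n) : limit.lift _ c ≫ limit.π (matchingDiagram Φ n) (op θ) =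
        s.app _ (SSet.boundaryMk θ) := limit.lift_π c (op θ)
    have sq' : CommSq y f (matchingMap Φ n) (limit.lift _ c) := ⟨by
      apply limit.hom_ext
      rintro ⟨θ⟩
      rw [comp_matchingMap_π]
      refine (app_eq_comp_map t θ.obj.hom).symm.trans ?_
      have := ConcreteCategory.congr_hom (NatTrans.congr_app sq.w (op θ.obj.left))
        (SSet.boundaryMk θ)
      exact this.symm.trans ((congr_arg (fun z => f ≫ z) (hc θ).symm).trans
        (Category.assoc _ _ _).symm)⟩
    refine ⟨⟨⟨SSet.yonedaEquiv.symm sq'.lift, ?_, ?_⟩⟩⟩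
    · apply SSet.boundary_hom_ext
      intro θ
      have := sq'.fac_right =≫ limit.π _ (op θ)
      rw [comp_matchingMap_π] at this
      exact this.trans (hc θ)
    · refine (SSet.yonedaEquiv_symm_comp _ _).trans (SSet.yonedaEquiv.injective ?_)
      exact (Equiv.apply_symm_apply _ _).trans sq'.fac_left
  · intro hf
    refine ⟨fun {y t} sq => ?_⟩
    obtain ⟨s, hs⟩ := SSet.exists_boundary_hom (n := n) (K := mapSSet Φ m')
      (fun θ => t ≫ limit.π (matchingDiagram Φ n) (op θ)) (fun {θ θ'} h => by
        refine (Category.assoc _ _ _).trans ?_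
        have := limit.w (matchingDiagram Φ n) h.op
        rw [← this]
        rfl)
    let y' : Δ[n] ⟶ mapSSet Φ m := SSet.yonedaEquiv.symm y
    have sq' : CommSq s (∂Δ[n] : (Δ[n] : SSet.{v}).Subcomplex).ι (mapSSetMap Φ f) y' := ⟨by
      apply SSet.boundary_hom_ext
      intro θ
      have := sq.w =≫ limit.π _ (op θ)
      rw [comp_matchingMap_π] at this
      refine Eq.trans ?_ this.symm
      exact (congr_arg (fun z => f ≫ z) (hs θ)).trans (Category.assoc _ _ _).symm⟩
    refine ⟨⟨⟨SSet.yonedaEquiv sq'.lift, ?_, ?_⟩⟩⟩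
    · have := congr_arg SSet.yonedaEquiv sq'.fac_right
      rw [SSet.yonedaEquiv_comp] at this
      exact this.trans (Equiv.apply_symm_apply _ _)
    · apply limit.hom_ext
      rintro ⟨θ⟩
      refine (comp_matchingMap_π Φ n _ θ).trans (Eq.trans ?_ (hs θ))
      refine (app_eq_comp_map sq'.lift θ.obj.hom).symm.trans ?_
      exact ConcreteCategory.congr_hom (NatTrans.congr_app sq'.fac_left (op θ.obj.left))
        (SSet.boundaryMk θ)

end


/-! ## Copowers of simplicial objects -/

section

variable {I : Type} [SmallCategory I] {M : Type u} [Category.{v} M] [HasColimits M]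

/-- A pushout-product of an injection of sets and a map `f` has the left lifting property
with respect to all maps for which `f` has. -/
lemma hasLiftingProperty_copower {A B : Type v} (j : A → B) (hj : Function.Injective j)
    {m m' : M} (f : m ⟶ m') {P : M} {inl : (∐ fun _ : B => m) ⟶ P} {inr : (∐ fun _ : A => m') ⟶ P}
    (hP : IsPushout (Sigma.desc fun a => Sigma.ι (fun _ : B => m) (j a))
      (Sigma.desc fun a => f ≫ Sigma.ι (fun _ : A => m') a) inl inr)
    (c : P ⟶ ∐ fun _ : B => m')
    (hinl : inl ≫ c = Sigma.desc fun b => f ≫ Sigma.ι (fun _ : B => m') b)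
    (hinr : inr ≫ c = Sigma.desc fun a => Sigma.ι (fun _ : B => m') (j a))
    {S T : M} (q : S ⟶ T) [HasLiftingProperty f q] : HasLiftingProperty c q := by
  refine ⟨fun {s t} sq => ?_⟩
  have key (b : B) : ∃ l : m' ⟶ S, f ≫ l = Sigma.ι (fun _ => m) b ≫ inl ≫ s ∧
      l ≫ q = Sigma.ι (fun _ => m') b ≫ t ∧
      ∀ a, j a = b → l = Sigma.ι (fun _ => m') a ≫ inr ≫ s := by
    -- On the image of `j` the component is prescribed by the summand `m'` of the pushout
    -- (unambiguously, as `j` is injective); elsewhere it comes from lifting `f` against `q`.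
    by_cases hb : ∃ a, j a = b
    · obtain ⟨a, rfl⟩ := hb
      refine ⟨Sigma.ι (fun _ => m') a ≫ inr ≫ s, ?_, ?_, ?_⟩
      · have := Sigma.ι (fun _ => m) a ≫= hP.w =≫ s
        simpa using this.symm
      · rw [Category.assoc, Category.assoc, sq.w, reassoc_of% hinr]
        simp
      · rintro a' h
        rw [hj h]
    · have sq' : CommSq (Sigma.ι (fun _ => m) b ≫ inl ≫ s) f q (Sigma.ι (fun _ => m') b ≫ t) :=
        ⟨by
          rw [Category.assoc, Category.assoc, sq.w, reassoc_of% hinl]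
          simp⟩
      exact ⟨sq'.lift, sq'.fac_left, sq'.fac_right, fun a ha => (hb ⟨a, ha⟩).elim⟩
  choose l hl1 hl2 hl3 using key
  refine ⟨⟨⟨Sigma.desc l, hP.hom_ext ?_ ?_, ?_⟩⟩⟩
  · rw [reassoc_of% hinl]
    ext b
    simp [hl1]
  · rw [reassoc_of% hinr]
    ext a
    simp [hl3 (j a) a rfl]
  · ext b
    simp [hl2]

/-- The copower `k ↦ ∐_{K k} m`. -/
noncomputable def copower (K : I ⥤ Type v) (m : M) : I ⥤ M where
  obj k := ∐ fun _ : K.obj k => m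
  map φ := Sigma.desc fun x => Sigma.ι (fun _ => m) (K.map φ x)

/-- The inclusions in the copower. -/
noncomputable def copowerι (K : I ⥤ Type v) (m : M) {k : I} (x : K.obj k) :
    m ⟶ (copower K m).obj k :=
  Sigma.ι (fun _ : K.obj k => m) x

lemma copower_hom_ext {K : I ⥤ Type v} {m : M} {k : I} {T : M} {f g : (copower K m).obj k ⟶ T}
    (h : ∀ x, copowerι K m x ≫ f = copowerι K m x ≫ g) : f = g :=
  Sigma.hom_ext _ _ h

/-- Maps from the copower. -/
noncomputable def copowerDescApp {K : I ⥤ Type v} {m : M} {k : I} {T : M} (x : K.obj k → (m ⟶ T)) :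
    (copower K m).obj k ⟶ T :=
  Sigma.desc x

@[simp]
lemma copowerι_descApp {K : I ⥤ Type v} {m : M} {k : I} {T : M} (x : K.obj k → (m ⟶ T))
    (y : K.obj k) : copowerι K m y ≫ copowerDescApp x = x y :=
  Sigma.ι_desc _ _

@[simp]
lemma copowerι_descApp_assoc {K : I ⥤ Type v} {m : M} {k : I} {T T' : M} (x : K.obj k → (m ⟶ T))
    (y : K.obj k) (h : T ⟶ T') : copowerι K m y ≫ copowerDescApp x ≫ h = x y ≫ h := by
  rw [← Category.assoc, copowerι_descApp]

@[simp]
lemma copowerι_map (K : I ⥤ Type v) (m : M) {k l : I} (φ : k ⟶ l) (x : K.obj k) :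
    copowerι K m x ≫ (copower K m).map φ = copowerι K m (K.map φ x) :=
  Sigma.ι_desc _ _

@[simp]
lemma copowerι_map_assoc (K : I ⥤ Type v) (m : M) {k l : I} (φ : k ⟶ l) (x : K.obj k) {T : M}
    (h : (copower K m).obj l ⟶ T) :
    copowerι K m x ≫ (copower K m).map φ ≫ h = copowerι K m (K.map φ x) ≫ h := by
  rw [← Category.assoc, copowerι_map]

/-- The universal property of copowers. -/
noncomputable def copowerDesc {K : I ⥤ Type v} {m : M} {Φ : I ⥤ M}
    (x : K ⟶ Φ ⋙ coyoneda.obj (op m)) : copower K m ⟶ Φ where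
  app k := copowerDescApp (fun y => x.app k y)
  naturality k l φ := copower_hom_ext (fun y => by
    have := ConcreteCategory.congr_hom (x.naturality φ) y
    rw [copowerι_map_assoc, copowerι_descApp, copowerι_descApp_assoc]
    exact this)

@[simp]
lemma copowerι_desc_app {K : I ⥤ Type v} {m : M} {Φ : I ⥤ M}
    (x : K ⟶ Φ ⋙ coyoneda.obj (op m)) {k : I} (y : K.obj k) :
    copowerι K m y ≫ (copowerDesc x).app k = x.app k y :=
  copowerι_descApp _ _

/-- The universal property of copowers. -/
noncomputable def copowerHom {K : I ⥤ Type v} {m : M} {Φ : I ⥤ M}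
    (g : copower K m ⟶ Φ) : K ⟶ Φ ⋙ coyoneda.obj (op m) where
  app k := ↾fun y => copowerι K m y ≫ g.app k
  naturality k l φ := by
    ext y
    have := copowerι K m y ≫= g.naturality φ
    rw [copowerι_map_assoc, ← Category.assoc] at this
    exact this

/-- Functoriality of the copower in the first variable. -/
noncomputable def copowerMapLeft {K L : I ⥤ Type v} (i : K ⟶ L) (m : M) :
    copower K m ⟶ copower L m where
  app k := copowerDescApp fun x => copowerι L m (i.app k x)
  naturality k l φ := copower_hom_ext (fun x => by
    have := ConcreteCategory.congr_hom (i.naturality φ) x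
    simp only [types_comp_apply] at this
    simp [this])

@[simp]
lemma copowerι_mapLeft_app {K L : I ⥤ Type v} (i : K ⟶ L) (m : M) {k : I} (x : K.obj k) :
    copowerι K m x ≫ (copowerMapLeft i m).app k = copowerι L m (i.app k x) :=
  copowerι_descApp _ _

@[simp]
lemma copowerι_mapLeft_app_assoc {K L : I ⥤ Type v} (i : K ⟶ L) (m : M) {k : I} (x : K.obj k)
    {T : M} (h : (copower L m).obj k ⟶ T) :
    copowerι K m x ≫ (copowerMapLeft i m).app k ≫ h = copowerι L m (i.app k x) ≫ h := by
  rw [← Category.assoc, copowerι_mapLeft_app]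

/-- Functoriality of the copower in the second variable. -/
noncomputable def copowerMapRight (K : I ⥤ Type v) {m m' : M} (f : m ⟶ m') :
    copower K m ⟶ copower K m' where
  app k := copowerDescApp fun x => f ≫ copowerι K m' x
  naturality k l φ := copower_hom_ext (fun x => by simp)

@[simp]
lemma copowerι_mapRight_app (K : I ⥤ Type v) {m m' : M} (f : m ⟶ m') {k : I} (x : K.obj k) :
    copowerι K m x ≫ (copowerMapRight K f).app k = f ≫ copowerι K m' x :=
  copowerι_descApp _ _

@[simp]
lemma copowerι_mapRight_app_assoc (K : I ⥤ Type v) {m m' : M} (f : m ⟶ m') {k : I} (x : K.obj k)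
    {T : M} (h : (copower K m').obj k ⟶ T) :
    copowerι K m x ≫ (copowerMapRight K f).app k ≫ h = f ≫ copowerι K m' x ≫ h := by
  rw [← Category.assoc, copowerι_mapRight_app, Category.assoc]

lemma copowerMapLeft_mapRight {K L : I ⥤ Type v} (i : K ⟶ L) {m m' : M} (f : m ⟶ m') :
    copowerMapLeft i m ≫ copowerMapRight L f = copowerMapRight K f ≫ copowerMapLeft i m' := by
  ext k
  exact copower_hom_ext (fun x => by simp)

variable [ModelCategory M]

/-- Transposed along the copower adjunctions, the problem is to extend a map to `Φ` along the
pushout-product of `i` and `f`, which is a levelwise trivial cofibration. -/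
lemma hasLiftingProperty_of_rlp {K L : I ⥤ Type v} (i : K ⟶ L) [Mono i] {m m' : M} (f : m ⟶ m')
    (hf : trivialCofibrations M f) [HasTerminal (I ⥤ M)] (Φ : I ⥤ M)
    (hΦ : ((trivialCofibrations M).functorCategory I).rlp (terminal.from Φ)) :
    HasLiftingProperty i (Functor.whiskerLeft Φ (coyoneda.map f.op)) := by
  refine ⟨fun {s t} sq => ?_⟩
  let c : pushout (copowerMapLeft i m) (copowerMapRight K f) ⟶ copower L m' :=
    pushout.desc (copowerMapRight L f) (copowerMapLeft i m') (copowerMapLeft_mapRight i f)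
  have hinl : pushout.inl _ _ ≫ c = copowerMapRight L f := pushout.inl_desc _ _ _
  have hinr : pushout.inr _ _ ≫ c = copowerMapLeft i m' := pushout.inr_desc _ _ _
  have hc : (trivialCofibrations M).functorCategory I c := fun k => by
    rw [← fibrations_llp]
    intro S T q hq
    have hq' : Fibration q := (fibration_iff _).2 hq
    obtain ⟨_, _⟩ := (mem_trivialCofibrations_iff _).1 hf
    exact hasLiftingProperty_copower (i.app k) ((mono_iff_injective _).1 inferInstance) f
      ((IsPushout.of_hasPushout (copowerMapLeft i m) (copowerMapRight K f)).map
        ((evaluation I M).obj k)) (c.app k) (congr_app hinl k) (congr_app hinr k) q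
  have w : copowerMapLeft i m ≫ copowerDesc t = copowerMapRight K f ≫ copowerDesc s := by
    ext k
    refine copower_hom_ext (fun x => ?_)
    have := ConcreteCategory.congr_hom (congr_app sq.w k) x
    simp only [NatTrans.comp_app, copowerι_mapLeft_app_assoc, copowerι_desc_app,
      copowerι_mapRight_app_assoc]
    exact this.symm
  have := hΦ _ hc
  have sq' : CommSq (pushout.desc (copowerDesc t) (copowerDesc s) w) c (terminal.from Φ)
    (terminal.from _) := ⟨Subsingleton.elim _ _⟩
  have hl := sq'.fac_left
  have hl1 : copowerMapRight L f ≫ sq'.lift = copowerDesc t := by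
    rw [← hinl, Category.assoc, hl, pushout.inl_desc]
  have hl2 : copowerMapLeft i m' ≫ sq'.lift = copowerDesc s := by
    rw [← hinr, Category.assoc, hl, pushout.inr_desc]
  refine ⟨⟨⟨copowerHom sq'.lift, ?_, ?_⟩⟩⟩
  · ext k x
    have := copowerι K m' x ≫= congr_app hl2 k
    simp only [NatTrans.comp_app, copowerι_mapLeft_app_assoc, copowerι_desc_app] at this
    exact this
  · ext k x
    have := copowerι L m x ≫= congr_app hl1 k
    simp only [NatTrans.comp_app, copowerι_mapRight_app_assoc, copowerι_desc_app] at this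
    exact this

end

/-! ### Reedy fibrancy of the functorial resolution. -/

section

variable {M : Type u} [Category.{v} M] [HasColimits M] [ModelCategory M] [HasLimits M]

lemma isReedyFibrant_of_rlp [HasTerminal (SimplexCategoryᵒᵖ ⥤ M)] (Φ : SimplexCategoryᵒᵖ ⥤ M)
    (hΦ : ((trivialCofibrations M).functorCategory SimplexCategoryᵒᵖ).rlp (terminal.from Φ)) :
    IsReedyFibrant (M := M) Φ := by
  intro n
  have key : (trivialCofibrations M).rlp (matchingMap Φ n) := fun m m' f hf =>
    (hasLiftingProperty_matchingMap_iff Φ n f).2 (hasLiftingProperty_of_rlp (I := SimplexCategoryᵒᵖ)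
      (∂Δ[n] : (Δ[n] : SSet.{v}).Subcomplex).ι f hf Φ hΦ)
  rw [trivialCofibrations_rlp] at key
  exact (fibration_iff _).2 key

variable [MorphismProperty.HasFunctorialFactorization (trivialCofibrations M) (fibrations M)]

lemma isReedyFibrant_injRes (Φ : SimplexCategoryᵒᵖ ⥤ M) :
    IsReedyFibrant (M := M) ((injRes SimplexCategoryᵒᵖ M).obj Φ) :=
  isReedyFibrant_of_rlp _ (fun _ _ f hf => hasLiftingProperty_injRes Φ f hf)

end


/-! ## Vertices and horns -/

namespace SSet

/-- A class of maps of simplicial sets with the closure properties that make it possible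
to compare vertex inclusions and horn inclusions. -/
structure IsLeftCancellable (W : MorphismProperty SSet.{v}) : Prop where
  isMultiplicative : W.IsMultiplicative
  respectsIso : W.RespectsIso
  isStableUnderCobaseChange : W.IsStableUnderCobaseChange
  cancel {A B C : SSet.{v}} (i : A ⟶ B) (j : B ⟶ C) [Mono j] (hi : W i) (hij : W (i ≫ j)) : W j

variable {W : MorphismProperty SSet.{v}} (hW : IsLeftCancellable W)

/-- The condition that the inclusion of a vertex in a subcomplex belongs to `W`. -/
def Subcomplex.VertexMem (W : MorphismProperty SSet.{v}) {X : SSet.{v}} (x : X _⦋0⦌)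
    (A : X.Subcomplex) : Prop :=
  ∃ h : x ∈ A.obj (op ⦋0⦌), W ((SSet.yonedaEquiv (X := (A : SSet.{v})) (n := ⦋0⦌)).symm ⟨x, h⟩)

variable {X : SSet.{v}} {x : X _⦋0⦌}

namespace Subcomplex.VertexMem

include hW

lemma homOfLE {A B : X.Subcomplex} (hA : VertexMem W x A) (hB : VertexMem W x B) (h : A ≤ B) :
    W (Subcomplex.homOfLE h) := by
  obtain ⟨hxA, hA⟩ := hA
  obtain ⟨hxB, hB⟩ := hB
  exact hW.cancel _ _ hA hB

lemma ι {A : X.Subcomplex} (hA : VertexMem W x A) (hx : W (yonedaEquiv.symm x)) :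
    W A.ι := by
  obtain ⟨hxA, hA⟩ := hA
  exact hW.cancel _ _ hA hx

/-- `A ⊓ B ⟶ B` belongs to `W` by cancellation, so its cobase change `A ⟶ A ⊔ B` does; precompose
with the vertex of `A`. -/
lemma sup {A B : X.Subcomplex} (hA : VertexMem W x A) (hB : VertexMem W x B)
    (hAB : VertexMem W x (A ⊓ B)) : VertexMem W x (A ⊔ B) := by
  have h1 := homOfLE hW hAB hB inf_le_right
  obtain ⟨hxA, hA⟩ := hA
  have sq : Subcomplex.BicartSq (A ⊓ B) A B (A ⊔ B) := { sup_eq := rfl, inf_eq := rfl }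
  have := hW.isStableUnderCobaseChange
  have := hW.isMultiplicative
  have h2 : W (Subcomplex.homOfLE (le_sup_left : A ≤ A ⊔ B)) :=
    W.of_isPushout sq.isPushout h1
  refine ⟨Or.inl hxA, ?_⟩
  exact W.comp_mem _ _ hA h2

lemma face {n m : ℕ} {k : Fin (n + 1)} {S : Finset (Fin (n + 1))} (hk : k ∈ S)
    (hS : S.card = m + 1)
    (hm : ∀ y : (Δ[m] : SSet.{v}) _⦋0⦌, W (yonedaEquiv.symm y)) :
    VertexMem W (stdSimplex.obj₀Equiv.symm k) (stdSimplex.face S) := by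
  have h := (stdSimplex.obj₀Equiv_symm_mem_face_iff.{v} S k).2 hk
  refine ⟨h, ?_⟩
  let e := stdSimplex.isoOfRepresentableBy (stdSimplex.faceRepresentableBy.{v} S m
    (S.orderIsoOfFin hS))
  have := hW.respectsIso
  have := hm (e.inv.app _ ⟨_, h⟩)
  rw [← W.cancel_right_of_respectsIso _ e.hom, yonedaEquiv_symm_comp] at this
  convert this
  exact congr_arg yonedaEquiv.symm (ConcreteCategory.congr_hom (NatTrans.congr_app e.inv_hom_id (op ⦋0⦌)) ⟨_, h⟩).symm

end Subcomplex.VertexMem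

/-- A union of faces of a simplex. -/
def unionFaces {n : ℕ} (l : List (Finset (Fin (n + 1)))) : (Δ[n] : SSet.{v}).Subcomplex :=
  l.foldr (fun S A => stdSimplex.face S ⊔ A) ⊥

lemma mem_unionFaces_iff {n : ℕ} (l : List (Finset (Fin (n + 1)))) {k : SimplexCategoryᵒᵖ}
    (x : (Δ[n] : SSet.{v}).obj k) :
    x ∈ (unionFaces l).obj k ↔ ∃ S ∈ l, x ∈ (stdSimplex.face S).obj k := by
  induction l with
  | nil =>
    simp [unionFaces]
  | cons T l ih =>
    simp only [List.mem_cons, exists_eq_or_imp, ← ih]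
    rfl

lemma face_inf_unionFaces {n : ℕ} (T : Finset (Fin (n + 1))) (l : List (Finset (Fin (n + 1)))) :
    unionFaces l ⊓ stdSimplex.face.{v} T = unionFaces (l.map (· ∩ T)) := by
  ext k x
  have : x ∈ (unionFaces l ⊓ stdSimplex.face.{v} T).obj k ↔
    x ∈ (unionFaces l).obj k ∧ x ∈ (stdSimplex.face.{v} T).obj k := Iff.rfl
  rw [this, mem_unionFaces_iff, mem_unionFaces_iff]
  have h (S : Finset (Fin (n + 1))) : x ∈ (stdSimplex.face.{v} (S ∩ T)).obj k ↔
      x ∈ (stdSimplex.face.{v} S).obj k ∧ x ∈ (stdSimplex.face.{v} T).obj k := by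
    have := stdSimplex.face_inter_face.{v} S T
    rw [← Finset.inf_eq_inter, ← this]
    rfl
  simp only [List.mem_map, exists_exists_and_eq_and, h]
  tauto

include hW in
-- Induction on the number of faces. Intersecting a union of faces with one more face gives a union
-- of equally many faces, still containing the vertex `k` and no larger, so `VertexMem.sup` applies.
lemma vertexMem_unionFaces {n N : ℕ} (k : Fin (n + 1))
    (hN : ∀ (m : ℕ) (_ : m ≤ N) (y : (Δ[m] : SSet.{v}) _⦋0⦌), W (yonedaEquiv.symm y))
    (T : Finset (Fin (n + 1))) (l : List (Finset (Fin (n + 1))))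
    (hT : k ∈ T ∧ T.card ≤ N + 1) (hl : ∀ S ∈ l, k ∈ S ∧ S.card ≤ N + 1) :
    Subcomplex.VertexMem W (stdSimplex.obj₀Equiv.symm k) (unionFaces (T :: l)) := by
  have hface (T : Finset (Fin (n + 1))) (hT : k ∈ T ∧ T.card ≤ N + 1) :
      Subcomplex.VertexMem W (stdSimplex.obj₀Equiv.symm k) (stdSimplex.face T) := by
    obtain ⟨m, hm⟩ : ∃ m, T.card = m + 1 :=
      ⟨T.card - 1, by have := Finset.card_pos.2 ⟨k, hT.1⟩; omega⟩
    exact Subcomplex.VertexMem.face hW hT.1 hm (hN m (by omega))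
  obtain ⟨d, hd⟩ : ∃ d, l.length = d := ⟨_, rfl⟩
  induction d generalizing T l with
  | zero =>
    obtain rfl := List.length_eq_zero_iff.1 hd
    have : unionFaces [T] = stdSimplex.face.{v} T := sup_bot_eq _
    rw [this]
    exact hface T hT
  | succ d ih =>
    obtain _ | ⟨S, l⟩ := l
    · simp at hd
    · have hd' : l.length = d := by simpa using hd
      have hS := hl S (by simp)
      have hl' : ∀ S ∈ l, k ∈ S ∧ S.card ≤ N + 1 := fun S' h => hl S' (by simp [h])
      have e : unionFaces (T :: S :: l) = unionFaces.{v} (S :: l) ⊔ stdSimplex.face T :=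
        sup_comm _ _
      rw [e]
      refine Subcomplex.VertexMem.sup hW (ih S l hS hl' hd') (hface T hT) ?_
      rw [face_inf_unionFaces]
      refine ih (S ∩ T) (l.map (· ∩ T)) ⟨by simp [hS.1, hT.1],
        (Finset.card_le_card Finset.inter_subset_left).trans hS.2⟩ (fun S' hS' => ?_) (by simpa)
      obtain ⟨S'', h1, rfl⟩ := List.mem_map.1 hS'
      exact ⟨by simp [(hl' S'' h1).1, hT.1],
        (Finset.card_le_card Finset.inter_subset_left).trans (hl' S'' h1).2⟩

include hW in
lemma vertexMem_horn {n : ℕ} (k : Fin (n + 2))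
    (hn : ∀ (m : ℕ) (_ : m ≤ n) (y : (Δ[m] : SSet.{v}) _⦋0⦌), W (yonedaEquiv.symm y)) :
    Subcomplex.VertexMem W (stdSimplex.obj₀Equiv.symm k) (horn.{v} (n + 1) k) := by
  let l : List (Finset (Fin (n + 2))) := ({k}ᶜ : Finset (Fin (n + 2))).toList.map (fun j => {j}ᶜ)
  have hl : ∀ S ∈ l, k ∈ S ∧ S.card ≤ n + 1 := by
    intro S hS
    obtain ⟨j, hj, rfl⟩ := List.mem_map.1 hS
    simp only [Finset.mem_toList, Finset.mem_compl, Finset.mem_singleton] at hj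
    simp [Finset.card_compl, Ne.symm hj]
  have e : horn.{v} (n + 1) k = unionFaces l := by
    rw [horn_eq_iSup]
    ext d x
    rw [mem_unionFaces_iff]
    simp [l]
  rw [e]
  obtain h | ⟨T, l', h⟩ : l = [] ∨ ∃ T l', l = T :: l' := by
    cases l <;> simp
  -- The horn has `n + 1` faces, hence at least one.
  · have := congr_arg List.length h
    simp [l, Finset.card_compl] at this
  · rw [h] at hl ⊢
    exact vertexMem_unionFaces hW k hn T l' (hl T (by simp)) (fun S hS => hl S (by simp [hS]))

include hW in
/-- If `W` contains all vertex inclusions, then it contains the horn inclusions. -/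
lemma horn_ι_mem_of_vertex (hv : ∀ (m : ℕ) (y : (Δ[m] : SSet.{v}) _⦋0⦌), W (yonedaEquiv.symm y))
    {n : ℕ} (k : Fin (n + 2)) : W (horn.{v} (n + 1) k).ι :=
  -- The vertex `k` lies in the horn; its inclusions in the horn and in the simplex are both in `W`,
  -- so cancellation applies.
  (vertexMem_horn hW k (fun m _ => hv m)).ι hW (hv _ _)

include hW in
/-- If `W` contains all horn inclusions, then it contains the vertex inclusions. -/
lemma vertex_mem_of_horn (hh : ∀ (n : ℕ) (k : Fin (n + 2)), W (horn.{v} (n + 1) k).ι)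
    (m : ℕ) (y : (Δ[m] : SSet.{v}) _⦋0⦌) : W (yonedaEquiv.symm y) := by
  induction m using Nat.strong_induction_on with
  | _ m ih =>
  obtain _ | m := m
  · have := hW.isMultiplicative
    have e : (yonedaEquiv.symm y : Δ[0] ⟶ Δ[0]) = 𝟙 _ := by
      apply yonedaEquiv.injective
      exact stdSimplex.ext _ _ (fun i => Subsingleton.elim (α := Fin 1) _ _)
    rw [e]
    exact W.id_mem _
  · obtain ⟨k, rfl⟩ := stdSimplex.obj₀Equiv.symm.surjective y
    -- The faces of the horn have dimension at most `m`, so the induction hypothesis puts vertex to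
    -- horn in `W`; then compose with the horn inclusion.
    obtain ⟨h, hk⟩ := vertexMem_horn hW k (fun i hi => ih i (by omega))
    have := hW.isMultiplicative
    exact W.comp_mem _ _ hk (hh m k)

end SSet


/-! ## Weighted limits -/

section

variable {J : Type w} [Category.{v'} J] {M : Type u} [Category.{v} M]

/-- The functor `m ↦ Hom(m, Ψ -)`. -/
def homFunctor (Ψ : J ⥤ M) : M ⥤ (J ⥤ Type v)ᵒᵖ where
  obj m := op (Ψ ⋙ coyoneda.obj (op m))
  map f := (Functor.whiskerLeft Ψ (coyoneda.map f.op)).op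
  map_id m := Quiver.Hom.unop_inj (by
    ext j g
    exact Category.id_comp (X := m) g)
  map_comp f g := Quiver.Hom.unop_inj (by
    ext j h
    exact Category.assoc f g h)

variable [∀ S : J ⥤ Type v, HasLimitsOfShape S.Elements M] (Ψ : J ⥤ M)

/-- The limit of `Ψ` weighted by `S`. -/
noncomputable def wlimObj (S : (J ⥤ Type v)ᵒᵖ) : M :=
  limit (CategoryOfElements.π S.unop ⋙ Ψ)

/-- The universal property of weighted limits. -/
noncomputable def wlimEquiv (m : M) (S : (J ⥤ Type v)ᵒᵖ) :
    ((homFunctor Ψ).obj m ⟶ S) ≃ (m ⟶ wlimObj Ψ S) where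
  toFun g := limit.lift (CategoryOfElements.π S.unop ⋙ Ψ)
    { pt := m
      π :=
        { app := fun x => g.unop.app x.1 x.2
          naturality := fun x y φ => by
            have := ConcreteCategory.congr_hom (g.unop.naturality φ.1) x.2
            refine (Category.id_comp _).trans (Eq.trans ?_ this)
            exact congr_arg (g.unop.app y.1) φ.2.symm } }
  invFun h := Quiver.Hom.op
    { app := fun j => ↾fun x => h ≫ limit.π (CategoryOfElements.π S.unop ⋙ Ψ) ⟨j, x⟩
      naturality := fun j j' φ => by
        ext x
        let φ' : S.unop.elementsMk j x ⟶ S.unop.elementsMk j' (S.unop.map φ x) := ⟨φ, rfl⟩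
        have := limit.w (CategoryOfElements.π S.unop ⋙ Ψ) φ'
        refine (congr_arg (fun z => h ≫ z) this.symm).trans (Category.assoc _ _ _).symm }
  left_inv g := Quiver.Hom.unop_inj (by
    ext j x
    exact limit.lift_π _ _)
  right_inv h := by
    apply limit.hom_ext
    rintro ⟨j, x⟩
    exact limit.lift_π _ _

lemma wlimEquiv_π {m : M} {S : (J ⥤ Type v)ᵒᵖ} (g : (homFunctor Ψ).obj m ⟶ S) {j : J}
    (x : S.unop.obj j) :
    wlimEquiv Ψ m S g ≫ limit.π (CategoryOfElements.π S.unop ⋙ Ψ) (S.unop.elementsMk j x) =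
      g.unop.app j x :=
  limit.lift_π _ _

lemma wlimEquiv_naturality (m m' : M) (S : (J ⥤ Type v)ᵒᵖ) (f : m ⟶ m')
    (g : (homFunctor Ψ).obj m' ⟶ S) :
    wlimEquiv Ψ m S ((homFunctor Ψ).map f ≫ g) = f ≫ wlimEquiv Ψ m' S g := by
  apply limit.hom_ext
  rintro ⟨j, x⟩
  refine (wlimEquiv_π Ψ _ x).trans ?_
  refine Eq.trans ?_ (Category.assoc _ _ _).symm
  exact congr_arg (fun z => f ≫ z) (wlimEquiv_π Ψ g x).symm

/-- The weighted limit functor. -/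
noncomputable def wlim : (J ⥤ Type v)ᵒᵖ ⥤ M :=
  Adjunction.rightAdjointOfEquiv (wlimEquiv Ψ) (wlimEquiv_naturality Ψ)

/-- The weighted limit functor is right adjoint to `homFunctor`. -/
noncomputable def wlimAdj : homFunctor Ψ ⊣ wlim Ψ :=
  Adjunction.adjunctionOfEquivRight (wlimEquiv Ψ) (wlimEquiv_naturality Ψ)

lemma hasLiftingProperty_wlim_iff {K L : J ⥤ Type v} (i : K ⟶ L) {m m' : M} (f : m ⟶ m') :
    HasLiftingProperty f ((wlim Ψ).map i.op) ↔
      HasLiftingProperty i (Functor.whiskerLeft Ψ (coyoneda.map f.op)) := by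
  rw [← (wlimAdj Ψ).hasLiftingProperty_iff]
  exact HasLiftingProperty.iff_op.symm

end

/-! ### Reedy fibrancy, Kan fibrations and weak equivalences. -/

section

variable {M : Type u} [Category.{v} M] (Φ : SimplicialObject M)

lemma hasLiftingProperty_stdSimplex_map_iff {k n : SimplexCategory} (θ : k ⟶ n) {m m' : M}
    (f : m ⟶ m') :
    HasLiftingProperty (SSet.stdSimplex.{v}.map θ) (mapSSetMap Φ f) ↔
      HasLiftingProperty f (Φ.map θ.op) := by
  constructor
  · intro h
    refine ⟨fun {s t} sq => ?_⟩
    have sq' : CommSq ((SSet.yonedaEquiv (X := mapSSet Φ m')).symm t) (SSet.stdSimplex.map θ)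
        (mapSSetMap Φ f) ((SSet.yonedaEquiv (X := mapSSet Φ m)).symm s) := ⟨by
      refine (SSet.yonedaEquiv_symm_comp _ _).trans ?_
      refine Eq.trans ?_ (SSet.yonedaEquiv_symm_naturality_left _ _).symm
      exact congr_arg SSet.yonedaEquiv.symm sq.w.symm⟩
    refine ⟨⟨⟨SSet.yonedaEquiv sq'.lift, ?_, ?_⟩⟩⟩
    · exact (congr_arg SSet.yonedaEquiv sq'.fac_right).trans (Equiv.apply_symm_apply _ _)
    · refine (SSet.yonedaEquiv_naturality θ sq'.lift).trans ?_
      exact (congr_arg SSet.yonedaEquiv sq'.fac_left).trans (Equiv.apply_symm_apply _ _)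
  · intro h
    refine ⟨fun {s t} sq => ?_⟩
    let t' : m ⟶ Φ.obj (op n) := SSet.yonedaEquiv t
    let s' : m' ⟶ Φ.obj (op k) := SSet.yonedaEquiv s
    have sq' : CommSq t' f (Φ.map θ.op) s' := ⟨by
      refine (SSet.yonedaEquiv_naturality θ t).trans ?_
      exact congr_arg SSet.yonedaEquiv sq.w.symm⟩
    refine ⟨⟨⟨(SSet.yonedaEquiv (X := mapSSet Φ m')).symm sq'.lift, ?_, ?_⟩⟩⟩
    · refine (SSet.yonedaEquiv_symm_naturality_left _ _).trans ?_
      exact (congr_arg SSet.yonedaEquiv.symm sq'.fac_right).trans (Equiv.symm_apply_apply _ _)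
    · refine (SSet.yonedaEquiv_symm_comp _ _).trans ?_
      exact (congr_arg SSet.yonedaEquiv.symm sq'.fac_left).trans (Equiv.symm_apply_apply _ _)

variable [ModelCategory M] [HasLimits M]

variable {Φ} in
-- It suffices to lift against boundary inclusions, where the problem transposes to lifting `f`
-- against a matching map.
lemma IsReedyFibrant.rlp_monomorphisms (hΦ : IsReedyFibrant Φ) {m m' : M} (f : m ⟶ m')
    (hf : trivialCofibrations M f) :
    (MorphismProperty.monomorphisms SSet.{v}).rlp (mapSSetMap Φ f) := by
  rw [SSet.rlp_monomorphisms]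
  rintro _ _ _ ⟨n⟩
  rw [← hasLiftingProperty_matchingMap_iff]
  have : Fibration (matchingMap Φ n) := hΦ n
  obtain ⟨_, _⟩ := (mem_trivialCofibrations_iff _).1 hf
  infer_instance

lemma isReedyFibrant_of_rlp_monomorphisms (h : ∀ {m m' : M} (f : m ⟶ m'), trivialCofibrations M f →
      (MorphismProperty.monomorphisms SSet.{v}).rlp (mapSSetMap Φ f)) : IsReedyFibrant Φ := by
  intro n
  have key : (trivialCofibrations M).rlp (matchingMap Φ n) := fun m m' f hf =>
    (hasLiftingProperty_matchingMap_iff Φ n f).2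
      (h f hf _ (MorphismProperty.monomorphisms.infer_property _))
  rw [trivialCofibrations_rlp] at key
  exact (fibration_iff _).2 key

/-- The class of maps of simplicial sets with the left lifting property with respect to
`Map(f, Φ)` for all cofibrations `f`. -/
def mapLLP : MorphismProperty SSet.{v} :=
  (MorphismProperty.ofHoms (fun f : { a : Arrow M // Cofibration a.hom } =>
    mapSSetMap Φ f.1.hom)).llp

omit [HasLimits M] in
lemma mapLLP_iff {K L : SSet.{v}} (i : K ⟶ L) :
    mapLLP Φ i ↔ ∀ {m m' : M} (f : m ⟶ m') [Cofibration f],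
      HasLiftingProperty i (mapSSetMap Φ f) := by
  constructor
  · intro h m m' f hf
    exact h _ (.mk (⟨Arrow.mk f, hf⟩ : { a : Arrow M // Cofibration a.hom }))
  · rintro h _ _ _ ⟨f, hf⟩
    exact h f.hom

instance (S : SimplexCategoryᵒᵖ ⥤ Type v) : HasLimitsOfShape S.Elements M :=
  have : HasLimitsOfSize.{0, v} M := hasLimitsOfSizeShrink.{0, v, v, v} M
  inferInstance

lemma mapLLP_iff_trivialFibrations {K L : SSet.{v}} (i : K ⟶ L) :
    mapLLP Φ i ↔ trivialFibrations M ((wlim (J := SimplexCategoryᵒᵖ) Φ).map (Quiver.Hom.op i)) := by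
  rw [mapLLP_iff, ← cofibrations_rlp]
  constructor
  · intro h m m' f hf
    have : Cofibration f := (cofibration_iff _).2 hf
    exact (hasLiftingProperty_wlim_iff (J := SimplexCategoryᵒᵖ) Φ i f).2 (h f)
  · intro h m m' f hf
    exact (hasLiftingProperty_wlim_iff (J := SimplexCategoryᵒᵖ) Φ i f).1
      (h f ((cofibration_iff _).1 hf))

variable {Φ} in
-- Membership in `mapLLP` means being sent by the weighted limit functor to a trivial fibration. A
-- monomorphism goes to a fibration by Reedy fibrancy, so cancellation is two-out-of-three.
lemma IsReedyFibrant.isLeftCancellable (hΦ : IsReedyFibrant Φ) :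
    SSet.IsLeftCancellable (mapLLP Φ) where
  isMultiplicative := by unfold mapLLP; infer_instance
  respectsIso := by unfold mapLLP; infer_instance
  isStableUnderCobaseChange := by unfold mapLLP; infer_instance
  cancel {A B C} i j _ hi hij := by
    let R := wlim (J := SimplexCategoryᵒᵖ) Φ
    rw [mapLLP_iff_trivialFibrations] at hi hij ⊢
    have e : R.map (i ≫ j).op = R.map j.op ≫ R.map i.op := R.map_comp _ _
    have hj : Fibration (R.map j.op) := by
      rw [fibration_iff, ← trivialCofibrations_rlp]
      intro m m' f hf
      exact (hasLiftingProperty_wlim_iff (J := SimplexCategoryᵒᵖ) Φ j f).2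
        (hΦ.rlp_monomorphisms f hf j (MorphismProperty.monomorphisms.infer_property _))
    obtain ⟨_, _⟩ := (mem_trivialFibrations_iff _).1 hi
    obtain ⟨_, _⟩ := (mem_trivialFibrations_iff _).1 hij
    have : WeakEquivalence (R.map j.op) := weakEquivalence_of_postcomp_of_fac e.symm
    exact mem_trivialFibrations _

variable {Φ} in
-- A split monomorphism induces a monomorphism of standard simplices, to which `rlp_monomorphisms`
-- applies.
lemma IsReedyFibrant.fibration_map (hΦ : IsReedyFibrant Φ) {k n : SimplexCategory} (θ : k ⟶ n)
    [IsSplitMono θ] : Fibration (Φ.map θ.op) := by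
  rw [fibration_iff, ← trivialCofibrations_rlp]
  intro m m' f hf
  rw [← hasLiftingProperty_stdSimplex_map_iff]
  let F : SimplexCategory ⥤ SSet.{v} := SSet.stdSimplex
  have : Mono (SSet.stdSimplex.{v}.map θ) := inferInstanceAs (Mono (F.map θ))
  exact hΦ.rlp_monomorphisms f hf _ (MorphismProperty.monomorphisms.infer_property _)

omit [HasLimits M] in
lemma mapLLP_vertex_iff {n : ℕ} (y : (Δ[n] : SSet.{v}) _⦋0⦌) :
    mapLLP Φ (SSet.yonedaEquiv.symm y) ↔
      trivialFibrations M (Φ.map (SSet.stdSimplex.objEquiv y).op) := by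
  have e : SSet.yonedaEquiv.symm y = SSet.stdSimplex.map (SSet.stdSimplex.objEquiv y) :=
    SSet.yonedaEquiv.injective (by
      rw [SSet.yonedaEquiv_map, Equiv.apply_symm_apply, Equiv.symm_apply_apply])
  rw [e, mapLLP_iff, ← cofibrations_rlp]
  constructor
  · intro h m m' f hf
    have : Cofibration f := (cofibration_iff _).2 hf
    exact (hasLiftingProperty_stdSimplex_map_iff Φ _ f).1 (h f)
  · intro h m m' f hf
    exact (hasLiftingProperty_stdSimplex_map_iff Φ _ f).2 (h f ((cofibration_iff _).1 hf))

variable {Φ} in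
/-- If `Φ` is Reedy fibrant with weak equivalences as structure maps, then the
`Map(f, Φ)` are Kan fibrations for all cofibrations `f`. -/
lemma IsReedyFibrant.fibration_mapSSetMap (hΦ : IsReedyFibrant Φ)
    (h : ∀ {k n : SimplexCategoryᵒᵖ} (θ : k ⟶ n), WeakEquivalence (Φ.map θ)) {m m' : M}
    (f : m ⟶ m') [Cofibration f] : Fibration (mapSSetMap Φ f) := by
  rw [SSet.modelCategoryQuillen.fibration_iff]
  intro _ _ i hi
  simp only [SSet.modelCategoryQuillen.J, MorphismProperty.iSup_iff] at hi
  obtain ⟨n, ⟨k⟩⟩ := hi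
  refine (mapLLP_iff Φ _).1 (SSet.horn_ι_mem_of_vertex hΦ.isLeftCancellable (fun m y => ?_) k) f
  rw [mapLLP_vertex_iff]
  -- Every vertex is split by the map to `⦋0⦌`, so the induced map to degree `0` is a fibration; by
  -- assumption it is a weak equivalence too.
  have : IsSplitMono (SSet.stdSimplex.objEquiv y) := IsSplitMono.mk'
    { retraction := SimplexCategory.const _ _ 0
      id := Subsingleton.elim (α := (⦋0⦌ : SimplexCategory) ⟶ ⦋0⦌) _ _ }
  have := hΦ.fibration_map (SSet.stdSimplex.objEquiv y)
  have := h (SSet.stdSimplex.objEquiv y).op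
  exact mem_trivialFibrations _

variable {Φ} in
/-- If `Φ` is Reedy fibrant and the `Map(f, Φ)` are Kan fibrations for all cofibrations `f`,
then the degeneracies from degree zero are weak equivalences. -/
lemma IsReedyFibrant.weakEquivalence_map (hΦ : IsReedyFibrant Φ)
    (h : ∀ {m m' : M} (f : m ⟶ m') [Cofibration f], Fibration (mapSSetMap Φ f))
    {n : SimplexCategory} (θ : n ⟶ ⦋0⦌) : WeakEquivalence (Φ.map θ.op) := by
  induction n using SimplexCategory.rec with | _ n
  have hv := SSet.vertex_mem_of_horn hΦ.isLeftCancellable (fun n k => by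
    rw [mapLLP_iff]
    intro m m' f hf
    have := h f
    infer_instance) n (SSet.stdSimplex.obj₀Equiv.symm 0)
  rw [mapLLP_vertex_iff] at hv
  obtain ⟨_, _⟩ := (mem_trivialFibrations_iff _).1 hv
  -- The degeneracy is a section of the trivial fibration given by the vertex `0`.
  have e : Φ.map θ.op ≫ Φ.map (SSet.stdSimplex.objEquiv
      (SSet.stdSimplex.obj₀Equiv.{v}.symm (0 : Fin (n + 1)))).op = 𝟙 _ := by
    rw [← Φ.map_comp, ← op_comp, ← Φ.map_id]
    congr 1
    exact Quiver.Hom.unop_inj (Subsingleton.elim (α := (⦋0⦌ : SimplexCategory) ⟶ ⦋0⦌) _ _)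
  exact weakEquivalence_of_postcomp_of_fac e

end


/-! ## Trivial fibrations of simplicial sets -/

namespace SSet

/-- For the converse, the anodyne part of a factorization lifts against the fibration `f`, so `f` is
a retract of the part with the lifting property. -/
lemma rlp_monomorphisms_iff {X Y : SSet.{v}} (f : X ⟶ Y) :
    (MorphismProperty.monomorphisms SSet.{v}).rlp f ↔ Fibration f ∧ WeakEquivalence f := by
  constructor
  · intro h
    refine ⟨?_, ?_⟩
    · rw [SSet.modelCategoryQuillen.fibration_iff]
      exact MorphismProperty.antitone_rlp SSet.modelCategoryQuillen.J_le_monomorphisms _ h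
    · rw [weakEquivalence_iff]
      exact ⟨{ Z := X, i := 𝟙 X, p := f, fac := Category.id_comp f
               hi := anodyneExtensions.of_isIso _, hp := h }⟩
  · rintro ⟨h1, h2⟩
    rw [weakEquivalence_iff] at h2
    obtain ⟨d⟩ := h2
    have h1' : fibrations SSet.{v} f := (HomotopicalAlgebra.fibration_iff f).1 h1
    have : HasLiftingProperty d.i f := d.hi _ h1'
    have r : RetractArrow f d.p := RetractArrow.ofRightLiftingProperty d.fac
    exact MorphismProperty.of_retract r d.hp

end SSet

namespace VCat

variable {C : Type v} [SmallCategory C]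

lemma cofibrations_iff {A B : VCat C} (g : A ⟶ B) :
    cofibrations (VCat C) g ↔ ∀ X, Fibration (g.unop.app X) := Iff.rfl

lemma trivialCofibrations_iff {A B : VCat C} (g : A ⟶ B) :
    trivialCofibrations (VCat C) g ↔
      ∀ X, (MorphismProperty.monomorphisms SSet.{v}).rlp (g.unop.app X) := by
  simp only [SSet.rlp_monomorphisms_iff, forall_and]
  exact Iff.rfl

/-! ## The corepresentable diagrams -/

/-- The diagram `Z ↦ C(X, Z) × Δ[n]`. -/
abbrev J (X : C) (n : SimplexCategory) : C ⥤ SSet.{v} :=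
  (discreteCoyoneda C).obj (op X) ⊗ (constSimplex C).obj n

/-- The simplices of `J X n`. -/
def Jmk {X Y : C} {n k : SimplexCategory} (g : X ⟶ Y) (θ : k ⟶ n) : ((J X n).obj Y).obj (op k) :=
  (g, SSet.stdSimplex.objEquiv.symm θ)

lemma Jmk_surjective {X Y : C} {n k : SimplexCategory} (x : ((J X n).obj Y).obj (op k)) :
    ∃ (g : X ⟶ Y) (θ : k ⟶ n), x = Jmk g θ :=
  ⟨x.1, SSet.stdSimplex.objEquiv x.2, rfl⟩

lemma map_Jmk {X Y : C} {n k l : SimplexCategory} (g : X ⟶ Y) (θ : k ⟶ n) (φ : l ⟶ k) :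
    ((J X n).obj Y).map φ.op (Jmk g θ) = Jmk g (φ ≫ θ) := rfl

lemma map_app_Jmk {X Y Z : C} {n k : SimplexCategory} (g : X ⟶ Y) (θ : k ⟶ n) (h : Y ⟶ Z) :
    ((J X n).map h).app (op k) (Jmk g θ) = Jmk (g ≫ h) θ := rfl

/-- The map from `J X n` that corresponds to a simplex by the Yoneda lemma. -/
def hat {S : C ⥤ SSet.{v}} {X : C} {n : SimplexCategory} (s : (S.obj X).obj (op n)) :
    J X n ⟶ S where
  app Y :=
    { app := fun k => ↾fun x => (S.map (show X ⟶ Y from x.1)).app k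
        ((S.obj X).map (SSet.stdSimplex.objEquiv x.2).op s)
      naturality := fun k l φ => by
        ext ⟨g, x⟩
        have := ConcreteCategory.congr_hom ((S.map (show X ⟶ Y from g)).naturality φ)
          ((S.obj X).map (SSet.stdSimplex.objEquiv x).op s)
        refine Eq.trans ?_ this
        refine congr_arg ((S.map (show X ⟶ Y from g)).app l) ?_
        exact ConcreteCategory.congr_hom
          ((S.obj X).map_comp (SSet.stdSimplex.objEquiv x).op φ) s }
  naturality Y Z h := by
    ext k ⟨g, x⟩
    have := S.map_comp (show X ⟶ Y from g) h
    exact ConcreteCategory.congr_hom (NatTrans.congr_app this k) _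

variable {S : C ⥤ SSet.{v}} {X : C} {n : SimplexCategory}

lemma hat_app_Jmk (s : (S.obj X).obj (op n)) {Y : C} {k : SimplexCategory} (g : X ⟶ Y) (θ : k ⟶ n) :
    ((hat s).app Y).app (op k) (Jmk g θ) = (S.map g).app (op k) ((S.obj X).map θ.op s) := rfl

lemma hat_app_id (s : (S.obj X).obj (op n)) :
    ((hat s).app X).app (op n) (Jmk (𝟙 X) (𝟙 n)) = s := by
  rw [hat_app_Jmk, S.map_id, op_id, (S.obj X).map_id]
  rfl

/-- Uniqueness in the Yoneda lemma: the simplex `(𝟙 X, 𝟙 n)` generates `J X n`. -/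
lemma J_hom_ext {f g : J X n ⟶ S}
    (h : (f.app X).app (op n) (Jmk (𝟙 X) (𝟙 n)) = (g.app X).app (op n) (Jmk (𝟙 X) (𝟙 n))) :
    f = g := by
  have key (f : J X n ⟶ S) {Y : C} {k : SimplexCategory} (a : X ⟶ Y) (θ : k ⟶ n) :
      (f.app Y).app (op k) (Jmk a θ) =
        (S.map a).app (op k) ((S.obj X).map θ.op ((f.app X).app (op n) (Jmk (𝟙 X) (𝟙 n)))) := by
    have h1 := ConcreteCategory.congr_hom ((f.app X).naturality θ.op) (Jmk (𝟙 X) (𝟙 n))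
    have h2 := ConcreteCategory.congr_hom (NatTrans.congr_app (f.naturality a) (op k))
      (((J X n).obj X).map θ.op (Jmk (𝟙 X) (𝟙 n)))
    have h3 : ((J X n).map a).app (op k) (((J X n).obj X).map θ.op (Jmk (𝟙 X) (𝟙 n))) =
        Jmk a θ := by
      rw [map_Jmk, map_app_Jmk, Category.id_comp, Category.comp_id]
    rw [← h3]
    exact h2.trans (congr_arg ((S.map a).app (op k)) h1)
  ext Y k x
  obtain ⟨a, θ, rfl⟩ := Jmk_surjective (k := k.unop) x
  exact (key f a θ).trans ((congr_arg _ (congr_arg _ h)).trans (key g a θ).symm)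

lemma hat_eta (f : J X n ⟶ S) : hat ((f.app X).app (op n) (Jmk (𝟙 X) (𝟙 n))) = f :=
  J_hom_ext (hat_app_id _)

lemma hat_comp (s : (S.obj X).obj (op n)) {T : C ⥤ SSet.{v}} (f : S ⟶ T) :
    hat s ≫ f = hat ((f.app X).app (op n) s) := by
  apply J_hom_ext
  rw [hat_app_id]
  exact congr_arg ((f.app X).app (op n)) (hat_app_id s)

/-- The functoriality of `J` in the simplicial direction. -/
lemma whiskerLeft_hat {k : SimplexCategory} (θ : k ⟶ n) (s : (S.obj X).obj (op n)) :
    (discreteCoyoneda C).obj (op X) ◁ (constSimplex C).map θ ≫ hat s =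
      hat ((S.obj X).map θ.op s) := by
  apply J_hom_ext
  rw [hat_app_id]
  have e : (((discreteCoyoneda C).obj (op X) ◁ (constSimplex C).map θ).app X).app (op k)
    (Jmk (𝟙 X) (𝟙 k)) = Jmk (𝟙 X) θ := by
      refine Prod.ext rfl ?_
      exact congr_arg SSet.stdSimplex.objEquiv.symm (Category.id_comp θ)
  refine (congr_arg (((hat s).app X).app (op k)) e).trans ?_
  rw [hat_app_Jmk, S.map_id]
  rfl

/-- The functoriality of `J` in the first variable. -/
lemma whiskerRight_hat {Y : C} (g : X ⟶ Y) (s : (S.obj X).obj (op n)) :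
    (discreteCoyoneda C).map g.op ▷ (constSimplex C).obj n ≫ hat s =
      hat ((S.map g).app (op n) s) := by
  apply J_hom_ext
  rw [hat_app_id]
  have e : (((discreteCoyoneda C).map g.op ▷ (constSimplex C).obj n).app Y).app (op n)
    (Jmk (𝟙 Y) (𝟙 n)) = Jmk g (𝟙 n) := by
      refine Prod.ext ?_ rfl
      exact Category.comp_id g
  refine (congr_arg (((hat s).app Y).app (op n)) e).trans ?_
  rw [hat_app_Jmk, op_id, (S.obj X).map_id]
  rfl

lemma hat_Jmk {Y : C} {k : SimplexCategory} (g : X ⟶ Y) (θ : k ⟶ n) :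
    hat (Jmk g θ) = (discreteCoyoneda C).map g.op ▷ (constSimplex C).obj k ≫
      (discreteCoyoneda C).obj (op X) ◁ (constSimplex C).map θ := by
  have h := hat_eta ((discreteCoyoneda C).obj (op X) ◁ (constSimplex C).map θ)
  rw [← h, whiskerRight_hat]
  congr 1
  refine Prod.ext ?_ ?_
  · exact (Category.id_comp g).symm
  · exact congr_arg SSet.stdSimplex.objEquiv.symm (Category.id_comp θ).symm

end VCat


/-! ## Mapping diagrams -/

section

variable {C : Type v} [SmallCategory C] {M : Type u} [Category.{v} M]

/-- The diagram of mapping simplicial sets `X ↦ Map(m, Φ X)`. -/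
@[simps]
def mapDiagram (Φ : C ⥤ SimplicialObject M) (m : M) : C ⥤ SSet.{v} where
  obj X := mapSSet (Φ.obj X) m
  map {X Y} g :=
    { app := fun n => ↾fun h => (show m ⟶ (Φ.obj X).obj n from h) ≫ (Φ.map g).app n
      naturality := fun n k φ => by
        ext h
        have := (Φ.map g).naturality φ
        exact (Category.assoc _ _ _).trans ((congr_arg (fun z => (show m ⟶ _ from h) ≫ z) this).trans
          (Category.assoc _ _ _).symm) }
  map_id X := by
    ext n h
    have := NatTrans.congr_app (Φ.map_id X) n
    exact (congr_arg (fun z => (show m ⟶ _ from h) ≫ z) this).trans (Category.comp_id _)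
  map_comp f g := by
    ext n h
    have := NatTrans.congr_app (Φ.map_comp f g) n
    exact (congr_arg (fun z => (show m ⟶ _ from h) ≫ z) this).trans (Category.assoc _ _ _).symm

/-- The functor `m ↦ Map(m, Φ -)`. -/
@[simps]
def mapDiagramFunctor (Φ : C ⥤ SimplicialObject M) : M ⥤ VCat C where
  obj m := op (mapDiagram Φ m)
  map f := Quiver.Hom.op
    { app := fun X => mapSSetMap (Φ.obj X) f
      naturality := fun X Y g => by
        ext n h
        exact (Category.assoc _ _ _).symm }
  map_id m := Quiver.Hom.unop_inj (by
    ext X n g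
    exact Category.id_comp (X := m) g)
  map_comp f g := Quiver.Hom.unop_inj (by
    ext X n h
    exact Category.assoc f g h)

/-- A diagram of simplicial objects as a functor in two variables. -/
abbrev uncurryS {M' : Type u'} [Category.{v'} M'] (Φ : C ⥤ SimplicialObject M') :
    C × SimplexCategoryᵒᵖ ⥤ M' :=
  Functor.uncurry.obj (show C ⥤ SimplexCategoryᵒᵖ ⥤ M' from Φ)

/-- Natural transformations to a mapping diagram in terms of functors in two variables. -/
def uncurryEquiv (Φ : C ⥤ SimplicialObject M) (m : M) (S : VCat C) :
    ((mapDiagramFunctor Φ).obj m ⟶ S) ≃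
      ((homFunctor (uncurryS Φ)).obj m ⟶
        op (uncurryS (M' := Type v) S.unop)) where
  toFun g := Quiver.Hom.op
    { app := fun p => ↾fun s => (g.unop.app p.1).app p.2 s
      naturality := fun p q φ => by
        ext s
        have h1 := ConcreteCategory.congr_hom (NatTrans.congr_app (g.unop.naturality φ.1) p.2) s
        have h2 := ConcreteCategory.congr_hom ((g.unop.app q.1).naturality φ.2)
          ((S.unop.map φ.1).app p.2 s)
        refine h2.trans ?_
        refine (congr_arg (((mapDiagram Φ m).obj q.1).map φ.2) h1).trans ?_
        exact Category.assoc _ _ _ }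
  invFun g := Quiver.Hom.op
    { app := fun X =>
        { app := fun n => ↾fun s => g.unop.app (X, n) s
          naturality := fun n k φ => by
            ext s
            have h := ConcreteCategory.congr_hom
              (g.unop.naturality ((𝟙 X, φ) : (X, n) ⟶ (X, k))) s
            have h1 : ((uncurryS (M' := Type v) S.unop).map
                ((𝟙 X, φ) : (X, n) ⟶ (X, k))) s = (S.unop.obj X).map φ s := by
              refine congr_arg ((S.unop.obj X).map φ) ?_
              exact ConcreteCategory.congr_hom (NatTrans.congr_app (S.unop.map_id X) n) s
            have h2 : (uncurryS Φ).map
                ((𝟙 X, φ) : (X, n) ⟶ (X, k)) = (Φ.obj X).map φ := by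
              refine Eq.trans ?_ (Category.id_comp _)
              exact congr_arg (· ≫ (Φ.obj X).map φ) (NatTrans.congr_app (Φ.map_id X) n)
            refine (congr_arg (g.unop.app (X, k)) h1.symm).trans (h.trans ?_)
            exact congr_arg (fun z => (show m ⟶ _ from g.unop.app (X, n) s) ≫ z) h2 }
      naturality := fun X Y f => by
        ext n s
        have h := ConcreteCategory.congr_hom
          (g.unop.naturality ((f, 𝟙 n) : (X, n) ⟶ (Y, n))) s
        have h1 : ((uncurryS (M' := Type v) S.unop).map
            ((f, 𝟙 n) : (X, n) ⟶ (Y, n))) s = (S.unop.map f).app n s :=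
          ConcreteCategory.congr_hom ((S.unop.obj Y).map_id n) _
        have h2 : (uncurryS Φ).map
            ((f, 𝟙 n) : (X, n) ⟶ (Y, n)) = (Φ.map f).app n := by
          refine Eq.trans ?_ (Category.comp_id _)
          exact congr_arg ((Φ.map f).app n ≫ ·) ((Φ.obj Y).map_id n)
        refine (congr_arg (g.unop.app (Y, n)) h1.symm).trans (h.trans ?_)
        exact congr_arg (fun z => (show m ⟶ _ from g.unop.app (X, n) s) ≫ z) h2 }
  left_inv _ := rfl
  right_inv _ := rfl

variable [HasLimits M] (Φ : C ⥤ SimplicialObject M)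

/-- The right adjoint to `m ↦ Map(m, Φ -)`, on objects. -/
noncomputable def resObj (S : VCat C) : M :=
  wlimObj (uncurryS Φ)
    (op (uncurryS (M' := Type v) S.unop))

/-- The adjunction bijection. -/
noncomputable def resEquiv (m : M) (S : VCat C) :
    ((mapDiagramFunctor Φ).obj m ⟶ S) ≃ (m ⟶ resObj Φ S) :=
  (uncurryEquiv Φ m S).trans (wlimEquiv _ m _)

lemma resEquiv_naturality (m m' : M) (S : VCat C) (f : m ⟶ m')
    (g : (mapDiagramFunctor Φ).obj m' ⟶ S) :
    resEquiv Φ m S ((mapDiagramFunctor Φ).map f ≫ g) = f ≫ resEquiv Φ m' S g :=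
  wlimEquiv_naturality _ m m' _ f (uncurryEquiv Φ m' S g)

/-- The right adjoint to `m ↦ Map(m, Φ -)`. -/
noncomputable def resR : VCat C ⥤ M :=
  Adjunction.rightAdjointOfEquiv (resEquiv Φ) (resEquiv_naturality Φ)

/-- The adjunction attached to `Φ`. -/
noncomputable def resAdj : mapDiagramFunctor Φ ⊣ resR Φ :=
  Adjunction.adjunctionOfEquivRight (resEquiv Φ) (resEquiv_naturality Φ)

end


/-! ## Right adjoint functors on diagrams of simplicial sets -/

section

open VCat

variable {C : Type v} [SmallCategory C] {M : Type u} [Category.{v} M]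

/-- The diagram of simplicial objects `X ↦ ([n] ↦ R(rX ⊗ Δ[n]))`. -/
abbrev restrJ (R : VCat C ⥤ M) : C ⥤ SimplicialObject M :=
  VCat.tensorSimplex C ⋙ (SimplicialObject.whiskering _ _).obj R

variable {L : M ⥤ VCat C} {R : VCat C ⥤ M} (adj : L ⊣ R)

lemma homEquiv_hat_map {m : M} {X Y : C} {n k : SimplexCategory}
    (y : ((L.obj m).unop.obj X).obj (op n)) (j : J Y k ⟶ J X n)
    (y' : ((L.obj m).unop.obj Y).obj (op k)) (h : j ≫ hat y = hat y') :
    adj.homEquiv m _ (hat y').op = adj.homEquiv m _ (hat y).op ≫ R.map j.op := by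
  rw [← h, op_comp]
  exact adj.homEquiv_naturality_right _ _

/-- A right adjoint functor `R` is determined by its restriction to the diagrams `J X n`:
the left adjoint is the functor `m ↦ Map(m, R(J X n))`. -/
def rhoHom (m : M) : (L.obj m).unop ⟶ mapDiagram (restrJ R) m where
  app X :=
    { app := fun n => ↾fun y => adj.homEquiv m (op (J X n.unop)) (hat y).op
      naturality := fun n k φ => by
        ext y
        exact homEquiv_hat_map adj y _ _ (whiskerLeft_hat φ.unop y) }
  naturality X Y g := by
    ext n y
    exact homEquiv_hat_map adj y _ _ (whiskerRight_hat g y)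

/-- The simplex attached to a map to `R(J X n)`. -/
def simplexOf {m : M} {X : C} {n : SimplexCategory} (x : m ⟶ R.obj (op (J X n))) :
    ((L.obj m).unop.obj X).obj (op n) :=
  (((adj.homEquiv m _).symm x).unop.app X).app (op n) (Jmk (𝟙 X) (𝟙 n))

lemma hat_simplexOf {m : M} {X : C} {n : SimplexCategory} (x : m ⟶ R.obj (op (J X n))) :
    hat (simplexOf adj x) = ((adj.homEquiv m _).symm x).unop :=
  hat_eta _

lemma simplexOf_homEquiv_hat {m : M} {X : C} {n : SimplexCategory}
    (y : ((L.obj m).unop.obj X).obj (op n)) :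
    simplexOf adj (adj.homEquiv m _ (hat y).op) = y := by
  unfold simplexOf
  rw [Equiv.symm_apply_apply]
  exact hat_app_id y

lemma homEquiv_hat_simplexOf {m : M} {X : C} {n : SimplexCategory} (x : m ⟶ R.obj (op (J X n))) :
    adj.homEquiv m _ (hat (simplexOf adj x)).op = x := by
  rw [hat_simplexOf]
  exact Equiv.apply_symm_apply _ _

/-- The map `rhoHom` is an isomorphism. -/
def rhoIso (m : M) : (L.obj m).unop ≅ mapDiagram (restrJ R) m :=
  NatIso.ofComponents (fun X => NatIso.ofComponents (fun n => Equiv.toIso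
    { toFun := fun y => adj.homEquiv m (op (J X n.unop)) (hat y).op
      invFun := fun x => simplexOf adj x
      left_inv := fun y => simplexOf_homEquiv_hat adj y
      right_inv := fun x => homEquiv_hat_simplexOf adj x })
      (fun φ => ((rhoHom adj m).app X).naturality φ)) (fun g => (rhoHom adj m).naturality g)

/-- Maps to `R S` are natural families of maps to the `R(J X n)`,
indexed by the simplices of `S`. -/
def elemEquiv (m : M) (S : VCat C) : (m ⟶ R.obj S) ≃ (S.unop ⟶ mapDiagram (restrJ R) m) :=
  ((adj.homEquiv m S).symm.trans (opEquiv _ _)).trans ((rhoIso adj m).homToEquiv)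

lemma elemEquiv_apply {m : M} {S : VCat C} (g : m ⟶ R.obj S) {X : C} {n : SimplexCategory}
    (s : (S.unop.obj X).obj (op n)) :
    ((elemEquiv adj m S g).app X).app (op n) s = g ≫ R.map (hat s).op := by
  obtain ⟨a, rfl⟩ := (adj.homEquiv m S).surjective g
  have : elemEquiv adj m S (adj.homEquiv m S a) = a.unop ≫ rhoHom adj m := by
    have h := congr_arg (fun z : L.obj m ⟶ S => z.unop ≫ rhoHom adj m)
      (Equiv.symm_apply_apply (adj.homEquiv m S) a)
    exact h
  rw [this]
  rw [← adj.homEquiv_naturality_right]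
  refine congr_arg (adj.homEquiv m (op (J X n))) (Quiver.Hom.unop_inj ?_)
  exact (hat_comp s a.unop).symm

/-- With `exists_hom_of_hat`, this exhibits `R S` as the limit of the `R(J X n)` over the simplices
of `S`. -/
lemma hom_ext_of_hat (adj : L ⊣ R) {m : M} {S : VCat C} {g h : m ⟶ R.obj S}
    (H : ∀ (X : C) (n : SimplexCategory) (s : (S.unop.obj X).obj (op n)),
      g ≫ R.map (hat s).op = h ≫ R.map (hat s).op) : g = h := by
  apply (elemEquiv adj m S).injective
  ext X n s
  exact (elemEquiv_apply adj g s).trans ((H X n.unop s).trans (elemEquiv_apply adj h s).symm)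

lemma exists_hom_of_hat (adj : L ⊣ R) {m : M} {S : VCat C} (α : S.unop ⟶ mapDiagram (restrJ R) m) :
    ∃ g : m ⟶ R.obj S, ∀ (X : C) (n : SimplexCategory) (s : (S.unop.obj X).obj (op n)),
      g ≫ R.map (hat s).op = (α.app X).app (op n) s := by
  obtain ⟨g, rfl⟩ := (elemEquiv adj m S).surjective α
  exact ⟨g, fun X n s => (elemEquiv_apply adj g s).symm⟩

lemma rhoIso_hom_naturality {m m' : M} (f : m ⟶ m') (X : C) :
    (L.map f).unop.app X ≫ (rhoIso adj m).hom.app X =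
      (rhoIso adj m').hom.app X ≫ mapSSetMap ((restrJ R).obj X) f := by
  ext n y
  have := adj.homEquiv_naturality_left f (hat y).op
  refine Eq.trans ?_ this
  refine congr_arg (adj.homEquiv m (op (J X n.unop))) (Quiver.Hom.unop_inj ?_)
  exact (hat_comp y (L.map f).unop).symm

/-- Up to isomorphism `Map(f, -)` is `L f`, so the Quillen conditions on `L` become fibration
conditions on mapping spaces. -/
lemma mapSSetMap_restrJ {m m' : M} (f : m ⟶ m') (X : C) :
    mapSSetMap ((restrJ R).obj X) f =
      (rhoIso adj m').inv.app X ≫ (L.map f).unop.app X ≫ (rhoIso adj m).hom.app X := by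
  rw [rhoIso_hom_naturality]
  exact (Iso.inv_hom_id_assoc ((rhoIso adj m').app X) _).symm

section

variable {R' : VCat C ⥤ M} {L' : M ⥤ VCat C}

/-- A natural transformation between right adjoints is determined by its restriction. -/
lemma natTrans_ext (adj' : L' ⊣ R') {τ τ' : R ⟶ R'}
    (h : ∀ (X : C) (n : SimplexCategory), τ.app (op (J X n)) = τ'.app (op (J X n))) : τ = τ' := by
  ext S
  refine hom_ext_of_hat adj' (fun X n s => ?_)
  rw [← τ.naturality, ← τ'.naturality, h]

/-- A natural transformation between the restrictions of right adjoints extends. -/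
lemma exists_natTrans (adj' : L' ⊣ R') (σ : restrJ R ⟶ restrJ R') :
    ∃ τ : R ⟶ R', ∀ (X : C) (n : SimplexCategory),
      τ.app (op (J X n)) = (σ.app X).app (op n) := by
  have key (S : VCat C) : ∃ t : R.obj S ⟶ R'.obj S,
      ∀ (X : C) (n : SimplexCategory) (s : (S.unop.obj X).obj (op n)),
        t ≫ R'.map (hat s).op = R.map (hat s).op ≫ (σ.app X).app (op n) := by
    let α : S.unop ⟶ mapDiagram (restrJ R') (R.obj S) :=
      { app := fun X =>
          { app := fun n => ↾fun s => R.map (hat s).op ≫ (σ.app X).app n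
            naturality := fun n k φ => by
              ext s
              have h1 := whiskerLeft_hat φ.unop s
              have h2 := (σ.app X).naturality φ
              have h3 : R.map (hat ((S.unop.obj X).map φ s)).op =
                  R.map (hat s).op ≫ ((restrJ R).obj X).map φ := by
                refine Eq.trans ?_ (R.map_comp _ _)
                exact congr_arg (fun z => R.map (Quiver.Hom.op z)) h1.symm
              refine (congr_arg (· ≫ (σ.app X).app k) h3).trans ?_
              refine (Category.assoc _ _ _).trans ?_
              exact (congr_arg (R.map (hat s).op ≫ ·) h2).trans (Category.assoc _ _ _).symm }
        naturality := fun X Y g => by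
          ext n s
          have h1 := whiskerRight_hat g s
          have h2 := NatTrans.congr_app (σ.naturality g) n
          have h3 : R.map (hat ((S.unop.map g).app n s)).op =
              R.map (hat s).op ≫ ((restrJ R).map g).app n := by
            refine Eq.trans ?_ (R.map_comp _ _)
            exact congr_arg (fun z => R.map (Quiver.Hom.op z)) h1.symm
          refine (congr_arg (· ≫ (σ.app Y).app n) h3).trans ?_
          refine (Category.assoc _ _ _).trans ?_
          exact (congr_arg (R.map (hat s).op ≫ ·) h2).trans (Category.assoc _ _ _).symm }
    obtain ⟨g, hg⟩ := exists_hom_of_hat adj' α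
    exact ⟨g, hg⟩
  choose t ht using key
  refine ⟨{ app := t, naturality := fun S T f => ?_ }, fun X n => ?_⟩
  · refine hom_ext_of_hat adj' (fun X n s => ?_)
    rw [Category.assoc, Category.assoc, ht, ← R'.map_comp]
    have e : f ≫ (hat s).op = (hat ((f.unop.app X).app (op n) s)).op :=
      Quiver.Hom.unop_inj (hat_comp s f.unop)
    have h4 : R.map f ≫ R.map (hat s).op = R.map (hat ((f.unop.app X).app (op n) s)).op := by
      rw [← R.map_comp, e]
    rw [e]
    refine (Category.assoc _ _ _).symm.trans ?_
    exact (congr_arg (· ≫ (σ.app X).app (op n)) h4).trans (ht S X n _).symm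
  -- A simplex of `J X n` is a pair `(g, θ)`, so agreement with `σ` follows from its naturality in
  -- both variables.
  · refine hom_ext_of_hat adj' (fun Y k s => ?_)
    obtain ⟨g, θ, rfl⟩ := Jmk_surjective s
    refine (ht _ Y k _).trans ?_
    rw [hat_Jmk, op_comp, R.map_comp, R'.map_comp]
    have h1 := (σ.app X).naturality θ.op
    have h2 := NatTrans.congr_app (σ.naturality g) (op k)
    refine (Category.assoc _ _ _).trans ?_
    refine (congr_arg (R.map _ ≫ ·) h2).trans ?_
    refine (Category.assoc _ _ _).symm.trans ?_
    exact (congr_arg (· ≫ ((restrJ R').map g).app (op k)) h1).trans (Category.assoc _ _ _)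

end

end


/-! ## From co-factorizations to simplicial resolutions -/

namespace VCat

variable {C : Type v} [SmallCategory C]

/-- The projection `rX ⟶ rX ⊗ Δ[n]`. -/
abbrev toJ (X : C) (n : SimplexCategory) : (r C).obj X ⟶ op (J X n) :=
  ((toTensorSimplex C).app X).app (op n)

instance isIso_toJ_zero (X : C) : IsIso (toJ X ⦋0⦌) := by
  have : IsIso (fst ((discreteCoyoneda C).obj (op X)) ((constSimplex C).obj ⦋0⦌)) := by
    have (Y : C) : IsIso ((fst ((discreteCoyoneda C).obj (op X))
        ((constSimplex C).obj ⦋0⦌)).app Y) := by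
      have (k : SimplexCategoryᵒᵖ) : IsIso (((fst ((discreteCoyoneda C).obj (op X))
          ((constSimplex C).obj ⦋0⦌)).app Y).app k) := by
        rw [isIso_iff_bijective]
        constructor
        · rintro ⟨g, x⟩ ⟨g', x'⟩ h
          refine Prod.ext h ?_
          apply SSet.stdSimplex.objEquiv.injective
          exact Subsingleton.elim (α := k.unop ⟶ (⦋0⦌ : SimplexCategory)) _ _
        · intro g
          exact ⟨(g, SSet.stdSimplex.objEquiv.symm (SimplexCategory.const _ _ 0)), rfl⟩
      exact NatIso.isIso_of_isIso_app _
    exact NatIso.isIso_of_isIso_app _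
  exact inferInstanceAs (IsIso (fst ((discreteCoyoneda C).obj (op X))
    ((constSimplex C).obj ⦋0⦌)).op)

end VCat

lemma SSet.fibration_iso_comp {A B A' B' : SSet.{v}} (i : A' ⟶ A) (f : A ⟶ B) (j : B ⟶ B')
    (_ : IsIso i) (_ : IsIso j) (h : Fibration f) : Fibration (i ≫ f ≫ j) :=
  inferInstance

lemma SSet.rlp_iso_comp {A B A' B' : SSet.{v}} (i : A' ⟶ A) (f : A ⟶ B) (j : B ⟶ B')
    (_ : IsIso i) (_ : IsIso j) (h : (MorphismProperty.monomorphisms SSet.{v}).rlp f) :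
    (MorphismProperty.monomorphisms SSet.{v}).rlp (i ≫ f ≫ j) := by
  intro _ _ k hk
  have := h k hk
  infer_instance

namespace CoFact

open VCat

variable {C : Type v} [SmallCategory C] {M : Type u} [Category.{v} M] [ModelCategory M]
  {γ : C ⥤ M} (F : CoFact (VCat.r C) γ)

lemma fibration_mapSSetMap (X : C) {m m' : M} (f : m ⟶ m') [Cofibration f] :
    Fibration (mapSSetMap ((restrJ F.R).obj X) f) := by
  rw [mapSSetMap_restrJ F.adj]
  have h := (VCat.cofibrations_iff _).1
    (F.isQuillenPair.map_cofibrations f ((cofibration_iff _).1 inferInstance)) X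
  have h1 : IsIso ((rhoIso F.adj m').inv.app X) :=
    inferInstanceAs (IsIso ((rhoIso F.adj m').app X).inv)
  have h2 : IsIso ((rhoIso F.adj m).hom.app X) :=
    inferInstanceAs (IsIso ((rhoIso F.adj m).app X).hom)
  exact SSet.fibration_iso_comp _ _ _ h1 h2 h

lemma rlp_mapSSetMap (X : C) {m m' : M} (f : m ⟶ m') (hf : trivialCofibrations M f) :
    (MorphismProperty.monomorphisms SSet.{v}).rlp (mapSSetMap ((restrJ F.R).obj X) f) := by
  rw [mapSSetMap_restrJ F.adj]
  have h := (VCat.trivialCofibrations_iff _).1 (F.isQuillenPair.map_trivialCofibrations f hf) X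
  have h1 : IsIso ((rhoIso F.adj m').inv.app X) :=
    inferInstanceAs (IsIso ((rhoIso F.adj m').app X).inv)
  have h2 : IsIso ((rhoIso F.adj m).hom.app X) :=
    inferInstanceAs (IsIso ((rhoIso F.adj m).app X).hom)
  exact SSet.rlp_iso_comp _ _ _ h1 h2 h

variable [HasLimits M]

lemma isReedyFibrant (X : C) : IsReedyFibrant ((restrJ F.R).obj X) :=
  isReedyFibrant_of_rlp_monomorphisms _ (fun f hf => F.rlp_mapSSetMap X f hf)

/-- Since `rX ≅ rX ⊗ Δ[0]`, the map differs from `η` by an isomorphism and a degeneracy, which is a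
weak equivalence because `L` preserves cofibrations. -/
lemma weakEquivalence_toUnder (X : C) (n : SimplexCategory) :
    WeakEquivalence (F.η.app X ≫ F.R.map (toJ X n)) := by
  let θ : n ⟶ ⦋0⦌ := SimplexCategory.const _ _ 0
  let j : op (J X ⦋0⦌) ⟶ op (J X n) := ((tensorSimplex C).obj X).map θ.op
  have e : toJ X n = toJ X ⦋0⦌ ≫ j :=
    (Category.id_comp _).symm.trans (((toTensorSimplex C).app X).naturality θ.op)
  have h : WeakEquivalence (F.R.map j) :=
    (F.isReedyFibrant X).weakEquivalence_map (fun f _ => F.fibration_mapSSetMap X f) θ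
  have := F.weakEquivalence_η X
  rw [e, F.R.map_comp]
  infer_instance

variable (γ) in
/-- The functor from co-factorizations to simplicial resolutions. -/
def toSRes : CoFact (VCat.r C) γ ⥤ SRes γ :=
  ObjectProperty.lift _ (toUnder γ)
    (fun F => ⟨fun X => F.isReedyFibrant X, fun X n => F.weakEquivalence_toUnder X n.unop⟩)

instance : (toSRes γ).Faithful where
  map_injective {F G} f g h := by
    apply CoFact.Hom.ext
    refine natTrans_ext G.adj (fun X n => ?_)
    have h' : (toUnder γ).map f = (toUnder γ).map g :=
      congr_arg (fun z => (ObjectProperty.ι _).map z) h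
    have := congr_arg (fun z => (z.right.app X).app (op n)) h'
    exact this

instance : (toSRes γ).Full where
  map_surjective {F G} σ := by
    let σ' : (toUnder γ).obj F ⟶ (toUnder γ).obj G := (ObjectProperty.ι _).map σ
    obtain ⟨τ, hτ⟩ := exists_natTrans G.adj σ'.right
    -- Compatibility with `η` is read off in degree `0`, where `rX ⟶ rX ⊗ Δ[0]` is invertible and
    -- can be cancelled.
    have hw (X : C) : F.η.app X ≫ τ.app ((VCat.r C).obj X) = G.η.app X := by
      have h1 : (F.η.app X ≫ F.R.map (toJ X ⦋0⦌)) ≫ (σ'.right.app X).app (op ⦋0⦌) =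
          G.η.app X ≫ G.R.map (toJ X ⦋0⦌) :=
        NatTrans.congr_app (NatTrans.congr_app (Under.w σ') X) (op ⦋0⦌)
      have h2 := τ.naturality (toJ X ⦋0⦌)
      rw [← cancel_mono (G.R.map (toJ X ⦋0⦌)), Category.assoc, ← h2, hτ, ← h1]
      exact (Category.assoc _ _ _).symm
    refine ⟨{ τ := τ, fac := by ext X; exact hw X }, ?_⟩
    apply ObjectProperty.hom_ext
    apply Under.UnderMorphism.ext
    ext X n
    exact hτ X n.unop

end CoFact


/-! ## From simplicial resolutions to co-factorizations -/

section

open VCat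

variable {C : Type v} [SmallCategory C] {M : Type u} [Category.{v} M]

lemma simplexOf_comp_map {L : M ⥤ VCat C} {R : VCat C ⥤ M} (adj : L ⊣ R)
    {m : M} {X Y : C} {n k : SimplexCategory} (x : m ⟶ R.obj (op (J X n))) (j : J Y k ⟶ J X n)
    (y : ((L.obj m).unop.obj Y).obj (op k)) (h : j ≫ hat (simplexOf adj x) = hat y) :
    simplexOf adj (x ≫ R.map j.op) = y := by
  rw [← simplexOf_homEquiv_hat adj y, homEquiv_hat_map adj _ j y h, homEquiv_hat_simplexOf]

variable {Φ : C ⥤ SimplicialObject M} {R : VCat C ⥤ M} (adj : mapDiagramFunctor Φ ⊣ R)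

lemma simplexOf_comp {m m' : M} (f : m' ⟶ m) {X : C} {n : SimplexCategory}
    (x : m ⟶ R.obj (op (J X n))) :
    simplexOf adj (f ≫ x) = f ≫ (show m ⟶ (Φ.obj X).obj (op n) from simplexOf adj x) := by
  have h := adj.homEquiv_naturality_left_symm f x
  exact congr_arg (fun z : (mapDiagramFunctor Φ).obj m' ⟶ op (J X n) =>
    (z.unop.app X).app (op n) (Jmk (𝟙 X) (𝟙 n))) h

/-- The evaluation map `R(J X n) ⟶ (Φ X)_n`. -/
def evalJ (X : C) (n : SimplexCategory) : R.obj (op (J X n)) ⟶ (Φ.obj X).obj (op n) :=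
  simplexOf adj (𝟙 _)

/-- Here `L` is `Map(-, Φ)`, so `R(J X n)` and the degree `n` part of `Φ X` represent the same
functor; `evalJ` is the universal element. -/
lemma simplexOf_eq_comp_evalJ {m : M} {X : C} {n : SimplexCategory}
    (x : m ⟶ R.obj (op (J X n))) : simplexOf adj x = x ≫ evalJ adj X n := by
  refine Eq.trans ?_ (simplexOf_comp adj x (𝟙 _))
  rw [Category.comp_id]

/-- The inverse of the evaluation map. -/
def evalJInv (X : C) (n : SimplexCategory) : (Φ.obj X).obj (op n) ⟶ R.obj (op (J X n)) :=
  adj.homEquiv _ _ (hat (S := mapDiagram Φ ((Φ.obj X).obj (op n)))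
    (show (Φ.obj X).obj (op n) ⟶ (Φ.obj X).obj (op n) from 𝟙 _)).op

lemma evalJInv_comp_evalJ (X : C) (n : SimplexCategory) :
    evalJInv adj X n ≫ evalJ adj X n = 𝟙 _ :=
  (simplexOf_eq_comp_evalJ adj _).symm.trans (simplexOf_homEquiv_hat adj _)

lemma evalJ_comp_evalJInv (X : C) (n : SimplexCategory) :
    evalJ adj X n ≫ evalJInv adj X n = 𝟙 _ := by
  have h : simplexOf adj (evalJ adj X n ≫ evalJInv adj X n) = simplexOf adj (𝟙 _) := by
    rw [simplexOf_eq_comp_evalJ, simplexOf_eq_comp_evalJ, Category.assoc, evalJInv_comp_evalJ,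
      Category.id_comp]
    exact Category.comp_id _
  rw [← homEquiv_hat_simplexOf adj (evalJ adj X n ≫ evalJInv adj X n), h, homEquiv_hat_simplexOf]

lemma map_whiskerLeft_comp_evalJ (X : C) {n k : SimplexCategory} (θ : k ⟶ n) :
    R.map ((discreteCoyoneda C).obj (op X) ◁ (constSimplex C).map θ).op ≫ evalJ adj X k =
      evalJ adj X n ≫ (Φ.obj X).map θ.op := by
  rw [← simplexOf_eq_comp_evalJ, ← Category.id_comp (R.map _)]
  exact simplexOf_comp_map adj _ _ _ (whiskerLeft_hat θ _)

lemma map_whiskerRight_comp_evalJ {X Y : C} (g : X ⟶ Y) (n : SimplexCategory) :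
    R.map ((discreteCoyoneda C).map g.op ▷ (constSimplex C).obj n).op ≫ evalJ adj Y n =
      evalJ adj X n ≫ (Φ.map g).app (op n) := by
  rw [← simplexOf_eq_comp_evalJ, ← Category.id_comp (R.map _)]
  exact simplexOf_comp_map adj _ _ _ (whiskerRight_hat g _)

/-- The restriction of a right adjoint to `m ↦ Map(m, Φ -)` is isomorphic to `Φ`. -/
def restrJIso : restrJ R ≅ Φ :=
  NatIso.ofComponents (fun X => NatIso.ofComponents (fun n =>
    { hom := evalJ adj X n.unop
      inv := evalJInv adj X n.unop
      hom_inv_id := evalJ_comp_evalJInv adj X n.unop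
      inv_hom_id := evalJInv_comp_evalJ adj X n.unop })
    (fun φ => map_whiskerLeft_comp_evalJ adj X φ.unop))
    (fun g => by
      ext n
      exact map_whiskerRight_comp_evalJ adj g n.unop)

variable {γ : C ⥤ M} (c : γ ⋙ SimplicialObject.const M ⟶ Φ)

/-- The restriction along `rX ≅ rX ⊗ Δ[0]` of a functor on `VC`. -/
noncomputable def toJIso (R : VCat C ⥤ M) :
    VCat.r C ⋙ R ≅ restrJ R ⋙ (evaluation SimplexCategoryᵒᵖ M).obj (op ⦋0⦌) :=
  NatIso.ofComponents (fun X => R.mapIso (@asIso _ _ _ _ (toJ X ⦋0⦌) (isIso_toJ_zero X))) (fun {X Y} g => by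
    have h : (VCat.r C).map g ≫ toJ Y ⦋0⦌ = toJ X ⦋0⦌ ≫ ((tensorSimplex C).map g).app (op ⦋0⦌) :=
      congr_arg (fun t => t.app (op ⦋0⦌)) ((toTensorSimplex C).naturality g)
    exact (R.map_comp _ _).symm.trans ((congr_arg R.map h).trans (R.map_comp _ _)))

/-- The map `γ ⟶ rR` attached to a map from the constant diagram. -/
noncomputable def etaOf : γ ⟶ VCat.r C ⋙ R :=
  (show γ ⟶ Φ ⋙ (evaluation SimplexCategoryᵒᵖ M).obj (op ⦋0⦌) from
    { app := fun X => (c.app X).app (op ⦋0⦌)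
      naturality := fun _ _ g => NatTrans.congr_app (c.naturality g) (op ⦋0⦌) }) ≫
    Functor.whiskerRight (restrJIso adj).inv _ ≫ (toJIso R).inv

lemma etaOf_app_comp_zero (X : C) :
    (etaOf adj c).app X ≫ R.map (toJ X ⦋0⦌) ≫ evalJ adj X ⦋0⦌ = (c.app X).app (op ⦋0⦌) := by
  let a : γ.obj X ⟶ (Φ.obj X).obj (op ⦋0⦌) := (c.app X).app (op ⦋0⦌)
  have h : (etaOf adj c).app X = a ≫ evalJInv adj X ⦋0⦌ ≫ R.map (inv (toJ X ⦋0⦌)) := rfl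
  have h2 : R.map (inv (toJ X ⦋0⦌)) ≫ R.map (toJ X ⦋0⦌) = 𝟙 _ := by
    rw [← R.map_comp, IsIso.inv_hom_id, R.map_id]
  rw [h, Category.assoc, Category.assoc, reassoc_of% h2, evalJInv_comp_evalJ]
  exact Category.comp_id a

lemma etaOf_app_comp (X : C) (n : SimplexCategory) :
    ((etaOf adj c).app X ≫ R.map (toJ X n)) ≫ evalJ adj X n = (c.app X).app (op n) := by
  let θ : n ⟶ ⦋0⦌ := SimplexCategory.const _ _ 0
  let j : op (J X ⦋0⦌) ⟶ op (J X n) := ((tensorSimplex C).obj X).map θ.op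
  have e : toJ X n = toJ X ⦋0⦌ ≫ j :=
    (Category.id_comp _).symm.trans (((toTensorSimplex C).app X).naturality θ.op)
  have h : R.map j ≫ evalJ adj X n = evalJ adj X ⦋0⦌ ≫ (Φ.obj X).map θ.op :=
    map_whiskerLeft_comp_evalJ adj X θ
  have hc : (c.app X).app (op n) = (c.app X).app (op ⦋0⦌) ≫ (Φ.obj X).map θ.op :=
    (Category.id_comp _).symm.trans ((c.app X).naturality θ.op)
  rw [e, R.map_comp, Category.assoc, Category.assoc, h, hc, ← etaOf_app_comp_zero adj c X]
  simp only [Category.assoc]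

end

namespace CoFact

open VCat

variable {C : Type v} [SmallCategory C] {M : Type u} [Category.{v} M] [ModelCategory M]
  {γ : C ⥤ M} [HasLimits M] (Φ : SRes γ)

lemma weakEquivalence_map_of_sRes (X : C) {k n : SimplexCategoryᵒᵖ} (θ : k ⟶ n) :
    WeakEquivalence ((Φ.obj.right.obj X).map θ) := by
  let a (n : SimplexCategoryᵒᵖ) : γ.obj X ⟶ (Φ.obj.right.obj X).obj n := (Φ.obj.hom.app X).app n
  have ha (n) : WeakEquivalence (a n) := Φ.property.2 X n
  have h : a n = a k ≫ (Φ.obj.right.obj X).map θ :=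
    (Category.id_comp _).symm.trans ((Φ.obj.hom.app X).naturality θ)
  have : WeakEquivalence (a k ≫ (Φ.obj.right.obj X).map θ) := h ▸ ha n
  exact weakEquivalence_of_precomp (a k) _

/-- The co-factorization attached to a simplicial resolution. -/
noncomputable def ofSRes : CoFact (VCat.r C) γ where
  L := mapDiagramFunctor Φ.obj.right
  R := resR Φ.obj.right
  adj := resAdj Φ.obj.right
  isQuillenPair :=
    { map_cofibrations := fun f hf => (VCat.cofibrations_iff _).2 (fun X => by
        have : Cofibration f := (cofibration_iff _).2 hf
        exact (Φ.property.1 X).fibration_mapSSetMap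
          (fun θ => weakEquivalence_map_of_sRes Φ X θ) f)
      map_trivialCofibrations := fun f hf => (VCat.trivialCofibrations_iff _).2 (fun X =>
        (Φ.property.1 X).rlp_monomorphisms f hf) }
  η := etaOf (resAdj Φ.obj.right) Φ.obj.hom
  -- In degree `0` the coaugmentation of `Φ` is `η` followed by isomorphisms; cancel them by
  -- two-out-of-three.
  weakEquivalence_η X := by
    have h := etaOf_app_comp_zero (resAdj Φ.obj.right) Φ.obj.hom X
    let ε := evalJ (resAdj Φ.obj.right) X ⦋0⦌
    have : IsIso ε := ⟨_, evalJ_comp_evalJInv _ X ⦋0⦌, evalJInv_comp_evalJ _ X ⦋0⦌⟩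
    have h1 : WeakEquivalence ((Φ.obj.hom.app X).app (op ⦋0⦌)) := Φ.property.2 X _
    rw [← h] at h1
    have : WeakEquivalence ((resR Φ.obj.right).map (toJ X ⦋0⦌) ≫ ε) := inferInstance
    exact weakEquivalence_of_postcomp _ ((resR Φ.obj.right).map (toJ X ⦋0⦌) ≫ ε)

/-- The simplicial resolution attached to `ofSRes Φ` is isomorphic to `Φ`. -/
noncomputable def toUnderOfSResIso : (toUnder γ).obj (ofSRes Φ) ≅ Φ.obj :=
  Under.isoMk (restrJIso (resAdj Φ.obj.right)) (by
    ext X n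
    exact etaOf_app_comp (resAdj Φ.obj.right) Φ.obj.hom X n.unop)

instance : (toSRes γ).EssSurj where
  mem_essImage Φ := ⟨ofSRes Φ, ⟨(ObjectProperty.fullyFaithfulι _).preimageIso (toUnderOfSResIso Φ)⟩⟩

instance : (toSRes γ).IsEquivalence where

end CoFact


/-! ## Contractibility -/

/-- The zigzag is conjugated back to `D`, as the two categories may live in different universes
while the nerve comparison is between categories in the same ones. -/
lemma IsContractibleCategory.of_equivalence_zigzag {D : Type u} [Category.{v} D]
    {D' : Type u'} [Category.{v'} D'] (e : D ≌ D') (T : D' ⥤ D') (c : D')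
    (α : 𝟭 D' ⟶ T) (β : (Functor.const D').obj c ⟶ T) : IsContractibleCategory D :=
  .of_zigzag (e.functor ⋙ T ⋙ e.inverse) (e.inverse.obj c)
    (e.unit ≫ Functor.whiskerLeft e.functor (Functor.whiskerRight α e.inverse))
    { app := fun d => e.inverse.map (β.app (e.functor.obj d))
      naturality := fun X Y f => by
        have := β.naturality (e.functor.map f)
        dsimp at this ⊢
        rw [Category.id_comp] at this ⊢
        rw [this, e.inverse.map_comp] }

namespace SRes

variable {C : Type v} [SmallCategory C] {M : Type u} [Category.{v} M]
  [ModelCategory M] [HasLimits M] [HasColimits M]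
  [MorphismProperty.HasFunctorialFactorization (trivialCofibrations M) (fibrations M)]
  {γ : C ⥤ M}

variable (M) in
/-- The functorial Reedy fibrant replacement. -/
noncomputable abbrev fibrantReplacement : SimplicialObject M ⥤ SimplicialObject M :=
  injRes SimplexCategoryᵒᵖ M

variable (M) in
/-- The coaugmentation of the functorial Reedy fibrant replacement. -/
noncomputable abbrev toFibrantReplacement : 𝟭 (SimplicialObject M) ⟶ fibrantReplacement M :=
  injResι SimplexCategoryᵒᵖ M

/-- The fibrant replacement of an object under the constant diagram. -/
noncomputable def replaceUnder :
    Under (γ ⋙ SimplicialObject.const M) ⥤ Under (γ ⋙ SimplicialObject.const M) where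
  obj Φ := Under.mk (Φ.hom ≫ Functor.whiskerLeft Φ.right (toFibrantReplacement M))
  map {Φ Φ'} f := Under.homMk (Functor.whiskerRight f.right (fibrantReplacement M)) (by
    have h := Under.w f
    ext X : 2
    have h1 := (toFibrantReplacement M).naturality (f.right.app X)
    have h2 := NatTrans.congr_app h X
    refine (Category.assoc _ _ _).trans ?_
    refine (congr_arg (Φ.hom.app X ≫ ·) h1.symm).trans ?_
    refine (Category.assoc _ _ _).symm.trans ?_
    exact congr_arg (· ≫ (toFibrantReplacement M).app (Φ'.right.obj X)) h2)
  map_id Φ := by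
    ext X : 3
    exact (fibrantReplacement M).map_id _
  map_comp f g := by
    ext X : 3
    exact (fibrantReplacement M).map_comp _ _

/-- Reedy fibrancy of `Φ` is not assumed, so this covers both resolutions and the constant diagram
itself. -/
lemma prop_replaceUnder (Φ : Under (γ ⋙ SimplicialObject.const M))
    (h : ∀ (X : C) (n : SimplexCategoryᵒᵖ), WeakEquivalence ((Φ.hom.app X).app n)) :
    (∀ X : C, IsReedyFibrant ((replaceUnder.obj Φ).right.obj X)) ∧
      ∀ (X : C) (n : SimplexCategoryᵒᵖ),
        WeakEquivalence (((replaceUnder.obj Φ).hom.app X).app n) := by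
  refine ⟨fun X => isReedyFibrant_injRes _, fun X n => ?_⟩
  let a : γ.obj X ⟶ (Φ.right.obj X).obj n := (Φ.hom.app X).app n
  have ha : WeakEquivalence a := h X n
  have hb := weakEquivalence_injResι_app (I := SimplexCategoryᵒᵖ) (Φ.right.obj X) n
  exact inferInstanceAs (WeakEquivalence
    (a ≫ ((injResι SimplexCategoryᵒᵖ M).app (Φ.right.obj X)).app n))

/-- The fibrant replacement of a simplicial resolution. -/
noncomputable def replace : SRes γ ⥤ SRes γ :=
  ObjectProperty.lift _ (ObjectProperty.ι _ ⋙ replaceUnder)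
    (fun Φ => prop_replaceUnder Φ.obj Φ.property.2)

/-- The coaugmentation of the fibrant replacement. -/
noncomputable def toReplace : 𝟭 (SRes γ) ⟶ replace where
  app Φ := ObjectProperty.homMk
    (Under.homMk (Functor.whiskerLeft Φ.obj.right (toFibrantReplacement M)) rfl)
  naturality Φ Φ' f := by
    apply ObjectProperty.hom_ext
    ext X : 3
    exact (toFibrantReplacement M).naturality (f.hom.right.app X)

variable (γ) in
/-- The fibrant replacement of the constant diagram. -/
noncomputable def base : SRes γ :=
  ⟨replaceUnder.obj (Under.mk (𝟙 _)), prop_replaceUnder _ (fun X _ =>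
    inferInstanceAs (WeakEquivalence (𝟙 (γ.obj X))))⟩

/-- The map from the initial object under the constant diagram. -/
def fromConst (Φ : Under (γ ⋙ SimplicialObject.const M)) :
    Under.mk (𝟙 (γ ⋙ SimplicialObject.const M)) ⟶ Φ :=
  Under.homMk Φ.hom (Category.id_comp _)

/-- The map from the fibrant replacement of the constant diagram. -/
noncomputable def fromBase : (Functor.const (SRes γ)).obj (base γ) ⟶ replace where
  app Φ := ObjectProperty.homMk (replaceUnder.map (fromConst Φ.obj))
  naturality Φ Φ' f := by
    apply ObjectProperty.hom_ext
    refine (Category.id_comp _).trans ?_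
    -- The identity of `c_*γ` is initial among objects under it; applying the replacement functor to
    -- the maps out of it yields the natural cone.
    have h : fromConst Φ'.obj = fromConst Φ.obj ≫ f.hom := by
      ext : 1
      exact (Under.w f.hom).symm
    exact (congr_arg (fun z => replaceUnder.map z) h).trans (replaceUnder.map_comp _ f.hom)

end SRes

theorem mainTheorem12 {C : Type v} [SmallCategory C] {M : Type u} [Category.{v} M]
    [ModelCategory M] [HasLimits M] [HasColimits M]
    [MorphismProperty.HasFunctorialFactorization (cofibrations M) (trivialFibrations M)]
    [MorphismProperty.HasFunctorialFactorization (trivialCofibrations M) (fibrations M)]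
    (γ : C ⥤ M) :
    Nonempty (CoFact (VCat.r C) γ) ∧
    IsContractibleCategory (CoFact (VCat.r C) γ) ∧
    ∃ e : CoFact (VCat.r C) γ ≌ SRes γ,
      Nonempty (e.functor ⋙ ObjectProperty.ι _ ≅ CoFact.toUnder γ) :=
  ⟨⟨CoFact.ofSRes (SRes.base γ)⟩,
    .of_equivalence_zigzag (CoFact.toSRes γ).asEquivalence SRes.replace (SRes.base γ)
      SRes.toReplace SRes.fromBase,
    (CoFact.toSRes γ).asEquivalence, ⟨Iso.refl _⟩⟩
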